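/- Let $2\le r_1\le r_2$ be integers, $A_i=\{0,\dots,r_i-1\}$, and equip $A_i^{\mathbb N}$ with the distance $d_i(z,z')=r_i^{-|z\wedge z'|}$, where $|z\wedge z'|$ is the length of the longest common prefix ($d_i(z,z)=0$), and $A_1^{\mathbb N}\times A_2^{\mathbb N}$ with the maximum $d$ of $d_1$ and $d_2$; $\dim$ is the Hausdorff dimension with respect to $d$. Identify pairs of words $(w_1,w_2)$ of equal length with words over $A_1\times A_2$ and with the cylinders $[w_1]\times[w_2]$. Let $\psi$ be an almost-multiplicative function of these cylinders, that is, $\psi\ge 0$, $\psi$ is not identically zero on the words of positive length, and there is $C>0$ with $$C^{-1}\psi([w])\psi([w'])\le\psi([ww'])\le C\,\psi([w])\psi([w'])$$ for all finite (possibly empty) words $w,w'$ over $A_1\times A_2$. For a function $\rho\ge0$ of the cylinders over a finite alphabet $A$ put $P(\log\rho)=\lim_{n\to\infty}\frac1n\log\sum_{w\in A^n}\rho([w])$ when this limit exists, and suppose that $P(\log\psi)=0$. Put $s=\log r_1/\log r_2$ and, for $q\in\mathbb R$, with the convention $0^\gamma=0$ for all $\gamma\in\mathbb R$, $$I_{\psi,q}([w_1])=\sum_{w_2\in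 A_2^{|w_1|}}\psi([w_1]\times[w_2])^q,\qquad \mathcal T_\psi(q)=-\frac{P(s\log I_{\psi,q})}{\log r_1},$$ where $P(s\log I_{\psi,q})=P(\log (I_{\psi,q}^s))$ is taken over the alphabet $A_1$. For $\alpha\ge0$ let $\mathcal T_\psi^*(\alpha)=\inf_{q\in\mathbb R}(\alpha q-\mathcal T_\psi(q))\in[-\infty,\infty)$ and, writing $z|n$ for the prefix of length $n$ of $z$, let $E_\psi(\alpha)$ be the set of all $(x,y)\in A_1^{\mathbb N}\times A_2^{\mathbb N}$ such that $\psi([x|n]\times[y|n])>0$ for all $n\ge0$ and $$\lim_{n\to\infty}\frac{\log_{r_2}\psi([x|n]\times[y|n])}{-n}=\alpha .$$ Then the limits $P(s\log I_{\psi,q})$ exist for all $q\in\mathbb R$, and: (i) $\mathcal T_\psi:\mathbb R\to\mathbb R$ is concave, differentiable and non-decreasing. (ii) For every $\alpha\ge0$: if $\mathcal T_\psi^*(\alpha)>0$ then $\dim E_\psi(\alpha)=\mathcal T_\psi^*(\alpha)$, and if $\mathcal T_\psi^*(\alpha)<0$ then $E_\psi(\alpha)=\emptyset$. -/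

import Mathlib

open Filter Topology MeasureTheory

noncomputable section

/-- A real function on the cylinders of the symbolic space over the alphabet `A`: a cylinder `[w]`
is encoded by its defining word `w`, and a word of length `n` is a map `Fin n → A`.
(For an alphabet with at least two letters, `w ↦ [w]` is a bijection.) -/
abbrev CylFun (A : Type) : Type := (n : ℕ) → (Fin n → A) → ℝ

/-- Almost-multiplicative functions of cylinders: nonnegative functions, not identically zero on
the words of positive length, such that `C⁻¹ ψ[w] ψ[w'] ≤ ψ[w w'] ≤ C ψ[w] ψ[w']` for some
constant `C > 0` and all (possibly empty) words `w`, `w'`. -/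
structure AlmostMultiplicative {A : Type} (ψ : CylFun A) : Prop where
  nonneg : ∀ n (w : Fin n → A), 0 ≤ ψ n w
  nonzero : ∃ n, 1 ≤ n ∧ ∃ w : Fin n → A, ψ n w ≠ 0
  almost_mul : ∃ C : ℝ, 0 < C ∧ ∀ (n p : ℕ) (w : Fin n → A) (w' : Fin p → A),
    C⁻¹ * (ψ n w * ψ p w') ≤ ψ (n + p) (Fin.append w w') ∧
      ψ (n + p) (Fin.append w w') ≤ C * (ψ n w * ψ p w')

/-- The sequence `(1/n) log ∑_{w ∈ Aⁿ} ψ[w]`. -/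
def pressureSeq {A : Type} [Fintype A] (ψ : CylFun A) (n : ℕ) : ℝ :=
  (1 / (n : ℝ)) * Real.log (∑ w : Fin n → A, ψ n w)

/-- The topological pressure `P(log ψ)` exists and equals `p`. -/
def HasPressure {A : Type} [Fintype A] (ψ : CylFun A) (p : ℝ) : Prop :=
  Tendsto (pressureSeq ψ) atTop (𝓝 p)

/-- The topological pressure `P(log ψ) = lim (1/n) log ∑_{w ∈ Aⁿ} ψ[w]`
(meaningful when the limit exists, see `HasPressure`). -/
def pressure {A : Type} [Fintype A] (ψ : CylFun A) : ℝ :=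
  limUnder atTop (pressureSeq ψ)

/-- The power `x ^ γ` with the convention `0 ^ γ = 0` for every real `γ`, including `γ = 0`. -/
def zpw (x γ : ℝ) : ℝ := if x = 0 then 0 else x ^ γ

/-- `I_{ψ,q}[w₁] = ∑_{w₂} ψ([w₁] × [w₂]) ^ q`, the sum being over the words `w₂` on the second
alphabet that have the length of `w₁`. -/
def fiberSum {A₁ A₂ : Type} [Fintype A₂] (ψ : CylFun (A₁ × A₂)) (q : ℝ) : CylFun A₁ :=
  fun n w₁ => ∑ w₂ : Fin n → A₂, zpw (ψ n fun i => (w₁ i, w₂ i)) q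

/-- The pointwise power `ψ ^ γ` of a function of cylinders, so that `P(γ log ψ)` is
`pressure (cylPow ψ γ)`. -/
def cylPow {A : Type} (ψ : CylFun A) (γ : ℝ) : CylFun A := fun n w => zpw (ψ n w) γ

/-- The symbolic space over `{0, …, r - 1}`: infinite words `z₀ z₁ z₂ …`. -/
def SymbSpace (r : ℕ) : Type := ℕ → Fin r

/-- The prefix `z|n`. -/
def SymbSpace.pre {r : ℕ} (z : SymbSpace r) (n : ℕ) : Fin n → Fin r := fun i => z i

/-- The ultrametric distance `d(z, z') = r ^ (-|z ∧ z'|)`, where `|z ∧ z'|` is the length of the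
longest common prefix. The product of two symbolic spaces carries the maximum distance. -/
instance SymbSpace.instMetricSpace (r : ℕ) : MetricSpace (SymbSpace r) where
  dist z z' := open Classical in
    if z = z' then 0 else ((r : ℝ) ^ PiNat.firstDiff (E := fun _ => Fin r) z z')⁻¹
  dist_self z := by simp
  dist_comm z z' := by
    by_cases h : z = z'
    · subst h
      rfl
    · simp only [PiNat.firstDiff_comm (E := fun _ => Fin r) z z', h, Ne.symm h, if_false]
  dist_triangle x y z := by
    have hr : (1 : ℝ) ≤ r := by exact_mod_cast Nat.succ_le_of_lt (x 0).pos
    have hp : ∀ k : ℕ, 0 ≤ ((r : ℝ) ^ k)⁻¹ := fun k => by positivity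
    have key : ∀ k l : ℕ, k ≤ l → ((r : ℝ) ^ l)⁻¹ ≤ ((r : ℝ) ^ k)⁻¹ := fun k l h =>
      inv_anti₀ (by positivity) (pow_le_pow_right₀ hr h)
    by_cases hxz : x = z
    · simp only [hxz, if_true]
      split_ifs <;> positivity
    by_cases hxy : x = y
    · subst hxy
      simp
    by_cases hyz : y = z
    · subst hyz
      simp
    simp only [hxz, hxy, hyz, if_false]
    rcases min_le_iff.1 (PiNat.min_firstDiff_le (E := fun _ => Fin r) x y z hxz) with h | h
    · exact (key _ _ h).trans (le_add_of_nonneg_right (hp _))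
    · exact (key _ _ h).trans (le_add_of_nonneg_left (hp _))
  eq_of_dist_eq_zero := by
    intro x y h
    by_contra hne
    have hr : (0 : ℝ) < r := by exact_mod_cast (x 0).pos
    have : 0 < ((r : ℝ) ^ PiNat.firstDiff (E := fun _ => Fin r) x y)⁻¹ := by positivity
    simp only [hne, if_false] at h
    exact this.ne' h

/-- `ψ([x|n] × [y|n])`. -/
def cylValue {r₁ r₂ : ℕ} (ψ : CylFun (Fin r₁ × Fin r₂)) (z : SymbSpace r₁ × SymbSpace r₂)
    (n : ℕ) : ℝ :=
  ψ n fun i => (z.1.pre n i, z.2.pre n i)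

/-- The support of `ψ`: the points all of whose cylinders have positive `ψ`. -/
def cylSupport {r₁ r₂ : ℕ} (ψ : CylFun (Fin r₁ × Fin r₂)) : Set (SymbSpace r₁ × SymbSpace r₂) :=
  {z | ∀ n, 0 < cylValue ψ z n}

/-- The level set `E_ψ(α)`. -/
def levelSet {r₁ r₂ : ℕ} (ψ : CylFun (Fin r₁ × Fin r₂)) (α : ℝ) :
    Set (SymbSpace r₁ × SymbSpace r₂) :=
  {z | z ∈ cylSupport ψ ∧
    Tendsto (fun n : ℕ => Real.logb (r₂ : ℝ) (cylValue ψ z n) / (-(n : ℝ))) atTop (𝓝 α)}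

/-- The exponent `s = log r₁ / log r₂`. -/
def sExp (r₁ r₂ : ℕ) : ℝ := Real.log r₁ / Real.log r₂

/-- `𝒯_ψ(q) = - P(s log I_{ψ,q}) / log r₁`. -/
def Tfun {r₁ r₂ : ℕ} (ψ : CylFun (Fin r₁ × Fin r₂)) (q : ℝ) : ℝ :=
  -pressure (cylPow (fiberSum ψ q) (sExp r₁ r₂)) / Real.log r₁

/-- The Legendre transform `f*(α) = inf_q (α q - f(q))`, with values in `[-∞, ∞)`. -/
def legendre (f : ℝ → ℝ) (α : ℝ) : EReal := ⨅ q : ℝ, ((α * q - f q : ℝ) : EReal)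

end

open scoped ENNReal NNReal

/-! The balls of radius `r₂ ^ (-n)` are approximate squares: the first coordinate is known up to l =
⌈n/s⌉ letters, the second up to n letters. The central object is the Gibbs weight φ = ψ^q I_q^(s-1),
whose sums over fibers are I_q^s; P(q) denotes the growth rate of the partition sums of either.

Existence and (i). Almost multiplicativity passes to powers, products and fiber sums, and it makes
partition sums both sub- and supermultiplicative up to a constant, so that log Z_n = nP + O(1)
(`AlmostMul.tendsto_growthRate_aux`). Convexity of P is Hölder's inequality. Monotonicity holds
because P(log ψ) = 0 bounds ψ on nonempty words. For differentiability let G(t) be the growth rate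
of φ ψ^t. Hölder gives G(st) ≤ P(q + t) ≤ (1 - s) G(0) + s G(t) with equality at t = 0, so it is
enough to differentiate G at 0. The right derivative b of the convex function G is the limit of the
φ-means of (log ψ)/n: upward deviations from nb are o(n) by an exponential Chebyshev bound
(`tendsto_excess`), and they control the downward ones, since a strong negative drift in every block
would make the exponential moments grow more slowly than convexity allows (`deficit_le`). Applied to
-log ψ, the same statement gives the left derivative, and the two limits agree.

Upper bound in (ii). The masses ψ^q I_q(x|n)^(-1) I_q(x|l)^s e^(-lP) of the squares of order n have
bounded sum (`sum_squareMass_le`). At a point of the level set the logarithm of the mass is -n log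
r₂ (αq - T(q)) + s log I_q(x|l) - log I_q(x|n) + o(n), and the difference of the last two logarithms
is at least -εn for infinitely many n by a liminf argument (`frequently_le_mul_ceil_sub`). Hence few
squares are needed to cover the level set, and none can exist if αq - T(q) < 0.

Lower bound in (ii). The infimum over q need not be attained, so a penalised version of it is
minimised at a finite length n (`exists_goodLaw`). The critical point equation says that the
normalised Gibbs weight p has mean exponent close to α, and the minimal value says that H(p) + (1/s
- 1) H(πp), with πp the first marginal, is at least about n T*(α) log r₂. Independent blocks with
such laws and slowly increasing lengths are concatenated. The law of large numbers puts almost every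
resulting point in the level set and bounds the mass of the squares around it
(`BlockLaws.eventually_logMassBound_le`, `BlockLaws.measure_square_le`), and the mass distribution
principle `le_dimH_of_outerMeasure` concludes. -/

/-- The words of length `n` over `A`, as lists. -/
def wordsOf (A : Type) [Fintype A] (n : ℕ) : Finset (List A) :=
  Finset.univ.map ⟨fun w : Fin n → A => List.ofFn w, List.ofFn_injective⟩

/-! ### Words as lists, concatenation and pairs -/

section Words

variable {A B : Type} [Fintype A] [Fintype B]

theorem mem_wordsOf {n : ℕ} {w : List A} : w ∈ wordsOf A n ↔ w.length = n := by
  simp only [wordsOf, Finset.mem_map, Finset.mem_univ, true_and, Function.Embedding.coeFn_mk]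
  constructor
  · rintro ⟨f, rfl⟩
    simp
  · rintro rfl
    exact ⟨w.get, List.ofFn_get w⟩

theorem sum_wordsOf (n : ℕ) (F : List A → ℝ) :
    ∑ w ∈ wordsOf A n, F w = ∑ w : Fin n → A, F (List.ofFn w) := by
  simp [wordsOf]

theorem wordsOf_zero : wordsOf A 0 = {[]} := by
  ext w
  simp [mem_wordsOf]

theorem sum_wordsOf_add (n m : ℕ) (F : List A → ℝ) :
    ∑ w ∈ wordsOf A (n + m), F w = ∑ u ∈ wordsOf A n, ∑ v ∈ wordsOf A m, F (u ++ v) := by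
  rw [← Finset.sum_product']
  symm
  refine Finset.sum_bij' (fun p _ => p.1 ++ p.2) (fun w _ => (w.take n, w.drop n)) ?_ ?_ ?_ ?_ ?_
  · rintro ⟨u, v⟩ h
    simp only [Finset.mem_product, mem_wordsOf] at h ⊢
    simp [h.1, h.2]
  · intro w h
    simp only [Finset.mem_product, mem_wordsOf] at h ⊢
    simp [h]
  · rintro ⟨u, v⟩ h
    simp only [Finset.mem_product, mem_wordsOf] at h
    simp [← h.1]
  · intro w _
    simp
  · intros
    rfl

theorem sum_wordsOf_prod (n : ℕ) (F : List (A × B) → ℝ) :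
    ∑ w ∈ wordsOf (A × B) n, F w = ∑ u ∈ wordsOf A n, ∑ v ∈ wordsOf B n, F (u.zip v) := by
  rw [← Finset.sum_product']
  symm
  refine Finset.sum_bij' (fun p _ => p.1.zip p.2) (fun w _ => w.unzip) ?_ ?_ ?_ ?_ ?_
  · rintro ⟨u, v⟩ h
    simp only [Finset.mem_product, mem_wordsOf] at h ⊢
    simp [h.1, h.2]
  · intro w h
    simp only [Finset.mem_product, mem_wordsOf] at h ⊢
    simp [h]
  · rintro ⟨u, v⟩ h
    simp only [Finset.mem_product, mem_wordsOf] at h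
    exact List.unzip_zip (h.1.trans h.2.symm)
  · intro w _
    exact List.zip_unzip w
  · intros
    rfl

end Words

/-! ### Almost multiplicative functions and the growth of their partition sums -/

/-- `F` is almost multiplicative with constant `C` for the concatenation of words. -/
structure AlmostMul {A : Type} (C : ℝ) (F : List A → ℝ) : Prop where
  one_le : 1 ≤ C
  nonneg : ∀ w, 0 ≤ F w
  lower : ∀ u v, C⁻¹ * (F u * F v) ≤ F (u ++ v)
  upper : ∀ u v, F (u ++ v) ≤ C * (F u * F v)

/-- The partition function `∑_{|w| = n} F w`. -/
noncomputable def partSum {A : Type} [Fintype A] (F : List A → ℝ) (n : ℕ) : ℝ :=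
  ∑ w ∈ wordsOf A n, F w

/-- The growth rate of the partition function. -/
noncomputable def growthRate {A : Type} [Fintype A] (F : List A → ℝ) : ℝ :=
  limUnder atTop fun n : ℕ => 1 / (n : ℝ) * Real.log (partSum F n)

theorem zpw_nonneg {x : ℝ} (hx : 0 ≤ x) (γ : ℝ) : 0 ≤ zpw x γ := by
  unfold zpw
  split_ifs
  · exact le_rfl
  · positivity

theorem zpw_zero_left (γ : ℝ) : zpw 0 γ = 0 := by simp [zpw]

theorem zpw_of_pos {x : ℝ} (hx : 0 < x) (γ : ℝ) : zpw x γ = x ^ γ := by simp [zpw, hx.ne']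

theorem zpw_pos {x : ℝ} (hx : 0 < x) (γ : ℝ) : 0 < zpw x γ := by
  rw [zpw_of_pos hx]
  positivity

theorem zpw_eq_zero {x : ℝ} (hx : 0 ≤ x) (γ : ℝ) : zpw x γ = 0 ↔ x = 0 := by
  rcases hx.eq_or_lt with rfl | h
  · simp [zpw_zero_left]
  · simp [(zpw_pos h γ).ne', h.ne']

theorem log_zpw {x : ℝ} (hx : 0 ≤ x) (γ : ℝ) : Real.log (zpw x γ) = γ * Real.log x := by
  rcases hx.eq_or_lt with rfl | h
  · simp [zpw_zero_left]
  · rw [zpw_of_pos h, Real.log_rpow h]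

namespace AlmostMul

variable {A B : Type} {C : ℝ} {F : List A → ℝ}

theorem pos_const (h : AlmostMul C F) : 0 < C := zero_lt_one.trans_le h.one_le

/-- The lower inequality makes the support stable under concatenation, the upper one makes it stable
under passing to prefixes and suffixes. -/
theorem pos_append (h : AlmostMul C F) {u v : List A} : 0 < F (u ++ v) ↔ 0 < F u ∧ 0 < F v := by
  constructor
  · intro huv
    have h1 : 0 < F u * F v := pos_of_mul_pos_right (huv.trans_le (h.upper u v)) h.pos_const.le
    rcases (h.nonneg u).eq_or_lt with h0 | h0
    · simp [← h0] at h1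
    · exact ⟨h0, pos_of_mul_pos_right h1 h0.le⟩
  · rintro ⟨hu, hv⟩
    have := h.pos_const
    exact lt_of_lt_of_le (by positivity) (h.lower u v)

theorem abs_log_append (h : AlmostMul C F) {u v : List A} (huv : 0 < F (u ++ v)) :
    |Real.log (F (u ++ v)) - Real.log (F u) - Real.log (F v)| ≤ Real.log C := by
  obtain ⟨hu, hv⟩ := h.pos_append.1 huv
  have hC := h.pos_const
  have h1 := Real.log_le_log (by positivity) (h.lower u v)
  have h2 := Real.log_le_log huv (h.upper u v)
  rw [Real.log_mul (by positivity) (by positivity), Real.log_mul hu.ne' hv.ne', Real.log_inv] at h1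
  rw [Real.log_mul (by positivity) (by positivity), Real.log_mul hu.ne' hv.ne'] at h2
  rw [abs_le]
  constructor <;> linarith

/-- Peeling off one letter changes log F by a bounded amount. Letters of value 0 do no harm to the
maximum over letters since `Real.log 0 = 0`. -/
theorem exists_abs_log_le [Finite A] (h : AlmostMul C F) :
    ∃ b : ℝ, 0 < b ∧ ∀ w, 0 < F w → |Real.log (F w)| ≤ b * (w.length + 1) := by
  have := Fintype.ofFinite A
  obtain ⟨M, hM⟩ : ∃ M : ℝ, ∀ a : A, |Real.log (F [a])| ≤ M := by
    obtain ⟨M, hM⟩ := (Set.finite_range fun a : A => |Real.log (F [a])|).bddAbove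
    exact ⟨M, fun a => hM ⟨a, rfl⟩⟩
  have hC : 0 ≤ Real.log C := Real.log_nonneg h.one_le
  refine ⟨max M 0 + Real.log C + |Real.log (F [])| + 1, by positivity, fun w => ?_⟩
  induction w with
  | nil =>
    intro _
    simp only [List.length_nil, Nat.cast_zero, zero_add, mul_one]
    have := le_max_right M 0
    linarith
  | cons a w ih =>
    intro hw
    have hw' : 0 < F ([a] ++ w) := hw
    obtain ⟨_, h2⟩ := h.pos_append.1 hw'
    have h3 := ih h2
    have h4 := h.abs_log_append hw'
    have h5 := hM a
    have h6 := le_max_left M 0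
    have h7 := abs_nonneg (Real.log (F []))
    simp only [List.singleton_append] at h4
    rw [List.length_cons]
    push_cast
    rw [abs_le] at h3 h4 h5 ⊢
    constructor <;> nlinarith

/-- On the support log F is additive up to log C, and a factor q of either sign scales this error by
|q|. Off the support the convention 0^q = 0 preserves both bounds. -/
theorem zpw (h : AlmostMul C F) (q : ℝ) : AlmostMul (C ^ |q|) fun w => zpw (F w) q := by
  have hC := h.pos_const
  have key : ∀ u v, 0 < F (u ++ v) →
      |q * Real.log (F (u ++ v)) - (q * Real.log (F u) + q * Real.log (F v))|
        ≤ |q| * Real.log C := by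
    intro u v huv
    have := h.abs_log_append huv
    rw [← mul_add, ← mul_sub, abs_mul, ← sub_sub]
    gcongr
  have hexp : ∀ w, 0 < F w → _root_.zpw (F w) q = Real.exp (q * Real.log (F w)) := by
    intro w hw
    rw [zpw_of_pos hw, Real.rpow_def_of_pos hw, mul_comm]
  have hCe : C ^ |q| = Real.exp (|q| * Real.log C) := by
    rw [Real.rpow_def_of_pos hC, mul_comm]
  have hzero : ∀ u v, F (u ++ v) = 0 → F u = 0 ∨ F v = 0 := by
    intro u v huv
    by_contra hcon
    push Not at hcon
    have := h.pos_append.2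
      ⟨(h.nonneg u).lt_of_ne' hcon.1, (h.nonneg v).lt_of_ne' hcon.2⟩
    exact this.ne' huv
  refine ⟨Real.one_le_rpow h.one_le (abs_nonneg q), fun w => zpw_nonneg (h.nonneg w) q, ?_, ?_⟩
  · intro u v
    rcases (h.nonneg (u ++ v)).eq_or_lt with h0 | h0
    · rcases hzero u v h0.symm with h1 | h1 <;>
      simp [h1, zpw_zero_left, zpw_nonneg (h.nonneg _) q]
    · obtain ⟨hu, hv⟩ := h.pos_append.1 h0
      simp only [hexp _ hu, hexp _ hv, hexp _ h0, hCe]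
      rw [← Real.exp_neg, ← Real.exp_add, ← Real.exp_add, Real.exp_le_exp]
      have := abs_le.1 (key u v h0)
      linarith
  · intro u v
    rcases (h.nonneg (u ++ v)).eq_or_lt with h0 | h0
    · rw [← h0, zpw_zero_left]
      have := zpw_nonneg (h.nonneg u) q
      have := zpw_nonneg (h.nonneg v) q
      positivity
    · obtain ⟨hu, hv⟩ := h.pos_append.1 h0
      simp only [hexp _ hu, hexp _ hv, hexp _ h0, hCe]
      rw [← Real.exp_add, ← Real.exp_add, Real.exp_le_exp]
      have := abs_le.1 (key u v h0)
      linarith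

theorem mul {C' : ℝ} {G : List A → ℝ} (h : AlmostMul C F) (h' : AlmostMul C' G) :
    AlmostMul (C * C') fun w => F w * G w := by
  have hC := h.pos_const
  have hC' := h'.pos_const
  refine ⟨one_le_mul_of_one_le_of_one_le h.one_le h'.one_le,
    fun w => mul_nonneg (h.nonneg w) (h'.nonneg w), fun u v => ?_, fun u v => ?_⟩
  · calc (C * C')⁻¹ * (F u * G u * (F v * G v)) = (C⁻¹ * (F u * F v)) * (C'⁻¹ * (G u * G v)) := by
          rw [mul_inv]
          ring
      _ ≤ _ := by
          have := h'.nonneg u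
          have := h'.nonneg v
          have := h.nonneg (u ++ v)
          gcongr
          · exact h.lower u v
          · exact h'.lower u v
  · calc F (u ++ v) * G (u ++ v) ≤ (C * (F u * F v)) * (C' * (G u * G v)) := by
          have := h.nonneg u
          have := h.nonneg v
          have := h'.nonneg (u ++ v)
          gcongr
          · exact h.upper u v
          · exact h'.upper u v
      _ = _ := by ring

theorem comp_map (h : AlmostMul C F) (f : B → A) : AlmostMul C fun w : List B => F (w.map f) :=
  ⟨h.one_le, fun w => h.nonneg _, fun u v => by simpa using h.lower (u.map f) (v.map f),
    fun u v => by simpa using h.upper (u.map f) (v.map f)⟩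

end AlmostMul

/-- The sums of a function of pairs of words over the second word. -/
noncomputable def fiberPart {A B : Type} [Fintype B] (F : List (A × B) → ℝ) (u : List A) : ℝ :=
  ∑ v ∈ wordsOf B u.length, F (u.zip v)

namespace AlmostMul

variable {A B : Type} {C : ℝ}

/-- A second word of length |u| + |v| splits uniquely, so the fiber sum over uv is a double sum and
the bounds hold term by term with the same constant. -/
theorem fiberPart [Fintype B] {F : List (A × B) → ℝ} (h : AlmostMul C F) :
    AlmostMul C (fiberPart F) := by
  have key : ∀ u v : List A, _root_.fiberPart F (u ++ v) =
      ∑ u' ∈ wordsOf B u.length, ∑ v' ∈ wordsOf B v.length, F (u.zip u' ++ v.zip v') := by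
    intro u v
    rw [_root_.fiberPart, List.length_append, sum_wordsOf_add]
    refine Finset.sum_congr rfl fun u' hu' => Finset.sum_congr rfl fun v' _ => ?_
    rw [List.zip_append (mem_wordsOf.1 hu').symm]
  refine ⟨h.one_le, fun u => Finset.sum_nonneg fun _ _ => h.nonneg _, fun u v => ?_, fun u v => ?_⟩
  · rw [key, _root_.fiberPart, _root_.fiberPart, Finset.sum_mul_sum, Finset.mul_sum]
    refine Finset.sum_le_sum fun u' _ => ?_
    rw [Finset.mul_sum]
    exact Finset.sum_le_sum fun v' _ => h.lower _ _
  · rw [key, _root_.fiberPart, _root_.fiberPart, Finset.sum_mul_sum, Finset.mul_sum]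
    refine Finset.sum_le_sum fun u' _ => ?_
    rw [Finset.mul_sum]
    exact Finset.sum_le_sum fun v' _ => h.upper _ _

variable [Fintype A] {F : List A → ℝ}

theorem partSum_nonneg (h : AlmostMul C F) (n : ℕ) : 0 ≤ partSum F n :=
  Finset.sum_nonneg fun _ _ => h.nonneg _

theorem partSum_add_le (h : AlmostMul C F) (n m : ℕ) :
    partSum F (n + m) ≤ C * (partSum F n * partSum F m) := by
  rw [partSum, sum_wordsOf_add, partSum, partSum, Finset.sum_mul_sum, Finset.mul_sum]
  refine Finset.sum_le_sum fun u _ => ?_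
  rw [Finset.mul_sum]
  exact Finset.sum_le_sum fun v _ => h.upper u v

theorem le_partSum_add (h : AlmostMul C F) (n m : ℕ) :
    C⁻¹ * (partSum F n * partSum F m) ≤ partSum F (n + m) := by
  rw [partSum, partSum, partSum, sum_wordsOf_add, Finset.sum_mul_sum, Finset.mul_sum]
  refine Finset.sum_le_sum fun u _ => ?_
  rw [Finset.mul_sum]
  exact Finset.sum_le_sum fun v _ => h.lower u v

theorem partSum_pos (h : AlmostMul C F) (h1 : 0 < partSum F 1) (n : ℕ) : 0 < partSum F n := by
  have hC := h.pos_const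
  induction n with
  | zero =>
    have h2 := h1.trans_le (h.partSum_add_le 0 1)
    have h3 := pos_of_mul_pos_right h2 hC.le
    exact pos_of_mul_pos_left h3 h1.le
  | succ n ih => exact lt_of_lt_of_le (by positivity) (h.le_partSum_add n 1)

/-- After adding log C, both log Z_n and -log Z_n are subadditive. By Fekete's lemma their averages
converge, to opposite limits; each limit is also an infimum, which gives the error log C uniformly
in n ≥ 1. -/
theorem tendsto_growthRate_aux (h : AlmostMul C F) (h1 : 0 < partSum F 1) :
    ∃ P : ℝ, Tendsto (fun n : ℕ => 1 / (n : ℝ) * Real.log (partSum F n)) atTop (𝓝 P) ∧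
      ∀ n : ℕ, n ≠ 0 → |Real.log (partSum F n) - n * P| ≤ Real.log C := by
  have hC := h.pos_const
  have hC0 := Real.log_nonneg h.one_le
  have hpos := h.partSum_pos h1
  have hab : ∀ m n, |Real.log (partSum F (m + n)) - Real.log (partSum F m)
      - Real.log (partSum F n)| ≤ Real.log C := by
    intro m n
    have hm := hpos m
    have hn := hpos n
    have e1 := Real.log_le_log (by positivity) (h.le_partSum_add m n)
    have e2 := Real.log_le_log (hpos _) (h.partSum_add_le m n)
    rw [Real.log_mul (by positivity) (by positivity), Real.log_mul hm.ne' hn.ne', Real.log_inv] at e1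
    rw [Real.log_mul (by positivity) (by positivity), Real.log_mul hm.ne' hn.ne'] at e2
    rw [abs_le]
    constructor <;> linarith
  have hlin : ∃ b : ℝ, 0 ≤ b ∧ ∀ n : ℕ, |Real.log (partSum F n)| ≤ b * (n + 1) := by
    refine ⟨|Real.log (partSum F 0)| + |Real.log (partSum F 1)| + Real.log C, by positivity,
      fun n => ?_⟩
    induction n with
    | zero =>
      have := abs_nonneg (Real.log (partSum F 1))
      simp only [Nat.cast_zero, zero_add, mul_one]
      linarith
    | succ n ih =>
      have e := abs_le.1 (hab n 1)
      have e1 := abs_le.1 (le_refl |Real.log (partSum F 1)|)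
      have e2 := abs_nonneg (Real.log (partSum F 0))
      rw [abs_le] at ih ⊢
      push_cast
      constructor <;> nlinarith
  obtain ⟨b, hb0, hb⟩ := hlin
  have hU : Subadditive fun n => Real.log (partSum F n) + Real.log C := by
    intro m n
    have := abs_le.1 (hab m n)
    simp only
    linarith
  have hV : Subadditive fun n => -Real.log (partSum F n) + Real.log C := by
    intro m n
    have := abs_le.1 (hab m n)
    simp only
    linarith
  have hbd : ∀ f : ℕ → ℝ, (∀ n, |f n| ≤ b * (n + 1)) →
      BddBelow (Set.range fun n : ℕ => (f n + Real.log C) / n) := by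
    intro f hf
    refine ⟨-(2 * b), ?_⟩
    rintro _ ⟨n, rfl⟩
    rcases Nat.eq_zero_or_pos n with rfl | hn
    · simp only [Nat.cast_zero, div_zero]
      linarith
    · have hn' : (1 : ℝ) ≤ n := by exact_mod_cast hn
      simp only
      rw [le_div_iff₀ (by positivity)]
      have := abs_le.1 (hf n)
      nlinarith
  have hbU := hbd _ hb
  have hbV := hbd (fun n => -Real.log (partSum F n)) (by simpa using hb)
  have lU := hU.tendsto_lim hbU
  have lV := hV.tendsto_lim hbV
  have hz : Tendsto (fun n : ℕ => 2 * Real.log C / (n : ℝ)) atTop (𝓝 0) :=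
    tendsto_const_div_atTop_nhds_zero_nat _
  have hsum : hU.lim + hV.lim = 0 := by
    refine tendsto_nhds_unique (lU.add lV) (hz.congr fun n => ?_)
    ring
  have hz' : Tendsto (fun n : ℕ => Real.log C / (n : ℝ)) atTop (𝓝 0) :=
    tendsto_const_div_atTop_nhds_zero_nat _
  refine ⟨hU.lim, ?_, fun n hn => ?_⟩
  · have := lU.sub hz'
    rw [sub_zero] at this
    refine this.congr fun n => ?_
    ring
  · have hn' : (0 : ℝ) < n := by positivity
    have e1 := hU.lim_le_div hbU hn
    have e2 := hV.lim_le_div hbV hn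
    rw [le_div_iff₀ hn'] at e1 e2
    have e3 : hV.lim = -hU.lim := by linarith
    rw [e3] at e2
    rw [abs_le]
    constructor <;> linarith

theorem tendsto_growthRate (h : AlmostMul C F) (h1 : 0 < partSum F 1) :
    Tendsto (fun n : ℕ => 1 / (n : ℝ) * Real.log (partSum F n)) atTop (𝓝 (growthRate F)) := by
  obtain ⟨P, hP, -⟩ := h.tendsto_growthRate_aux h1
  rwa [growthRate, hP.limUnder_eq]

theorem abs_log_partSum_sub_le (h : AlmostMul C F) (h1 : 0 < partSum F 1) {n : ℕ} (hn : n ≠ 0) :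
    |Real.log (partSum F n) - n * growthRate F| ≤ Real.log C := by
  obtain ⟨P, hP, hP'⟩ := h.tendsto_growthRate_aux h1
  rw [growthRate, hP.limUnder_eq]
  exact hP' n hn

theorem partSum_le_exp (h : AlmostMul C F) (h1 : 0 < partSum F 1) {n : ℕ} (hn : n ≠ 0) :
    partSum F n ≤ C * Real.exp (n * growthRate F) := by
  have := abs_le.1 (h.abs_log_partSum_sub_le h1 hn)
  rw [← Real.log_le_log_iff (h.partSum_pos h1 n) (mul_pos h.pos_const (Real.exp_pos _)),
    Real.log_mul h.pos_const.ne' (Real.exp_pos _).ne', Real.log_exp]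
  linarith

theorem exp_le_partSum (h : AlmostMul C F) (h1 : 0 < partSum F 1) {n : ℕ} (hn : n ≠ 0) :
    C⁻¹ * Real.exp (n * growthRate F) ≤ partSum F n := by
  have := abs_le.1 (h.abs_log_partSum_sub_le h1 hn)
  rw [← Real.log_le_log_iff (mul_pos (inv_pos.2 h.pos_const) (Real.exp_pos _))
    (h.partSum_pos h1 n),
    Real.log_mul (inv_pos.2 h.pos_const).ne' (Real.exp_pos _).ne', Real.log_exp, Real.log_inv]
  linarith

end AlmostMul

/-! ### Exponential tilts: convexity and differentiability of the growth rate -/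

theorem sum_rpow_mul_rpow_le {ι : Type*} (S : Finset ι) (f g : ι → ℝ) (hf : ∀ i ∈ S, 0 ≤ f i)
    (hg : ∀ i ∈ S, 0 ≤ g i) {a b : ℝ} (ha : 0 < a) (hb : 0 < b) (hab : a + b = 1) :
    ∑ i ∈ S, f i ^ a * g i ^ b ≤ (∑ i ∈ S, f i) ^ a * (∑ i ∈ S, g i) ^ b := by
  have hpq : a⁻¹.HolderConjugate b⁻¹ := by
    rw [Real.holderConjugate_iff]
    refine ⟨?_, by simpa using hab⟩
    rw [one_lt_inv₀ ha]
    linarith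
  have := Real.inner_le_Lp_mul_Lq_of_nonneg S hpq (f := fun i => f i ^ a) (g := fun i => g i ^ b)
    (fun i hi => Real.rpow_nonneg (hf i hi) a) (fun i hi => Real.rpow_nonneg (hg i hi) b)
  simp only [one_div, inv_inv] at this
  refine this.trans_eq ?_
  congr 2
  · refine Finset.sum_congr rfl fun i hi => ?_
    rw [← Real.rpow_mul (hf i hi), mul_inv_cancel₀ ha.ne', Real.rpow_one]
  · refine Finset.sum_congr rfl fun i hi => ?_
    rw [← Real.rpow_mul (hg i hi), mul_inv_cancel₀ hb.ne', Real.rpow_one]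

/-- `X` is almost additive with constant `c` on the words that `φ` charges. -/
structure AlmostAdd {A : Type} (φ : List A → ℝ) (c : ℝ) (X : List A → ℝ) : Prop where
  nonneg : 0 ≤ c
  bound : ∀ u v, 0 < φ (u ++ v) → |X (u ++ v) - X u - X v| ≤ c

/-- The exponential tilt of the weight `φ` by `t X`. -/
noncomputable def expTilt {A : Type} (φ X : List A → ℝ) (t : ℝ) (w : List A) : ℝ :=
  φ w * Real.exp (t * X w)

section Tilt

variable {A : Type} {C c : ℝ} {φ X : List A → ℝ}

theorem AlmostAdd.neg (hX : AlmostAdd φ c X) : AlmostAdd φ c fun w => -X w :=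
  ⟨hX.nonneg, fun u v h => by
    rw [← abs_neg]
    convert hX.bound u v h using 2
    ring⟩

theorem expTilt_zero : expTilt φ X 0 = φ := by
  ext w
  simp [expTilt]

/-- Control of X on the support of φ suffices: if φ vanishes on uv, the lower inequality forces φ(u)
φ(v) = 0. -/
theorem AlmostMul.expTilt (h : AlmostMul C φ) (hX : AlmostAdd φ c X) (t : ℝ) :
    AlmostMul (C * Real.exp (|t| * c)) (expTilt φ X t) := by
  have hC := h.pos_const
  have hc := hX.nonneg
  have key : ∀ u v, 0 < φ (u ++ v) →
      |t * X (u ++ v) - (t * X u + t * X v)| ≤ |t| * c := by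
    intro u v huv
    have := hX.bound u v huv
    rw [← mul_add, ← mul_sub, abs_mul, ← sub_sub]
    gcongr
  have hnn : ∀ w, 0 ≤ _root_.expTilt φ X t w := fun w =>
    mul_nonneg (h.nonneg w) (Real.exp_pos _).le
  refine ⟨one_le_mul_of_one_le_of_one_le h.one_le (Real.one_le_exp (by positivity)), hnn,
    fun u v => ?_, fun u v => ?_⟩
  · rcases (h.nonneg (u ++ v)).eq_or_lt with h0 | h0
    · have h1 := h.lower u v
      rw [← h0] at h1
      have h2 : φ u * φ v = 0 := by
        have h3 := mul_nonneg (h.nonneg u) (h.nonneg v)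
        have h4 : 0 < C⁻¹ := inv_pos.2 hC
        nlinarith
      calc _ = (C * Real.exp (|t| * c))⁻¹ * ((φ u * φ v) *
            (Real.exp (t * X u) * Real.exp (t * X v))) := by
            simp only [_root_.expTilt]
            ring
        _ = 0 := by rw [h2]; ring
        _ ≤ _ := hnn _
    · calc _ = (C⁻¹ * (φ u * φ v)) * ((Real.exp (|t| * c))⁻¹ *
            (Real.exp (t * X u) * Real.exp (t * X v))) := by
            simp only [_root_.expTilt, mul_inv]
            ring
        _ ≤ φ (u ++ v) * Real.exp (t * X (u ++ v)) := by
            refine mul_le_mul (h.lower u v) ?_ (by positivity) h0.le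
            rw [← Real.exp_neg, ← Real.exp_add, ← Real.exp_add, Real.exp_le_exp]
            have := abs_le.1 (key u v h0)
            linarith
  · rcases (h.nonneg (u ++ v)).eq_or_lt with h0 | h0
    · have : _root_.expTilt φ X t (u ++ v) = 0 := by simp [_root_.expTilt, ← h0]
      rw [this]
      have := hnn u
      have := hnn v
      positivity
    · calc φ (u ++ v) * Real.exp (t * X (u ++ v)) ≤ (C * (φ u * φ v)) * (Real.exp (|t| * c) *
            (Real.exp (t * X u) * Real.exp (t * X v))) := by
            refine mul_le_mul (h.upper u v) ?_ (by positivity) (h0.le.trans (h.upper u v))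
            rw [← Real.exp_add, ← Real.exp_add, Real.exp_le_exp]
            have := abs_le.1 (key u v h0)
            linarith
        _ = _ := by
            simp only [_root_.expTilt]
            ring

variable [Fintype A]

theorem partSum_expTilt_one_pos (h : AlmostMul C φ) (h1 : 0 < partSum φ 1) (t : ℝ) :
    0 < partSum (expTilt φ X t) 1 := by
  obtain ⟨w, hw, hw'⟩ := Finset.exists_lt_of_sum_lt (s := wordsOf A 1) (f := fun _ => (0 : ℝ))
    (g := φ) (by rw [Finset.sum_const_zero]; exact h1)
  exact Finset.sum_pos' (fun w _ => mul_nonneg (h.nonneg w) (Real.exp_pos _).le)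
    ⟨w, hw, mul_pos hw' (Real.exp_pos _)⟩

/-- The growth rate of the tilted weights is a convex function of the parameter. -/
theorem convexOn_growthRate_expTilt (h : AlmostMul C φ) (h1 : 0 < partSum φ 1)
    (hX : AlmostAdd φ c X) : ConvexOn ℝ Set.univ fun t => growthRate (expTilt φ X t) := by
  rw [convexOn_iff_forall_pos]
  refine ⟨convex_univ, fun x _ y _ a b ha hb hab => ?_⟩
  have T := fun t => (h.expTilt hX t).tendsto_growthRate (partSum_expTilt_one_pos h h1 t)
  have hp := fun t => (h.expTilt hX t).partSum_pos (partSum_expTilt_one_pos h h1 t)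
  simp only [smul_eq_mul]
  refine le_of_tendsto_of_tendsto' (T (a * x + b * y)) (((T x).const_mul a).add
    ((T y).const_mul b)) fun n => ?_
  have e : partSum (expTilt φ X (a * x + b * y)) n
      ≤ partSum (expTilt φ X x) n ^ a * partSum (expTilt φ X y) n ^ b := by
    refine le_trans (Finset.sum_le_sum fun w _ => ?_) (sum_rpow_mul_rpow_le _ _ _
      (fun w _ => (h.expTilt hX x).nonneg w) (fun w _ => (h.expTilt hX y).nonneg w) ha hb hab)
    have h0 := h.nonneg w
    rw [expTilt, expTilt, expTilt, Real.mul_rpow h0 (Real.exp_pos _).le,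
      Real.mul_rpow h0 (Real.exp_pos _).le, mul_mul_mul_comm, ← Real.rpow_add_of_nonneg h0 ha.le
      hb.le, hab, Real.rpow_one, ← Real.exp_mul, ← Real.exp_mul, ← Real.exp_add]
    apply le_of_eq
    congr 2
    ring
  have e2 := Real.log_le_log (hp _ n) e
  rw [Real.log_mul (Real.rpow_pos_of_pos (hp x n) a).ne' (Real.rpow_pos_of_pos (hp y n) b).ne',
    Real.log_rpow (hp x n), Real.log_rpow (hp y n)] at e2
  have e3 : (0 : ℝ) ≤ 1 / n := by positivity
  calc _ ≤ 1 / (n : ℝ) * _ := mul_le_mul_of_nonneg_left e2 e3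
    _ = _ := by ring

/-- The total deviation of `X` above `n b`, in the weights `φ`. -/
noncomputable def excess (φ X : List A → ℝ) (b : ℝ) (n : ℕ) : ℝ :=
  ∑ w ∈ wordsOf A n, φ w * max (X w - n * b) 0

/-- The total deviation of `X` below `n b`, in the weights `φ`. -/
noncomputable def deficit (φ X : List A → ℝ) (b : ℝ) (n : ℕ) : ℝ :=
  ∑ w ∈ wordsOf A n, φ w * max (n * b - X w) 0

/-- Exponential Chebyshev bound with t = M/n. Since the slope of the growth rate is below b + 1/M
near 0, this tilt multiplies Z_n e^(tnb) by at most a constant K, and max(x, 0) ≤ e^(tx)/t bounds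
the excess by (n/M) K Z_n, with M arbitrary. -/
theorem tendsto_excess (h : AlmostMul C φ) (h1 : 0 < partSum φ 1) (hX : AlmostAdd φ c X) {b : ℝ}
    (hb : HasDerivWithinAt (fun t => growthRate (expTilt φ X t)) b (Set.Ioi 0) 0) :
    Tendsto (fun n : ℕ => excess φ X b n / (partSum φ n * n)) atTop (𝓝 0) := by
  have hC := h.pos_const
  have hZ := h.partSum_pos h1
  -- C e^c comes from the upper bound of the tilted sum (t ≤ 1), the other C from the lower bound of
  -- Z_n, and e from the slack nt/M = 1 in the slope.
  set K : ℝ := C * Real.exp c * C * Real.exp 1 with hK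
  have hK0 : 0 < K := by positivity
  rw [Metric.tendsto_atTop]
  intro ε hε
  obtain ⟨M, hM⟩ := exists_nat_gt (K / ε)
  have hM0 : (0 : ℝ) < M := lt_trans (by positivity) hM
  have hM1 : (1 : ℝ) ≤ M := by
    have : 0 < M := by exact_mod_cast hM0
    exact_mod_cast this
  rw [hasDerivWithinAt_iff_tendsto_slope' (by simp)] at hb
  have hev := hb.eventually (gt_mem_nhds (show b < b + 1 / M by linarith [one_div_pos.2 hM0]))
  have hseq : Tendsto (fun n : ℕ => (M : ℝ) / n) atTop (𝓝[>] 0) := by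
    rw [tendsto_nhdsWithin_iff]
    refine ⟨tendsto_const_div_atTop_nhds_zero_nat _, ?_⟩
    filter_upwards [eventually_gt_atTop 0] with n hn
    have : (0 : ℝ) < n := by exact_mod_cast hn
    exact div_pos hM0 this
  obtain ⟨n₀, hn₀⟩ := eventually_atTop.1 (hseq.eventually hev)
  refine ⟨max n₀ M, fun n hn => ?_⟩
  have hnM : M ≤ n := (le_max_right _ _).trans hn
  have hMn : (M : ℝ) ≤ n := by exact_mod_cast hnM
  have hnp : (0 : ℝ) < n := by linarith
  have hnne : n ≠ 0 := by
    rintro rfl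
    simp at hnp
  have hs := hn₀ n ((le_max_left _ _).trans hn)
  set t : ℝ := M / n with ht
  have ht0 : 0 < t := by positivity
  have ht1 : t ≤ 1 := by
    rw [ht, div_le_one hnp]
    exact hMn
  have htn : t * n = M := by rw [ht]; field_simp
  rw [slope_def_field, sub_zero, div_lt_iff₀ ht0] at hs
  have hexc0 : 0 ≤ excess φ X b n :=
    Finset.sum_nonneg fun w _ => mul_nonneg (h.nonneg w) (le_max_right _ _)
  have hZn := hZ n
  rw [Real.dist_eq, sub_zero, abs_of_nonneg (by positivity), div_lt_iff₀ (by positivity)]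
  have s1 : M * excess φ X b n ≤ n * (partSum (expTilt φ X t) n * Real.exp (-(t * (n * b)))) := by
    rw [excess, partSum, Finset.sum_mul, Finset.mul_sum, Finset.mul_sum]
    refine Finset.sum_le_sum fun w _ => ?_
    have e1 : max (X w - n * b) 0 * t ≤ Real.exp (t * (X w - n * b)) := by
      rcases le_total (X w - n * b) 0 with hx | hx
      · rw [max_eq_right hx, zero_mul]
        exact (Real.exp_pos _).le
      · rw [max_eq_left hx]
        linarith [Real.add_one_le_exp (t * (X w - n * b))]
    have e2 : Real.exp (t * (X w - n * b)) = Real.exp (t * X w) * Real.exp (-(t * (n * b))) := by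
      rw [← Real.exp_add]
      congr 1
      ring
    calc (M : ℝ) * (φ w * max (X w - n * b) 0) = n * (φ w * (max (X w - n * b) 0 * t)) := by
          rw [← htn]
          ring
      _ ≤ n * (φ w * (Real.exp (t * X w) * Real.exp (-(t * (n * b))))) := by
          rw [← e2]
          have := h.nonneg w
          gcongr
      _ = _ := by
          rw [expTilt]
          ring
  have s2 := (h.expTilt hX t).partSum_le_exp (partSum_expTilt_one_pos h h1 t) hnne
  have s3 := h.exp_le_partSum h1 hnne
  have s4 : Real.exp (n * growthRate φ) ≤ C * partSum φ n := by
    have := mul_le_mul_of_nonneg_left s3 hC.le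
    rwa [← mul_assoc, mul_inv_cancel₀ hC.ne', one_mul] at this
  rw [expTilt_zero] at hs
  have s5 : partSum (expTilt φ X t) n * Real.exp (-(t * (n * b))) ≤ K * partSum φ n := by
    have e1 : Real.exp (|t| * c) ≤ Real.exp c := by
      rw [Real.exp_le_exp, abs_of_pos ht0]
      nlinarith [hX.nonneg]
    have e2 : Real.exp (n * growthRate (expTilt φ X t)) * Real.exp (-(t * (n * b)))
        ≤ Real.exp 1 * Real.exp (n * growthRate φ) := by
      rw [← Real.exp_add, ← Real.exp_add, Real.exp_le_exp]
      have e3 := mul_le_mul_of_nonneg_left hs.le hnp.le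
      have e4 : (n : ℝ) * ((b + 1 / M) * t) = t * (n * b) + 1 := by
        have : (n : ℝ) * (1 / M * t) = (t * n) * (1 / M) := by ring
        rw [add_mul, mul_add, this, htn]
        field_simp
      rw [e4] at e3
      linarith
    calc _ ≤ C * Real.exp (|t| * c) * Real.exp (n * growthRate (expTilt φ X t))
          * Real.exp (-(t * (n * b))) := by gcongr
      _ = C * Real.exp (|t| * c) * (Real.exp (n * growthRate (expTilt φ X t))
          * Real.exp (-(t * (n * b)))) := by ring
      _ ≤ C * Real.exp c * (Real.exp 1 * (C * partSum φ n)) := by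
          exact mul_le_mul (by gcongr) (e2.trans (by gcongr)) (by positivity) (by positivity)
      _ = _ := by
          rw [hK]
          ring
  have s6 : M * excess φ X b n ≤ n * (K * partSum φ n) := s1.trans (by gcongr)
  rw [div_lt_iff₀ hε] at hM
  have s7 : n * (K * partSum φ n) < M * (ε * (partSum φ n * n)) := by
    have : 0 < partSum φ n * n := by positivity
    nlinarith
  exact lt_of_mul_lt_mul_left (s6.trans_lt s7) hM0.le

/-- The weight of the words of length `|w| + k` that begin with `w`. -/
noncomputable def futureSum (φ : List A → ℝ) (k : ℕ) (w : List A) : ℝ :=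
  ∑ v ∈ wordsOf A k, φ (w ++ v)

/-- Sums of φ over extensions return φ only up to constants, whereas these weights with a decreasing
horizon are exactly consistent. Iterating over blocks therefore loses no constant per block. -/
theorem futureSum_add (n m : ℕ) (w : List A) :
    futureSum φ (n + m) w = ∑ u ∈ wordsOf A n, futureSum φ m (w ++ u) := by
  simp only [futureSum, sum_wordsOf_add, List.append_assoc]

theorem futureSum_nonneg (h : AlmostMul C φ) (k : ℕ) (w : List A) : 0 ≤ futureSum φ k w :=
  Finset.sum_nonneg fun _ _ => h.nonneg _

theorem futureSum_le (h : AlmostMul C φ) (k : ℕ) (w : List A) :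
    futureSum φ k w ≤ C * (φ w * partSum φ k) := by
  rw [futureSum, partSum, Finset.mul_sum, Finset.mul_sum]
  exact Finset.sum_le_sum fun v _ => h.upper w v

theorem le_futureSum (h : AlmostMul C φ) (k : ℕ) (w : List A) :
    C⁻¹ * (φ w * partSum φ k) ≤ futureSum φ k w := by
  rw [futureSum, partSum, Finset.mul_sum, Finset.mul_sum]
  exact Finset.sum_le_sum fun v _ => h.lower w v

/-- Quasi-independence: given the past w, the block u has its unconditional weight φ(u)/Z_n up to
C^4. Two factors C separate w, u and the future, two more recombine w with the longer future. -/
theorem futureSum_append_le (h : AlmostMul C φ) (n m : ℕ) (w u : List A) :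
    futureSum φ m (w ++ u) * partSum φ n ≤ C ^ 4 * (futureSum φ (n + m) w * φ u) := by
  have hC := h.pos_const
  have hu := h.nonneg u
  have hw := h.nonneg w
  have hn := h.partSum_nonneg n
  have hm := h.partSum_nonneg m
  have e1 : futureSum φ m (w ++ u) ≤ C * (C * (φ w * φ u) * partSum φ m) :=
    (futureSum_le h m _).trans (by gcongr; exact h.upper w u)
  have e2 : C⁻¹ * (φ w * (C⁻¹ * (partSum φ n * partSum φ m))) ≤ futureSum φ (n + m) w :=
    le_trans (by gcongr; exact h.le_partSum_add n m) (le_futureSum h (n + m) w)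
  calc _ ≤ C * (C * (φ w * φ u) * partSum φ m) * partSum φ n := by gcongr
    _ = C ^ 4 * (C⁻¹ * (φ w * (C⁻¹ * (partSum φ n * partSum φ m))) * φ u) := by
        field_simp
    _ ≤ _ := by gcongr

theorem le_futureSum_append (h : AlmostMul C φ) (n m : ℕ) (w u : List A) :
    (C ^ 4)⁻¹ * (futureSum φ (n + m) w * φ u) ≤ futureSum φ m (w ++ u) * partSum φ n := by
  have hC := h.pos_const
  have hu := h.nonneg u
  have hw := h.nonneg w
  have hn := h.partSum_nonneg n
  have hm := h.partSum_nonneg m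
  have e1 : C⁻¹ * (C⁻¹ * (φ w * φ u) * partSum φ m) ≤ futureSum φ m (w ++ u) :=
    le_trans (by gcongr; exact h.lower w u) (le_futureSum h m _)
  have e2 : futureSum φ (n + m) w ≤ C * (φ w * (C * (partSum φ n * partSum φ m))) :=
    (futureSum_le h (n + m) w).trans (by gcongr; exact h.partSum_add_le n m)
  calc _ ≤ (C ^ 4)⁻¹ * (C * (φ w * (C * (partSum φ n * partSum φ m))) * φ u) := by gcongr
    _ = C⁻¹ * (C⁻¹ * (φ w * φ u) * partSum φ m) * partSum φ n := by
        field_simp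
    _ ≤ _ := by gcongr

/-- One step of the block-by-block estimate of an exponential moment. -/
theorem expMoment_step (h : AlmostMul C φ) (h1 : 0 < partSum φ 1) (hX : AlmostAdd φ c X)
    {b t B D : ℝ} {n : ℕ} (ht : 0 < t) (htB : t * B ≤ 1)
    (hB : ∀ u ∈ wordsOf A n, |X u - n * b| ≤ B)
    (hD : D * partSum φ n = (C ^ 4)⁻¹ * deficit φ X b n - C ^ 4 * excess φ X b n) (l m : ℕ) :
    ∑ w ∈ wordsOf A (l + n), futureSum φ m w * Real.exp (t * (X w - (l + n : ℕ) * b)) ≤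
      Real.exp (t * c - t * D + (t * B) ^ 2) *
        ∑ w ∈ wordsOf A l, futureSum φ (n + m) w * Real.exp (t * (X w - l * b)) := by
  have hC := h.pos_const
  have hZ := h.partSum_pos h1 n
  rw [sum_wordsOf_add, Finset.mul_sum]
  refine Finset.sum_le_sum fun w _ => ?_
  -- Almost additivity at the junction of w and u costs the factor e^(tc).
  have step1 : ∀ u, futureSum φ m (w ++ u) * Real.exp (t * (X (w ++ u) - (l + n : ℕ) * b)) ≤
      Real.exp (t * c) * Real.exp (t * (X w - l * b)) *
        (futureSum φ m (w ++ u) * Real.exp (t * (X u - n * b))) := by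
    intro u
    rcases (futureSum_nonneg h m (w ++ u)).eq_or_lt with h0 | h0
    · simp [← h0]
    · have h2 : 0 < φ (w ++ u) := by
        rcases (h.nonneg (w ++ u)).eq_or_lt with h3 | h3
        · have := futureSum_le h m (w ++ u)
          rw [← h3] at this
          linarith
        · exact h3
      have h4 := (abs_le.1 (hX.bound w u h2)).2
      have : Real.exp (t * (X (w ++ u) - (l + n : ℕ) * b)) ≤
          Real.exp (t * c) * Real.exp (t * (X w - l * b)) * Real.exp (t * (X u - n * b)) := by
        rw [← Real.exp_add, ← Real.exp_add, Real.exp_le_exp]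
        push_cast
        nlinarith
      calc _ ≤ futureSum φ m (w ++ u) * _ := mul_le_mul_of_nonneg_left this h0.le
        _ = _ := by ring
  -- The drift of X - nb over one block given the past: quasi-independence is used from above on the
  -- positive part and from below on the negative part.
  have step2 : ∑ u ∈ wordsOf A n, futureSum φ m (w ++ u) * (X u - n * b) ≤
      -D * futureSum φ (n + m) w := by
    have e0 : ∀ u, futureSum φ m (w ++ u) * (X u - n * b) * partSum φ n ≤
        C ^ 4 * (futureSum φ (n + m) w * (φ u * max (X u - n * b) 0)) -
        (C ^ 4)⁻¹ * (futureSum φ (n + m) w * (φ u * max (n * b - X u) 0)) := by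
      intro u
      have e1 : X u - n * b = max (X u - n * b) 0 - max (n * b - X u) 0 := by
        rcases le_total (X u) (n * b) with hx | hx
        · rw [max_eq_right (by linarith), max_eq_left (by linarith)]
          ring
        · rw [max_eq_left (by linarith), max_eq_right (by linarith)]
          ring
      have e2 := mul_le_mul_of_nonneg_right (futureSum_append_le h n m w u)
        (le_max_right (X u - n * b) 0)
      have e3 := mul_le_mul_of_nonneg_right (le_futureSum_append h n m w u)
        (le_max_right (n * b - X u) 0)
      calc futureSum φ m (w ++ u) * (X u - n * b) * partSum φ n
          = futureSum φ m (w ++ u) * (max (X u - n * b) 0 - max (n * b - X u) 0)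
              * partSum φ n := by rw [← e1]
        _ = futureSum φ m (w ++ u) * partSum φ n * max (X u - n * b) 0
            - futureSum φ m (w ++ u) * partSum φ n * max (n * b - X u) 0 := by ring
        _ ≤ _ := by linarith
    refine le_of_mul_le_mul_right ?_ hZ
    rw [Finset.sum_mul]
    refine (Finset.sum_le_sum fun u _ => e0 u).trans_eq ?_
    rw [Finset.sum_sub_distrib, ← Finset.mul_sum, ← Finset.mul_sum, ← Finset.mul_sum,
      ← Finset.mul_sum]
    change C ^ 4 * (futureSum φ (n + m) w * excess φ X b n) -
      (C ^ 4)⁻¹ * (futureSum φ (n + m) w * deficit φ X b n) = _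
    calc _ = -(D * partSum φ n) * futureSum φ (n + m) w := by
          rw [hD]
          ring
      _ = _ := by ring
  -- e^x ≤ 1 + x + x² for |x| ≤ 1, the linear term being the drift; then 1 + y ≤ e^y.
  have step3 : ∑ u ∈ wordsOf A n, futureSum φ m (w ++ u) * Real.exp (t * (X u - n * b)) ≤
      Real.exp (-(t * D) + (t * B) ^ 2) * futureSum φ (n + m) w := by
    have hF := futureSum_nonneg h (n + m) w
    calc _ ≤ ∑ u ∈ wordsOf A n, (futureSum φ m (w ++ u) * (1 + (t * B) ^ 2) +
          t * (futureSum φ m (w ++ u) * (X u - n * b))) := by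
          refine Finset.sum_le_sum fun u hu => ?_
          have hu' := hB u hu
          have e1 : |t * (X u - n * b)| ≤ t * B := by
            rw [abs_mul, abs_of_pos ht]
            gcongr
          have e2 := (abs_le.1 (Real.abs_exp_sub_one_sub_id_le (e1.trans htB))).2
          have e3 : (t * (X u - n * b)) ^ 2 ≤ (t * B) ^ 2 := by
            rw [← sq_abs]
            gcongr
          calc _ ≤ futureSum φ m (w ++ u) * (1 + (t * B) ^ 2 + t * (X u - n * b)) := by
                refine mul_le_mul_of_nonneg_left ?_ (futureSum_nonneg h m _)
                linarith
            _ = _ := by ring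
      _ = futureSum φ (n + m) w * (1 + (t * B) ^ 2) +
          t * ∑ u ∈ wordsOf A n, futureSum φ m (w ++ u) * (X u - n * b) := by
          rw [Finset.sum_add_distrib, ← Finset.sum_mul, ← futureSum_add, Finset.mul_sum]
      _ ≤ futureSum φ (n + m) w * (1 + (t * B) ^ 2) + t * (-D * futureSum φ (n + m) w) := by
          gcongr
      _ = (-(t * D) + (t * B) ^ 2 + 1) * futureSum φ (n + m) w := by ring
      _ ≤ _ := by
          gcongr
          exact Real.add_one_le_exp _
  calc _ ≤ ∑ u ∈ wordsOf A n, Real.exp (t * c) * Real.exp (t * (X w - l * b)) *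
        (futureSum φ m (w ++ u) * Real.exp (t * (X u - n * b))) :=
        Finset.sum_le_sum fun u _ => step1 u
    _ ≤ Real.exp (t * c) * Real.exp (t * (X w - l * b)) *
        (Real.exp (-(t * D) + (t * B) ^ 2) * futureSum φ (n + m) w) := by
        rw [← Finset.mul_sum]
        gcongr
    _ = Real.exp (t * c - t * D + (t * B) ^ 2) *
        (futureSum φ (n + m) w * Real.exp (t * (X w - l * b))) := by
        rw [show t * c - t * D + (t * B) ^ 2 = t * c + (-(t * D) + (t * B) ^ 2) by ring,
          Real.exp_add (t * c)]
        ring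

/-- If the deficit were larger, X - nb would have in each block, whatever the past, a drift below
-c, which the junction error c cannot repair. For small t the exponential moment of X - knb over k
blocks would then decay geometrically in k, while `hb` keeps it bounded below. -/
theorem deficit_le (h : AlmostMul C φ) (h1 : 0 < partSum φ 1) (hX : AlmostAdd φ c X) {b : ℝ}
    (hb : ∀ t, 0 < t → t * b ≤ growthRate (expTilt φ X t) - growthRate φ) {n : ℕ} (hn : n ≠ 0) :
    (C ^ 4)⁻¹ * deficit φ X b n ≤ C ^ 4 * excess φ X b n + c * partSum φ n := by
  have hC := h.pos_const
  have hZ := h.partSum_pos h1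
  obtain ⟨B, hB0, hB⟩ : ∃ B : ℝ, 0 < B ∧ ∀ u ∈ wordsOf A n, |X u - n * b| ≤ B := by
    refine ⟨∑ u ∈ wordsOf A n, |X u - n * b| + 1, ?_, fun u hu => ?_⟩
    · have := Finset.sum_nonneg (s := wordsOf A n) fun u _ => abs_nonneg (X u - n * b)
      linarith
    · have := Finset.single_le_sum (f := fun u => |X u - n * b|) (fun u _ => abs_nonneg _) hu
      linarith
  set D : ℝ := ((C ^ 4)⁻¹ * deficit φ X b n - C ^ 4 * excess φ X b n) / partSum φ n with hDdef
  have hD : D * partSum φ n = (C ^ 4)⁻¹ * deficit φ X b n - C ^ 4 * excess φ X b n :=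
    div_mul_cancel₀ _ (hZ n).ne'
  have main : ∀ t, 0 < t → t * B ≤ 1 → D ≤ c + t * B ^ 2 := by
    intro t ht htB
    set ρ := Real.exp (t * c - t * D + (t * B) ^ 2) with hρ
    -- Here j counts the blocks already read and m the blocks still ahead.
    have iter : ∀ j m : ℕ, ∑ w ∈ wordsOf A (j * n), futureSum φ (m * n) w *
        Real.exp (t * (X w - (j * n : ℕ) * b)) ≤
        ρ ^ j * (futureSum φ ((m + j) * n) [] * Real.exp (t * X [])) := by
      intro j
      induction j with
      | zero =>
        intro m
        simp [wordsOf_zero]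
      | succ j ih =>
        intro m
        have e := expMoment_step h h1 hX ht htB hB hD (j * n) (m * n)
        have e2 := ih (m + 1)
        rw [show (m + 1) * n = n + m * n by ring] at e2
        rw [show (j + 1) * n = j * n + n by ring, show m + (j + 1) = m + 1 + j by ring]
        refine e.trans ?_
        exact (mul_le_mul_of_nonneg_left e2 (Real.exp_pos _).le).trans_eq (by rw [← hρ]; ring)
    set K : ℝ := C * Real.exp (|t| * c) * C with hK
    have hK0 : 0 < K := by positivity
    -- By `hb` the tilted partition sum grows at least like e^(tbkn) Z_{kn}, so ρ^k stays above a
    -- constant independent of k and ρ ≥ 1.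
    have low : ∀ k : ℕ, k ≠ 0 → K⁻¹ ≤ ρ ^ k * Real.exp (t * X []) := by
      intro k hk
      have hkn : k * n ≠ 0 := mul_ne_zero hk hn
      have e := iter k 0
      have e1 : futureSum φ ((0 + k) * n) [] = partSum φ (k * n) := by
        simp [futureSum, partSum]
      have e2 : ∑ w ∈ wordsOf A (k * n), futureSum φ (0 * n) w *
          Real.exp (t * (X w - (k * n : ℕ) * b)) =
          partSum (expTilt φ X t) (k * n) * Real.exp (-(t * ((k * n : ℕ) * b))) := by
        rw [partSum, Finset.sum_mul]
        refine Finset.sum_congr rfl fun w _ => ?_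
        rw [futureSum, zero_mul, wordsOf_zero, Finset.sum_singleton, List.append_nil, expTilt,
          mul_assoc, ← Real.exp_add]
        congr 2
        ring
      rw [e1, e2] at e
      have e3 := (h.expTilt hX t).exp_le_partSum (partSum_expTilt_one_pos h h1 t) hkn
      have e4 := h.partSum_le_exp h1 hkn
      have e5 := hb t ht
      have e6 : (C * Real.exp (|t| * c))⁻¹ * Real.exp ((k * n : ℕ) * growthRate φ) ≤
          partSum (expTilt φ X t) (k * n) * Real.exp (-(t * ((k * n : ℕ) * b))) := by
        calc _ ≤ (C * Real.exp (|t| * c))⁻¹ *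
              (Real.exp ((k * n : ℕ) * growthRate (expTilt φ X t)) *
              Real.exp (-(t * ((k * n : ℕ) * b)))) := by
              rw [← Real.exp_add]
              gcongr
              have : (0 : ℝ) ≤ (k * n : ℕ) := by positivity
              nlinarith
          _ = (C * Real.exp (|t| * c))⁻¹ *
              Real.exp ((k * n : ℕ) * growthRate (expTilt φ X t)) *
              Real.exp (-(t * ((k * n : ℕ) * b))) := by ring
          _ ≤ _ := by gcongr
      have e7 : K⁻¹ * partSum φ (k * n) ≤ (C * Real.exp (|t| * c))⁻¹ *
          Real.exp ((k * n : ℕ) * growthRate φ) := by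
        calc _ ≤ K⁻¹ * (C * Real.exp ((k * n : ℕ) * growthRate φ)) := by gcongr
          _ = _ := by
            rw [hK]
            field_simp
      refine le_of_mul_le_mul_right ?_ (hZ (k * n))
      linarith
    have hρ1 : 1 ≤ ρ := by
      by_contra hlt
      push Not at hlt
      have hρ0 : 0 ≤ ρ := (Real.exp_pos _).le
      have := (tendsto_pow_atTop_nhds_zero_of_lt_one hρ0 hlt).mul_const (Real.exp (t * X []))
      rw [zero_mul] at this
      have h2 := ge_of_tendsto this (eventually_atTop.2 ⟨1, fun k hk => low k (by omega)⟩)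
      have : 0 < K⁻¹ := by positivity
      linarith
    rw [hρ, Real.one_le_exp_iff] at hρ1
    have : 0 ≤ t * (c - D + t * B ^ 2) := by linarith
    have := nonneg_of_mul_nonneg_right this ht
    linarith
  -- The block length n, hence B, is fixed, so t → 0 removes the second-order term.
  have hDc : D ≤ c := by
    have hev : ∀ᶠ t in 𝓝[>] (0 : ℝ), D ≤ c + t * B ^ 2 := by
      have : Set.Ioo (0 : ℝ) (1 / B) ∈ 𝓝[>] (0 : ℝ) := Ioo_mem_nhdsGT (by positivity)
      filter_upwards [this] with t ht
      exact main t ht.1 ((lt_div_iff₀ hB0).1 ht.2).le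
    have hlim : Tendsto (fun t : ℝ => c + t * B ^ 2) (𝓝[>] 0) (𝓝 (c + 0 * B ^ 2)) :=
      tendsto_nhdsWithin_of_tendsto_nhds (by
        have : Continuous fun t : ℝ => c + t * B ^ 2 := by fun_prop
        exact this.tendsto 0)
    simpa using ge_of_tendsto hlim hev
  have := mul_le_mul_of_nonneg_right hDc (hZ n).le
  rw [hD] at this
  linarith

/-- The mean of X - nb is excess minus deficit, both negligible after division by n. The hypothesis
involves one side of 0 only, but the limit of the means does not know the side; this is what makes
the two one-sided derivatives coincide. -/
theorem tendsto_mean_of_hasDerivWithinAt (h : AlmostMul C φ) (h1 : 0 < partSum φ 1)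
    (hX : AlmostAdd φ c X) {b : ℝ}
    (hb : HasDerivWithinAt (fun t => growthRate (expTilt φ X t)) b (Set.Ioi 0) 0) :
    Tendsto (fun n : ℕ => (∑ w ∈ wordsOf A n, φ w * X w) / (partSum φ n * n)) atTop (𝓝 b) := by
  have hC := h.pos_const
  have hZ := h.partSum_pos h1
  have hexc := tendsto_excess h h1 hX hb
  have hslope : ∀ t, 0 < t → t * b ≤ growthRate (expTilt φ X t) - growthRate φ := by
    intro t ht
    have := (convexOn_growthRate_expTilt h h1 hX).le_slope_of_hasDerivWithinAt_Ioi
      (Set.mem_univ 0) (Set.mem_univ t) ht hb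
    rw [slope_def_field, sub_zero, expTilt_zero, le_div_iff₀ ht] at this
    linarith
  have hup : Tendsto (fun n : ℕ => C ^ 4 * (C ^ 4 * (excess φ X b n / (partSum φ n * n)) + c / n))
      atTop (𝓝 0) := by
    have := ((hexc.const_mul (C ^ 4)).add (tendsto_const_div_atTop_nhds_zero_nat c)).const_mul
      (C ^ 4)
    simpa using this
  have hdef : Tendsto (fun n : ℕ => deficit φ X b n / (partSum φ n * n)) atTop (𝓝 0) := by
    refine squeeze_zero' (Eventually.of_forall fun n => ?_) ?_ hup
    · have h2 : 0 ≤ deficit φ X b n :=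
        Finset.sum_nonneg fun w _ => mul_nonneg (h.nonneg w) (le_max_right _ _)
      have h3 := hZ n
      positivity
    · filter_upwards [eventually_ne_atTop 0] with n hn
      have hn' : (0 : ℝ) < n := by positivity
      have e := deficit_le h h1 hX hslope hn
      have h3 := hZ n
      rw [div_le_iff₀ (by positivity)]
      calc deficit φ X b n = C ^ 4 * ((C ^ 4)⁻¹ * deficit φ X b n) := by field_simp
        _ ≤ C ^ 4 * (C ^ 4 * excess φ X b n + c * partSum φ n) := by gcongr
        _ = _ := by field_simp
  have := (tendsto_const_nhds (x := b)).add (hexc.sub hdef)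
  rw [sub_zero, add_zero] at this
  refine this.congr' ?_
  filter_upwards [eventually_ne_atTop 0] with n hn
  have hn' : (0 : ℝ) < n := by positivity
  have h3 := hZ n
  rw [← sub_div, eq_div_iff (by positivity), add_mul, div_mul_cancel₀ _ (by positivity), excess,
    deficit, ← Finset.sum_sub_distrib, partSum, Finset.sum_mul, Finset.mul_sum,
    ← Finset.sum_add_distrib]
  refine Finset.sum_congr rfl fun w _ => ?_
  rcases le_total (X w) (n * b) with hx | hx
  · rw [max_eq_right (by linarith), max_eq_left (by linarith)]
    ring
  · rw [max_eq_left (by linarith), max_eq_right (by linarith)]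
    ring

/-- The growth rate of the tilted weights is differentiable at `0`. -/
theorem exists_hasDerivAt_growthRate_expTilt (h : AlmostMul C φ) (h1 : 0 < partSum φ 1)
    (hX : AlmostAdd φ c X) :
    ∃ b, HasDerivAt (fun t => growthRate (expTilt φ X t)) b 0 := by
  set L := fun t => growthRate (expTilt φ X t) with hL
  have hneg : (fun t => growthRate (expTilt φ (fun w => -X w) t)) = fun t => L (-t) := by
    ext t
    simp only [hL]
    congr 1
    ext w
    simp [expTilt]
  have hR : HasDerivWithinAt L (derivWithin L (Set.Ioi 0) 0) (Set.Ioi 0) 0 :=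
    (convexOn_growthRate_expTilt h h1 hX).hasDerivWithinAt_rightDeriv_of_mem_interior (by simp)
  have hR' := (convexOn_growthRate_expTilt h h1 hX.neg).hasDerivWithinAt_rightDeriv_of_mem_interior
    (x := 0) (by simp)
  set b := derivWithin L (Set.Ioi 0) 0
  set a := derivWithin (fun t => growthRate (expTilt φ (fun w => -X w) t)) (Set.Ioi 0) 0
  have m1 := tendsto_mean_of_hasDerivWithinAt h h1 hX hR
  have m2 := tendsto_mean_of_hasDerivWithinAt h h1 hX.neg hR'
  -- The means of -X are the opposites of the means of X, so uniqueness of limits relates the right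
  -- derivatives of t ↦ L(t) and t ↦ L(-t).
  have hab : b = -a := by
    refine tendsto_nhds_unique m1 (m2.neg.congr fun n => ?_)
    rw [← neg_div, ← Finset.sum_neg_distrib]
    congr 1
    exact Finset.sum_congr rfl fun w _ => by ring
  have hLft : HasDerivWithinAt L b (Set.Iio 0) 0 := by
    rw [hneg] at hR'
    have hc : HasDerivWithinAt (fun t : ℝ => -t) (-1) (Set.Iio 0) 0 :=
      (hasDerivAt_neg (0 : ℝ)).hasDerivWithinAt
    have h0 : HasDerivWithinAt (fun t => L (-t)) a (Set.Ioi 0) (-(0 : ℝ)) := by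
      simpa using hR'
    have h2 : HasDerivWithinAt (fun t => L (- -t)) ((-1 : ℝ) • a) (Set.Iio 0) 0 :=
      h0.scomp (0 : ℝ) hc (fun x hx => by simpa using hx)
    simp only [neg_neg] at h2
    rw [hab]
    simpa using h2
  have := hLft.Iic_of_Iio.union hR.Ici_of_Ioi
  rw [Set.Iic_union_Ici, hasDerivWithinAt_univ] at this
  exact ⟨b, this⟩

end Tilt

/-! ### The pressure of I_q^s: convexity, differentiability, monotonicity -/

theorem hasDerivAt_of_squeeze {l f u : ℝ → ℝ} {d : ℝ} (x : ℝ) (hlf : ∀ t, l t ≤ f t)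
    (hfu : ∀ t, f t ≤ u t) (hl : HasDerivAt l d x) (hu : HasDerivAt u d x) (hlx : l x = f x)
    (hux : u x = f x) : HasDerivAt f d x := by
  rw [hasDerivAt_iff_isLittleO] at *
  refine Asymptotics.IsBigO.trans_isLittleO (Asymptotics.IsBigO.of_bound 1 ?_)
    (hl.norm_left.add hu.norm_left)
  refine Eventually.of_forall fun t => ?_
  have h1 := hlf t
  have h2 := hfu t
  simp only [smul_eq_mul, Real.norm_eq_abs, hlx, hux, one_mul]
  set A := l t - f x - (t - x) * d
  set B := u t - f x - (t - x) * d
  have h3 : A ≤ f t - f x - (t - x) * d := by simp only [A]; linarith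
  have h4 : f t - f x - (t - x) * d ≤ B := by simp only [B]; linarith
  rw [abs_of_nonneg (by positivity : 0 ≤ |A| + |B|), abs_le]
  have h5 := neg_abs_le A
  have h6 := le_abs_self B
  have h7 := abs_nonneg A
  have h8 := abs_nonneg B
  constructor <;> linarith

theorem zpw_mul_exp_log {x : ℝ} (hx : 0 ≤ x) (q t : ℝ) :
    zpw x q * Real.exp (t * Real.log x) = zpw x (q + t) := by
  rcases hx.eq_or_lt with rfl | h
  · simp [zpw_zero_left]
  · rw [zpw_of_pos h, zpw_of_pos h, Real.rpow_add h, Real.rpow_def_of_pos h t, mul_comm t]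

theorem zpw_mul_zpw {x : ℝ} (hx : 0 ≤ x) (q t : ℝ) : zpw x q * zpw x t = zpw x (q + t) := by
  rcases hx.eq_or_lt with rfl | h
  · simp [zpw_zero_left]
  · rw [zpw_of_pos h, zpw_of_pos h, zpw_of_pos h, Real.rpow_add h]

theorem zpw_one_right (x : ℝ) : zpw x 1 = x := by
  unfold zpw
  split_ifs with h
  · exact h.symm
  · exact Real.rpow_one x

theorem zpw_rpow_mul_zpw_rpow {x : ℝ} (hx : 0 ≤ x) {a b : ℝ} (ha : 0 < a) (p q : ℝ) :
    zpw x p ^ a * zpw x q ^ b = zpw x (a * p + b * q) := by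
  rcases hx.eq_or_lt with rfl | h
  · simp [zpw_zero_left, Real.zero_rpow ha.ne']
  · rw [zpw_of_pos h, zpw_of_pos h, zpw_of_pos h, ← Real.rpow_mul h.le, ← Real.rpow_mul h.le,
      Real.rpow_add h, mul_comm p, mul_comm q]

theorem partSum_prod {A B : Type} [Fintype A] [Fintype B] (F : List (A × B) → ℝ) (n : ℕ) :
    partSum F n = partSum (fiberPart F) n := by
  rw [partSum, sum_wordsOf_prod, partSum]
  refine Finset.sum_congr rfl fun u hu => ?_
  rw [fiberPart, mem_wordsOf.1 hu]

section Carpet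

variable {A B : Type} [Fintype B] (Ψ : List (A × B) → ℝ) (s q : ℝ)

/-- The list version of `I_{ψ,q}`. -/
noncomputable def fibPow (u : List A) : ℝ := fiberPart (fun w => zpw (Ψ w) q) u

/-- The list version of `I_{ψ,q} ^ s`. -/
noncomputable def fibPowPow (u : List A) : ℝ := zpw (fibPow Ψ q u) s

/-- The Gibbs weight `ψ ^ q I_{ψ,q} ^ (s - 1)`, whose fiber sums are `I_{ψ,q} ^ s`. -/
noncomputable def gibbsWeight (w : List (A × B)) : ℝ :=
  zpw (Ψ w) q * zpw (fibPow Ψ q (w.map Prod.fst)) (s - 1)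

variable {Ψ s q} {C : ℝ}

theorem AlmostMul.fibPow (h : AlmostMul C Ψ) (q : ℝ) : AlmostMul (C ^ |q|) (fibPow Ψ q) :=
  (h.zpw q).fiberPart

theorem AlmostMul.fibPowPow (h : AlmostMul C Ψ) (s q : ℝ) :
    AlmostMul ((C ^ |q|) ^ |s|) (fibPowPow Ψ s q) :=
  (h.fibPow q).zpw s

theorem AlmostMul.gibbsWeight (h : AlmostMul C Ψ) (s q : ℝ) :
    AlmostMul (C ^ |q| * (C ^ |q|) ^ |s - 1|) (gibbsWeight Ψ s q) :=
  (h.zpw q).mul (((h.fibPow q).zpw (s - 1)).comp_map Prod.fst)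

theorem pos_of_gibbsWeight_pos (h : AlmostMul C Ψ) {w : List (A × B)}
    (hw : 0 < gibbsWeight Ψ s q w) : 0 < Ψ w := by
  rcases (h.nonneg w).eq_or_lt with h0 | h0
  · simp [gibbsWeight, ← h0, zpw_zero_left] at hw
  · exact h0

theorem fibPow_map_fst_pos (h : AlmostMul C Ψ) {w : List (A × B)} (hw : 0 < Ψ w) (q : ℝ) :
    0 < fibPow Ψ q (w.map Prod.fst) := by
  refine Finset.sum_pos' (fun _ _ => zpw_nonneg (h.nonneg _) q) ⟨w.map Prod.snd, ?_, ?_⟩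
  · rw [mem_wordsOf]
    simp
  · have : (w.map Prod.fst).zip (w.map Prod.snd) = w := by
      rw [← List.unzip_fst, ← List.unzip_snd, List.zip_unzip]
    simp only [this]
    exact zpw_pos hw q

theorem gibbsWeight_pos (h : AlmostMul C Ψ) {w : List (A × B)} (hw : 0 < Ψ w) (s q : ℝ) :
    0 < gibbsWeight Ψ s q w :=
  mul_pos (zpw_pos hw q) (zpw_pos (fibPow_map_fst_pos h hw q) _)

theorem AlmostMul.almostAdd_log (h : AlmostMul C Ψ) (s q : ℝ) :
    AlmostAdd (_root_.gibbsWeight Ψ s q) (Real.log C) fun w => Real.log (Ψ w) :=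
  ⟨Real.log_nonneg h.one_le, fun _ _ huv => h.abs_log_append (pos_of_gibbsWeight_pos h huv)⟩

/-- The factor I_q^(s-1) depends on the first word only and leaves the fiber sum, while the tilt by
t log Ψ turns the power q into q + t. -/
theorem fiberPart_expTilt_gibbsWeight (h : AlmostMul C Ψ) (s q t : ℝ) (u : List A) :
    fiberPart (expTilt (gibbsWeight Ψ s q) (fun w => Real.log (Ψ w)) t) u =
      fibPow Ψ (q + t) u * zpw (fibPow Ψ q u) (s - 1) := by
  rw [fiberPart, fibPow, fiberPart, Finset.sum_mul]
  refine Finset.sum_congr rfl fun v hv => ?_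
  rw [expTilt, gibbsWeight, List.map_fst_zip (mem_wordsOf.1 hv).ge,
    ← zpw_mul_exp_log (h.nonneg _) q t]
  ring

theorem fiberPart_gibbsWeight (h : AlmostMul C Ψ) (s q : ℝ) :
    fiberPart (gibbsWeight Ψ s q) = fibPowPow Ψ s q := by
  ext u
  have := fiberPart_expTilt_gibbsWeight h s q 0 u
  rw [expTilt_zero, add_zero] at this
  rw [this, fibPowPow]
  nth_rw 1 [← zpw_one_right (fibPow Ψ q u)]
  rw [zpw_mul_zpw ((h.fibPow q).nonneg u)]
  congr 1
  ring

variable [Fintype A]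

theorem partSum_gibbsWeight (h : AlmostMul C Ψ) (s q : ℝ) (n : ℕ) :
    partSum (gibbsWeight Ψ s q) n = partSum (fibPowPow Ψ s q) n := by
  rw [partSum_prod, fiberPart_gibbsWeight h]

theorem growthRate_gibbsWeight (h : AlmostMul C Ψ) (s q : ℝ) :
    growthRate (gibbsWeight Ψ s q) = growthRate (fibPowPow Ψ s q) := by
  simp only [growthRate, partSum_gibbsWeight h]

theorem partSum_gibbsWeight_one_pos (h : AlmostMul C Ψ) (h1 : 0 < partSum Ψ 1) (s q : ℝ) :
    0 < partSum (gibbsWeight Ψ s q) 1 := by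
  obtain ⟨w, hw, hw'⟩ := Finset.exists_lt_of_sum_lt (s := wordsOf (A × B) 1)
    (f := fun _ => (0 : ℝ)) (g := Ψ) (by rw [Finset.sum_const_zero]; exact h1)
  exact Finset.sum_pos' (fun w _ => (h.gibbsWeight s q).nonneg w)
    ⟨w, hw, gibbsWeight_pos h hw' s q⟩

theorem partSum_fibPowPow_one_pos (h : AlmostMul C Ψ) (h1 : 0 < partSum Ψ 1) (s q : ℝ) :
    0 < partSum (fibPowPow Ψ s q) 1 := by
  rw [← partSum_gibbsWeight h]
  exact partSum_gibbsWeight_one_pos h h1 s q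

theorem tendsto_growthRate_fibPowPow (h : AlmostMul C Ψ) (h1 : 0 < partSum Ψ 1) (s q : ℝ) :
    Tendsto (fun n : ℕ => 1 / (n : ℝ) * Real.log (partSum (fibPowPow Ψ s q) n)) atTop
      (𝓝 (growthRate (fibPowPow Ψ s q))) :=
  (h.fibPowPow s q).tendsto_growthRate (partSum_fibPowPow_one_pos h h1 s q)

theorem partSum_fibPowPow_pos (h : AlmostMul C Ψ) (h1 : 0 < partSum Ψ 1) (s q : ℝ) (n : ℕ) :
    0 < partSum (fibPowPow Ψ s q) n :=
  (h.fibPowPow s q).partSum_pos (partSum_fibPowPow_one_pos h h1 s q) n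

/-- The pressure `P(s log I_{ψ,q})` is a convex function of `q`. -/
theorem convexOn_growthRate_fibPowPow (h : AlmostMul C Ψ) (h1 : 0 < partSum Ψ 1) (hs : 0 ≤ s) :
    ConvexOn ℝ Set.univ fun q => growthRate (fibPowPow Ψ s q) := by
  rw [convexOn_iff_forall_pos]
  refine ⟨convex_univ, fun x _ y _ a b ha hb hab => ?_⟩
  have T := tendsto_growthRate_fibPowPow h h1 s
  have hp := partSum_fibPowPow_pos h h1 s
  simp only [smul_eq_mul]
  refine le_of_tendsto_of_tendsto' (T (a * x + b * y)) (((T x).const_mul a).add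
    ((T y).const_mul b)) fun n => ?_
  have hI : ∀ u, fibPow Ψ (a * x + b * y) u ≤ fibPow Ψ x u ^ a * fibPow Ψ y u ^ b := by
    intro u
    refine le_trans (Finset.sum_le_sum fun v _ => ?_) (sum_rpow_mul_rpow_le _ _ _
      (fun v _ => zpw_nonneg (h.nonneg _) x) (fun v _ => zpw_nonneg (h.nonneg _) y) ha hb hab)
    exact (zpw_rpow_mul_zpw_rpow (h.nonneg _) ha x y).ge
  have e : partSum (fibPowPow Ψ s (a * x + b * y)) n
      ≤ partSum (fibPowPow Ψ s x) n ^ a * partSum (fibPowPow Ψ s y) n ^ b := by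
    refine le_trans (Finset.sum_le_sum fun u _ => ?_) (sum_rpow_mul_rpow_le _ _ _
      (fun w _ => (h.fibPowPow s x).nonneg w) (fun w _ => (h.fibPowPow s y).nonneg w) ha hb hab)
    have hx0 := (h.fibPow x).nonneg u
    have hy0 := (h.fibPow y).nonneg u
    have hIu := hI u
    rcases ((h.fibPow (a * x + b * y)).nonneg u).eq_or_lt with h0 | h0
    · rw [fibPowPow, ← h0, zpw_zero_left]
      exact mul_nonneg (Real.rpow_nonneg (zpw_nonneg hx0 s) a)
        (Real.rpow_nonneg (zpw_nonneg hy0 s) b)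
    · have hpos := h0.trans_le hIu
      have hx1 : 0 < fibPow Ψ x u := by
        rcases hx0.eq_or_lt with h2 | h2
        · rw [← h2, Real.zero_rpow ha.ne', zero_mul] at hpos
          exact absurd hpos (lt_irrefl 0)
        · exact h2
      have hy1 : 0 < fibPow Ψ y u := by
        rcases hy0.eq_or_lt with h2 | h2
        · rw [← h2, Real.zero_rpow hb.ne', mul_zero] at hpos
          exact absurd hpos (lt_irrefl 0)
        · exact h2
      rw [fibPowPow, fibPowPow, fibPowPow, zpw_of_pos h0, zpw_of_pos hx1, zpw_of_pos hy1,
        ← Real.rpow_mul hx0, ← Real.rpow_mul hy0, mul_comm s a, mul_comm s b,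
        Real.rpow_mul hx0, Real.rpow_mul hy0, ← Real.mul_rpow (by positivity) (by positivity)]
      exact Real.rpow_le_rpow h0.le hIu hs
  have e2 := Real.log_le_log (hp _ n) e
  rw [Real.log_mul (Real.rpow_pos_of_pos (hp x n) a).ne' (Real.rpow_pos_of_pos (hp y n) b).ne',
    Real.log_rpow (hp x n), Real.log_rpow (hp y n)] at e2
  have e3 : (0 : ℝ) ≤ 1 / n := by positivity
  calc _ ≤ 1 / (n : ℝ) * _ := mul_le_mul_of_nonneg_left e2 e3
    _ = _ := by ring

/-- Where I_q and I_{q+t} are positive, I_{q+t}^s = (I_q^s)^(1-s) (I_{q+t} I_q^(s-1))^s; Hölder is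
then applied to the sum over first words. For s = 1 the first exponent is 0 and the bound is
immediate. -/
theorem partSum_fibPowPow_le (h : AlmostMul C Ψ) (hs : 0 < s) (hs1 : s ≤ 1) (q t : ℝ) (n : ℕ) :
    partSum (fibPowPow Ψ s (q + t)) n ≤ partSum (fibPowPow Ψ s q) n ^ (1 - s) *
      partSum (expTilt (gibbsWeight Ψ s q) (fun w => Real.log (Ψ w)) t) n ^ s := by
  rw [partSum_prod (expTilt _ _ _)]
  have hz : ∀ u, fibPow Ψ q u = 0 → fibPow Ψ (q + t) u = 0 := by
    intro u hu
    rw [fibPow, fiberPart, Finset.sum_eq_zero_iff_of_nonneg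
      fun v _ => zpw_nonneg (h.nonneg _) q] at hu
    refine Finset.sum_eq_zero fun v hv => ?_
    have := (zpw_eq_zero (h.nonneg _) q).1 (hu v hv)
    simp only [this, zpw_zero_left]
  have key : ∀ u, fibPowPow Ψ s (q + t) u ≤ fibPowPow Ψ s q u ^ (1 - s) *
      fiberPart (expTilt (gibbsWeight Ψ s q) (fun w => Real.log (Ψ w)) t) u ^ s := by
    intro u
    rw [fiberPart_expTilt_gibbsWeight h, fibPowPow, fibPowPow]
    have h2 := (h.fibPow (q + t)).nonneg u
    rcases ((h.fibPow q).nonneg u).eq_or_lt with h0 | h0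
    · rw [hz u h0.symm, ← h0, zpw_zero_left, zero_mul, Real.zero_rpow hs.ne', mul_zero]
    · rcases h2.eq_or_lt with h3 | h3
      · rw [← h3, zpw_zero_left, zero_mul, Real.zero_rpow hs.ne', mul_zero]
      · rw [zpw_of_pos h0, zpw_of_pos h0, zpw_of_pos h3, Real.mul_rpow h2 (by positivity),
          ← Real.rpow_mul h0.le, ← Real.rpow_mul h0.le, mul_left_comm, ← Real.rpow_add h0]
        apply le_of_eq
        rw [show s * (1 - s) + (s - 1) * s = 0 by ring, Real.rpow_zero, mul_one]
  have hnn : ∀ u, 0 ≤ fiberPart (expTilt (gibbsWeight Ψ s q) (fun w => Real.log (Ψ w)) t) u :=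
    fun u => ((h.gibbsWeight s q).expTilt (h.almostAdd_log s q) t).fiberPart.nonneg u
  refine (Finset.sum_le_sum fun u _ => key u).trans ?_
  rcases hs1.eq_or_lt with rfl | hlt
  · simp [partSum]
  · exact sum_rpow_mul_rpow_le _ _ _ (fun u _ => (h.fibPowPow s q).nonneg u)
      (fun u _ => hnn u) (by linarith) hs (by ring)

/-- Here Hölder is applied inside each fiber, I_{q+st} ≤ I_q^(1-s) I_{q+t}^s, and the weight
I_q^(s-1) cancels the first factor. -/
theorem partSum_expTilt_le (h : AlmostMul C Ψ) (hs : 0 < s) (hs1 : s ≤ 1) (q t : ℝ) (n : ℕ) :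
    partSum (expTilt (gibbsWeight Ψ s q) (fun w => Real.log (Ψ w)) (s * t)) n ≤
      partSum (fibPowPow Ψ s (q + t)) n := by
  rw [partSum_prod]
  refine Finset.sum_le_sum fun u _ => ?_
  rw [fiberPart_expTilt_gibbsWeight h, fibPowPow]
  have h2 := (h.fibPow (q + t)).nonneg u
  rcases ((h.fibPow q).nonneg u).eq_or_lt with h0 | h0
  · rw [← h0, zpw_zero_left, mul_zero]
    exact zpw_nonneg h2 s
  rcases hs1.eq_or_lt with rfl | hlt
  · rw [sub_self, zpw_of_pos h0, Real.rpow_zero, zpw_one_right, mul_one, one_mul]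
  · have e : fibPow Ψ (q + s * t) u ≤ fibPow Ψ q u ^ (1 - s) * fibPow Ψ (q + t) u ^ s := by
      refine le_trans (Finset.sum_le_sum fun v _ => ?_) (sum_rpow_mul_rpow_le _ _ _
        (fun v _ => zpw_nonneg (h.nonneg _) q) (fun v _ => zpw_nonneg (h.nonneg _) (q + t))
        (by linarith) hs (by ring))
      rw [zpw_rpow_mul_zpw_rpow (h.nonneg _) (by linarith),
        show (1 - s) * q + s * (q + t) = q + s * t by ring]
    calc _ ≤ fibPow Ψ q u ^ (1 - s) * fibPow Ψ (q + t) u ^ s * zpw (fibPow Ψ q u) (s - 1) :=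
          mul_le_mul_of_nonneg_right e (zpw_nonneg h0.le _)
      _ = fibPow Ψ (q + t) u ^ s := by
          rw [zpw_of_pos h0, mul_right_comm, ← Real.rpow_add h0,
            show 1 - s + (s - 1) = 0 by ring, Real.rpow_zero, one_mul]
      _ ≤ zpw (fibPow Ψ (q + t) u) s := by
          rcases h2.eq_or_lt with h3 | h3
          · rw [← h3, zpw_zero_left, Real.zero_rpow hs.ne']
          · rw [zpw_of_pos h3]

/-- The pressure `P(s log I_{ψ,q})` is a differentiable function of `q`. -/
theorem differentiable_growthRate_fibPowPow (h : AlmostMul C Ψ) (h1 : 0 < partSum Ψ 1)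
    (hs : 0 < s) (hs1 : s ≤ 1) : Differentiable ℝ fun q => growthRate (fibPowPow Ψ s q) := by
  intro q
  have hφ := h.gibbsWeight s q
  have hφ1 := partSum_gibbsWeight_one_pos h h1 s q
  have hX := h.almostAdd_log s q
  set φ := gibbsWeight Ψ s q
  set X := fun w : List (A × B) => Real.log (Ψ w)
  set G := fun t => growthRate (expTilt φ X t) with hG
  obtain ⟨b, hb⟩ : ∃ b, HasDerivAt G b 0 := exists_hasDerivAt_growthRate_expTilt hφ hφ1 hX
  have T := tendsto_growthRate_fibPowPow h h1 s
  have hp := partSum_fibPowPow_pos h h1 s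
  have TG := fun t => (hφ.expTilt hX t).tendsto_growthRate (partSum_expTilt_one_pos hφ hφ1 t)
  have hpG := fun t => (hφ.expTilt hX t).partSum_pos (partSum_expTilt_one_pos hφ hφ1 t)
  have hG0 : G 0 = growthRate (fibPowPow Ψ s q) := by
    simp only [hG, expTilt_zero]
    exact growthRate_gibbsWeight h s q
  have hup : ∀ t, growthRate (fibPowPow Ψ s (q + t)) ≤ (1 - s) * G 0 + s * G t := by
    intro t
    rw [hG0]
    refine le_of_tendsto_of_tendsto' (T (q + t)) (((T q).const_mul (1 - s)).add
      ((TG t).const_mul s)) fun n => ?_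
    have e2 := Real.log_le_log (hp _ n) (partSum_fibPowPow_le h hs hs1 q t n)
    rw [Real.log_mul (Real.rpow_pos_of_pos (hp q n) _).ne'
      (Real.rpow_pos_of_pos (hpG t n) s).ne', Real.log_rpow (hp q n), Real.log_rpow (hpG t n)] at e2
    have e3 : (0 : ℝ) ≤ 1 / n := by positivity
    calc _ ≤ 1 / (n : ℝ) * _ := mul_le_mul_of_nonneg_left e2 e3
      _ = _ := by ring
  have hlow : ∀ t, G (s * t) ≤ growthRate (fibPowPow Ψ s (q + t)) := by
    intro t
    refine le_of_tendsto_of_tendsto' (TG (s * t)) (T (q + t)) fun n => ?_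
    have e2 := Real.log_le_log (hpG _ n) (partSum_expTilt_le h hs hs1 q t n)
    exact mul_le_mul_of_nonneg_left e2 (by positivity)
  -- The barriers t ↦ G(st) and t ↦ (1 - s) G(0) + s G(t) meet at t = 0 with the common slope sb.
  have hd : HasDerivAt (fun t => growthRate (fibPowPow Ψ s (q + t))) (s * b) 0 := by
    refine hasDerivAt_of_squeeze 0 hlow hup ?_ ?_ ?_ ?_
    · have h2 : HasDerivAt (fun t : ℝ => s * t) s 0 := by
        simpa using (hasDerivAt_id (0 : ℝ)).const_mul s
      have h3 : HasDerivAt G b (s * 0) := by simpa using hb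
      simpa [Function.comp_def, mul_comm] using h3.comp (0 : ℝ) h2
    · exact (hb.const_mul s).const_add _
    · simp [hG0]
    · simp only [add_zero, hG0]
      ring
  have h4 : HasDerivAt (fun t => growthRate (fibPowPow Ψ s (q + t))) (s * b) (q - q) := by
    simpa using hd
  have h5 := HasDerivAt.comp_sub_const q q h4
  simpa using h5.differentiableAt

theorem le_const_of_growthRate_eq_zero (h : AlmostMul C Ψ) (h1 : 0 < partSum Ψ 1)
    (h0 : growthRate Ψ = 0) {w : List (A × B)} (hw : w ≠ []) : Ψ w ≤ C := by
  have hn : w.length ≠ 0 := by simpa using hw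
  have := h.partSum_le_exp h1 hn
  rw [h0, mul_zero, Real.exp_zero, mul_one] at this
  exact (Finset.single_le_sum (fun v _ => h.nonneg v) (mem_wordsOf.2 rfl)).trans this

/-- Since Ψ ≤ C on nonempty words, I_{q'} ≤ C^(q'-q) I_q there, and a factor independent of n does
not change the growth rate. -/
theorem antitone_growthRate_fibPowPow (h : AlmostMul C Ψ) (h1 : 0 < partSum Ψ 1) (hs : 0 < s)
    (h0 : growthRate Ψ = 0) : Antitone fun q => growthRate (fibPowPow Ψ s q) := by
  intro q q' hqq
  have hC := h.pos_const
  have T := tendsto_growthRate_fibPowPow h h1 s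
  have hp := partSum_fibPowPow_pos h h1 s
  set K := (C ^ (q' - q)) ^ s with hK
  have hK0 : 0 < K := by positivity
  have hlim : Tendsto (fun n : ℕ => Real.log K / n + 1 / (n : ℝ) *
      Real.log (partSum (fibPowPow Ψ s q) n)) atTop (𝓝 (growthRate (fibPowPow Ψ s q))) := by
    simpa using (tendsto_const_div_atTop_nhds_zero_nat (Real.log K)).add (T q)
  refine le_of_tendsto_of_tendsto (T q') hlim ?_
  filter_upwards [eventually_ne_atTop 0] with n hn
  have e : partSum (fibPowPow Ψ s q') n ≤ K * partSum (fibPowPow Ψ s q) n := by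
    rw [partSum, partSum, Finset.mul_sum]
    refine Finset.sum_le_sum fun u hu => ?_
    have hun : u.length = n := mem_wordsOf.1 hu
    have hI : fibPow Ψ q' u ≤ C ^ (q' - q) * fibPow Ψ q u := by
      rw [fibPow, fibPow, fiberPart, fiberPart, Finset.mul_sum]
      refine Finset.sum_le_sum fun v hv => ?_
      rcases (h.nonneg (u.zip v)).eq_or_lt with h2 | h2
      · simp [← h2, zpw_zero_left]
      · rw [zpw_of_pos h2, zpw_of_pos h2, show q' = (q' - q) + q by ring, Real.rpow_add h2,
          add_sub_cancel_right]
        gcongr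
        · refine le_const_of_growthRate_eq_zero h h1 h0 ?_
          intro hnil
          have h3 : (u.zip v).length = n := by simp [hun, mem_wordsOf.1 hv]
          rw [hnil] at h3
          exact hn h3.symm
    rcases ((h.fibPow q').nonneg u).eq_or_lt with h2 | h2
    · rw [fibPowPow, ← h2, zpw_zero_left]
      exact mul_nonneg hK0.le ((h.fibPowPow s q).nonneg u)
    · have h3 : 0 < fibPow Ψ q u := pos_of_mul_pos_right (h2.trans_le hI) (by positivity)
      rw [fibPowPow, fibPowPow, zpw_of_pos h2, zpw_of_pos h3, hK,
        ← Real.mul_rpow (by positivity) h3.le]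
      exact Real.rpow_le_rpow h2.le hI hs.le
  have e2 := Real.log_le_log (hp _ n) e
  rw [Real.log_mul hK0.ne' (hp _ n).ne'] at e2
  have e3 : (0 : ℝ) ≤ 1 / n := by positivity
  calc _ ≤ 1 / (n : ℝ) * _ := mul_le_mul_of_nonneg_left e2 e3
    _ = _ := by ring

end Carpet

/-! ### Transfer to functions of cylinders; assertion (i) -/

/-- A function of cylinders as a function of words given by lists. -/
def CylFun.onLists {A : Type} (ψ : CylFun A) (w : List A) : ℝ := ψ w.length w.get

theorem CylFun.onLists_ofFn {A : Type} (ψ : CylFun A) {n : ℕ} (w : Fin n → A) :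
    ψ.onLists (List.ofFn w) = ψ n w := by
  have h := (List.equivSigmaTuple (α := A)).right_inv ⟨n, w⟩
  exact congrArg (fun p : Σ n, Fin n → A => ψ p.1 p.2) h

/-- The constant is raised to at least 1 so that its logarithm is nonnegative. A word of positive
length with nonzero value has a first letter of positive value. -/
theorem AlmostMultiplicative.exists_almostMul {A : Type} [Fintype A] {ψ : CylFun A}
    (h : AlmostMultiplicative ψ) :
    ∃ C, AlmostMul C ψ.onLists ∧ 0 < partSum ψ.onLists 1 := by
  obtain ⟨C, hC, hmul⟩ := h.almost_mul
  have hnn : ∀ w, 0 ≤ ψ.onLists w := fun w => h.nonneg _ _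
  have key : ∀ u v : List A, ψ.onLists (u ++ v) =
      ψ (u.length + v.length) (Fin.append u.get v.get) := by
    intro u v
    rw [← ψ.onLists_ofFn, List.ofFn_fin_append, List.ofFn_get, List.ofFn_get]
  have hAM : AlmostMul (max C 1) ψ.onLists := by
    refine ⟨le_max_right _ _, hnn, fun u v => ?_, fun u v => ?_⟩
    · rw [key]
      refine le_trans ?_ (hmul _ _ u.get v.get).1
      have := mul_nonneg (hnn u) (hnn v)
      exact mul_le_mul_of_nonneg_right (inv_anti₀ hC (le_max_left _ _)) this
    · rw [key]
      refine (hmul _ _ u.get v.get).2.trans ?_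
      have := mul_nonneg (hnn u) (hnn v)
      exact mul_le_mul_of_nonneg_right (le_max_left _ _) this
  refine ⟨_, hAM, ?_⟩
  obtain ⟨n, hn, w, hw⟩ := h.nonzero
  rw [← ψ.onLists_ofFn] at hw
  have hw0 := (hnn _).lt_of_ne' hw
  cases hl : List.ofFn w with
  | nil =>
    have := congrArg List.length hl
    simp at this
    omega
  | cons a t =>
    rw [hl, ← List.singleton_append, hAM.pos_append] at hw0
    exact Finset.sum_pos' (fun v _ => hnn v) ⟨[a], mem_wordsOf.2 rfl, hw0.1⟩

theorem pressureSeq_eq {A : Type} [Fintype A] (ψ : CylFun A) :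
    pressureSeq ψ = fun n : ℕ => 1 / (n : ℝ) * Real.log (partSum ψ.onLists n) := by
  ext n
  rw [pressureSeq, partSum, sum_wordsOf]
  simp only [CylFun.onLists_ofFn]

theorem pressure_eq {A : Type} [Fintype A] (ψ : CylFun A) :
    pressure ψ = growthRate ψ.onLists := by
  rw [pressure, growthRate, pressureSeq_eq]

theorem onLists_cylPow_fiberSum {A B : Type} [Fintype B] (ψ : CylFun (A × B)) (q s : ℝ) :
    (cylPow (fiberSum ψ q) s).onLists = fibPowPow ψ.onLists s q := by
  ext u
  obtain ⟨n, w, rfl⟩ : ∃ (n : ℕ) (w : Fin n → A), u = List.ofFn w :=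
    ⟨_, u.get, (List.ofFn_get u).symm⟩
  rw [CylFun.onLists_ofFn, fibPowPow, fibPow, fiberPart, List.length_ofFn, sum_wordsOf, cylPow,
    fiberSum]
  congr 1
  refine Finset.sum_congr rfl fun v _ => ?_
  rw [← ψ.onLists_ofFn]
  congr 2
  refine List.ext_getElem (by simp) fun i _ _ => ?_
  simp

theorem hasPressure_cylPow_fiberSum {A B : Type} [Fintype A] [Fintype B] {ψ : CylFun (A × B)}
    (hψ : AlmostMultiplicative ψ) (q s : ℝ) :
    HasPressure (cylPow (fiberSum ψ q) s) (pressure (cylPow (fiberSum ψ q) s)) := by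
  obtain ⟨C, hC, h1⟩ := hψ.exists_almostMul
  rw [HasPressure, pressure_eq, pressureSeq_eq, onLists_cylPow_fiberSum]
  exact tendsto_growthRate_fibPowPow hC h1 s q

theorem sExp_pos {r₁ r₂ : ℕ} (hr₁ : 2 ≤ r₁) (hr : r₁ ≤ r₂) : 0 < sExp r₁ r₂ :=
  div_pos (Real.log_pos (by exact_mod_cast hr₁)) (Real.log_pos (by exact_mod_cast hr₁.trans hr))

theorem sExp_le_one {r₁ r₂ : ℕ} (hr₁ : 2 ≤ r₁) (hr : r₁ ≤ r₂) : sExp r₁ r₂ ≤ 1 := by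
  have h2 : (0 : ℝ) < Real.log r₂ := Real.log_pos (by exact_mod_cast hr₁.trans hr)
  rw [sExp, div_le_one h2]
  exact Real.log_le_log (by positivity) (by exact_mod_cast hr)

theorem Tfun_eq {r₁ r₂ : ℕ} (ψ : CylFun (Fin r₁ × Fin r₂)) :
    Tfun ψ = fun q => -growthRate (fibPowPow ψ.onLists (sExp r₁ r₂) q) / Real.log r₁ := by
  ext q
  rw [Tfun, pressure_eq, onLists_cylPow_fiberSum]

theorem Tfun_concave_differentiable_monotone {r₁ r₂ : ℕ} (hr₁ : 2 ≤ r₁) (hr : r₁ ≤ r₂)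
    {ψ : CylFun (Fin r₁ × Fin r₂)} (hψ : AlmostMultiplicative ψ) (hP : HasPressure ψ 0) :
    ConcaveOn ℝ Set.univ (Tfun ψ) ∧ Differentiable ℝ (Tfun ψ) ∧ Monotone (Tfun ψ) := by
  obtain ⟨C, hC, h1⟩ := hψ.exists_almostMul
  have hs := sExp_pos hr₁ hr
  have hl : 0 < Real.log r₁ := Real.log_pos (by exact_mod_cast hr₁)
  have h0 : growthRate ψ.onLists = 0 := by
    rw [← pressure_eq]
    exact hP.limUnder_eq
  rw [Tfun_eq]
  refine ⟨?_, ?_, ?_⟩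
  · have := ((convexOn_growthRate_fibPowPow hC h1 hs.le).neg).smul (inv_nonneg.2 hl.le)
    refine this.congr fun q _ => ?_
    simp only [Pi.neg_apply, smul_eq_mul]
    rw [div_eq_inv_mul]
  · exact (differentiable_growthRate_fibPowPow hC h1 hs (sExp_le_one hr₁ hr)).neg.div_const _
  · intro q q' hqq
    have := antitone_growthRate_fibPowPow hC h1 hs h0 hqq
    simp only at this ⊢
    gcongr

/-! ### Upper bound: covering the level set by heavy approximate squares -/

/-- Boundedness forces `s G(⌈n / s⌉) - G(n)` to be almost nonnegative infinitely often. -/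
theorem frequently_le_mul_ceil_sub {G : ℕ → ℝ} {b s ε : ℝ} (hs : 0 < s) (hs1 : s ≤ 1)
    (hε : 0 < ε) (hG : ∀ n, |G n| ≤ b * (n + 1)) :
    ∃ᶠ n : ℕ in atTop, -(ε * n) ≤ s * G ⌈n / s⌉₊ - G n := by
  have hb0 : 0 ≤ b := by simpa using (abs_nonneg _).trans (hG 0)
  set g : ℕ → ℝ := fun n => G n / n with hg
  have hgb : ∀ n, |g n| ≤ 2 * b := by
    intro n
    rcases Nat.eq_zero_or_pos n with rfl | hn
    · simp [hg, hb0]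
    · have hn' : (1 : ℝ) ≤ n := by exact_mod_cast hn
      rw [hg, abs_div, Nat.abs_cast, div_le_iff₀ (by positivity)]
      have := hG n
      nlinarith
  have hlo : IsBoundedUnder (· ≥ ·) atTop g :=
    isBoundedUnder_of ⟨-(2 * b), fun n => (abs_le.1 (hgb n)).1⟩
  have hhi : IsBoundedUnder (· ≤ ·) atTop g :=
    isBoundedUnder_of ⟨2 * b, fun n => (abs_le.1 (hgb n)).2⟩
  -- G(n) ≤ (β + δ)n infinitely often, while G(l) ≥ (β - δ)l for all large l; since sl lies in [n, n
  -- + 1], the terms in β cancel up to |β|.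
  set β := liminf g atTop
  set δ := ε / 4 with hδ
  have hδ0 : 0 < δ := by positivity
  have ev : ∀ᶠ n in atTop, β - δ < g n :=
    eventually_lt_of_lt_liminf (by linarith) hlo
  have fr : ∃ᶠ n in atTop, g n < β + δ :=
    frequently_lt_of_liminf_lt hhi.isCoboundedUnder_ge (by linarith)
  obtain ⟨n₀, hn₀⟩ := eventually_atTop.1 ev
  obtain ⟨n₁, hn₁⟩ := exists_nat_gt ((|β| + δ) / δ)
  refine (fr.and_eventually (eventually_ge_atTop (max (max n₀ n₁) 1))).mono ?_
  rintro n ⟨h1, h2⟩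
  have h3 : n₀ ≤ n := (le_max_left _ _).trans ((le_max_left _ _).trans h2)
  have h4 : n₁ ≤ n := (le_max_right _ _).trans ((le_max_left _ _).trans h2)
  have h5 : 1 ≤ n := (le_max_right _ _).trans h2
  have h5' : (1 : ℝ) ≤ n := by exact_mod_cast h5
  have h4' : (n₁ : ℝ) ≤ n := by exact_mod_cast h4
  set l := ⌈(n : ℝ) / s⌉₊ with hl
  have hl1 : (n : ℝ) ≤ s * l := by
    have := Nat.le_ceil ((n : ℝ) / s)
    rw [div_le_iff₀ hs] at this
    linarith
  have hl2 : s * l ≤ n + 1 := by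
    have := (Nat.ceil_lt_add_one (a := (n : ℝ) / s) (by positivity)).le
    have h6 := mul_le_mul_of_nonneg_left this hs.le
    rw [mul_add, mul_div_cancel₀ _ hs.ne'] at h6
    linarith
  have hnl : n ≤ l := by
    have : (n : ℝ) ≤ l := hl1.trans (by nlinarith [Nat.cast_nonneg (α := ℝ) l])
    exact_mod_cast this
  have h7 := hn₀ l (h3.trans hnl)
  have hlpos : (0 : ℝ) < l := lt_of_lt_of_le (by linarith) (Nat.cast_le.2 hnl)
  have hGl : G l = g l * l := by simp only [hg]; field_simp
  have hGn : G n = g n * n := by simp only [hg]; field_simp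
  have h8 : (|β| + δ) < δ * n := by
    rw [div_lt_iff₀ hδ0] at hn₁
    nlinarith
  have h9 : (β - δ) * (s * l) ≤ s * G l := by
    rw [hGl]
    have : 0 < s * l := by positivity
    nlinarith
  have h10 : G n ≤ (β + δ) * n := by
    rw [hGn]
    nlinarith
  have h11 : -|β| ≤ β * (s * l - n) := by
    have : |β * (s * l - n)| ≤ |β| := by
      rw [abs_mul]
      have : |s * l - n| ≤ 1 := by
        rw [abs_le]
        constructor <;> linarith
      exact mul_le_of_le_one_right (abs_nonneg β) this
    exact (abs_le.1 this).1
  have h12 : δ * (s * l) ≤ δ * (n + 1) := by gcongr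
  have h13 : ε = 4 * δ := by rw [hδ]; ring
  rw [h13]
  nlinarith

namespace SymbSpace

variable {r : ℕ}

/-- The prefix of length `n`, as a list. -/
def word (z : SymbSpace r) (n : ℕ) : List (Fin r) := List.ofFn (z.pre n)

@[simp] theorem length_word (z : SymbSpace r) (n : ℕ) : (z.word n).length = n := by simp [word]

theorem word_mem (z : SymbSpace r) (n : ℕ) : z.word n ∈ wordsOf (Fin r) n :=
  mem_wordsOf.2 (z.length_word n)

theorem word_eq_iff {z z' : SymbSpace r} {n : ℕ} :
    z.word n = z'.word n ↔ ∀ i < n, z i = z' i := by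
  rw [word, word, List.ofFn_inj, funext_iff, Fin.forall_iff]
  rfl

theorem take_word (z : SymbSpace r) {n m : ℕ} (h : n ≤ m) : (z.word m).take n = z.word n := by
  refine List.ext_getElem (by simp [h]) fun i _ _ => ?_
  simp [word, pre]

/-- R need not be a power of r, which matters in the first factor, where the radius `r₂ ^ (-n)` is
in general not a power of `r₁`. -/
theorem dist_le_inv_iff {R : ℝ} (hR : 0 < R) {l : ℕ} (h : ∀ k, R ≤ (r : ℝ) ^ k ↔ l ≤ k)
    (z z' : SymbSpace r) : dist z z' ≤ R⁻¹ ↔ ∀ i < l, z i = z' i := by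
  have hd : dist z z' = open Classical in
    if z = z' then 0 else ((r : ℝ) ^ PiNat.firstDiff (E := fun _ => Fin r) z z')⁻¹ := rfl
  by_cases hz : z = z'
  · subst hz
    simp [hR.le]
  · have hr : (0 : ℝ) < r := by exact_mod_cast (z 0).pos
    rw [hd, if_neg hz, inv_le_inv₀ (by positivity) hR, h,
      ← PiNat.mem_cylinder_iff_le_firstDiff (E := fun _ => Fin r) hz]
    rfl

end SymbSpace

/-- The length `⌈n / s⌉` of the first words of the approximate squares of order `n`. -/
noncomputable def longLen (r₁ r₂ n : ℕ) : ℕ := ⌈(n : ℝ) / sExp r₁ r₂⌉₊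

section Squares

variable {r₁ r₂ : ℕ}

theorem pow_le_pow_iff_longLen_le (hr₁ : 2 ≤ r₁) (hr : r₁ ≤ r₂) (n k : ℕ) :
    (r₂ : ℝ) ^ n ≤ (r₁ : ℝ) ^ k ↔ longLen r₁ r₂ n ≤ k := by
  have h1 : (0 : ℝ) < r₁ := by positivity
  have h2 : (0 : ℝ) < r₂ := by exact_mod_cast (by omega : 0 < r₂)
  have hl1 : 0 < Real.log r₁ := Real.log_pos (by exact_mod_cast hr₁)
  have hl2 : 0 < Real.log r₂ := Real.log_pos (by exact_mod_cast hr₁.trans hr)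
  rw [longLen, Nat.ceil_le, sExp, ← Real.log_le_log_iff (by positivity) (by positivity),
    Real.log_pow, Real.log_pow, div_div_eq_mul_div, div_le_iff₀ hl1]

theorem le_longLen (hr₁ : 2 ≤ r₁) (hr : r₁ ≤ r₂) (n : ℕ) : n ≤ longLen r₁ r₂ n := by
  have h : (r₁ : ℝ) ^ n ≤ (r₂ : ℝ) ^ n := by gcongr
  have h2 := (pow_le_pow_iff_longLen_le hr₁ hr n _).2 le_rfl
  have h3 : (1 : ℝ) < r₁ := by exact_mod_cast hr₁
  exact (pow_le_pow_iff_right₀ h3).1 (h.trans h2)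

/-- Approximate squares are the closed balls of radius `r₂ ^ (-n)`. -/
theorem dist_le_inv_pow_iff (hr₁ : 2 ≤ r₁) (hr : r₁ ≤ r₂) (n : ℕ)
    (z z' : SymbSpace r₁ × SymbSpace r₂) : dist z z' ≤ ((r₂ : ℝ) ^ n)⁻¹ ↔
      z.1.word (longLen r₁ r₂ n) = z'.1.word (longLen r₁ r₂ n) ∧ z.2.word n = z'.2.word n := by
  have h2 : (1 : ℝ) < r₂ := by exact_mod_cast (by omega : 1 < r₂)
  rw [Prod.dist_eq, max_le_iff,
    SymbSpace.dist_le_inv_iff (by positivity) (pow_le_pow_iff_longLen_le hr₁ hr n),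
    SymbSpace.dist_le_inv_iff (by positivity) (fun k => pow_le_pow_iff_right₀ h2),
    SymbSpace.word_eq_iff, SymbSpace.word_eq_iff]

theorem cylValue_eq (ψ : CylFun (Fin r₁ × Fin r₂)) (z : SymbSpace r₁ × SymbSpace r₂) (n : ℕ) :
    cylValue ψ z n = ψ.onLists ((z.1.word n).zip (z.2.word n)) := by
  rw [cylValue, ← ψ.onLists_ofFn]
  congr 1
  refine List.ext_getElem (by simp) fun i _ _ => ?_
  simp [SymbSpace.word]

/-- The approximate square defined by a pair of words. -/
def squareSet (r₁ r₂ n : ℕ) (u : List (Fin r₁)) (v : List (Fin r₂)) :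
    Set (SymbSpace r₁ × SymbSpace r₂) :=
  {z | z.1.word (longLen r₁ r₂ n) = u ∧ z.2.word n = v}

theorem ediam_squareSet_le (hr₁ : 2 ≤ r₁) (hr : r₁ ≤ r₂) (n : ℕ) (u : List (Fin r₁))
    (v : List (Fin r₂)) :
    Metric.ediam (squareSet r₁ r₂ n u v) ≤ ENNReal.ofReal ((r₂ : ℝ) ^ n)⁻¹ := by
  refine Metric.ediam_le fun z hz z' hz' => ?_
  rw [edist_le_ofReal (by positivity), dist_le_inv_pow_iff hr₁ hr]
  exact ⟨hz.1.trans hz'.1.symm, hz.2.trans hz'.2.symm⟩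

/-- The mass that the Gibbs weight of parameter `q` gives to an approximate square. -/
noncomputable def squareMass (ψ : CylFun (Fin r₁ × Fin r₂)) (q : ℝ) (n : ℕ) (u : List (Fin r₁))
    (v : List (Fin r₂)) : ℝ :=
  zpw (ψ.onLists ((u.take n).zip v)) q * zpw (fibPow ψ.onLists q (u.take n)) (-1) *
    (fibPowPow ψ.onLists (sExp r₁ r₂) q u * Real.exp
      (-(longLen r₁ r₂ n * growthRate (fibPowPow ψ.onLists (sExp r₁ r₂) q))))

variable {ψ : CylFun (Fin r₁ × Fin r₂)} {C : ℝ}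

theorem squareMass_nonneg (hC : AlmostMul C ψ.onLists) (q : ℝ) (n : ℕ) (u : List (Fin r₁))
    (v : List (Fin r₂)) : 0 ≤ squareMass ψ q n u v :=
  mul_nonneg (mul_nonneg (zpw_nonneg (hC.nonneg _) _) (zpw_nonneg ((hC.fibPow q).nonneg _) _))
    (mul_nonneg ((hC.fibPowPow _ q).nonneg _) (Real.exp_pos _).le)

/-- The sum over v gives I_q(u|n), cancelled by the factor I_q(u|n)^(-1); what remains is the
normalised partition sum of I_q^s at length l. -/
theorem sum_squareMass_le (hr₁ : 2 ≤ r₁) (hr : r₁ ≤ r₂) (hC : AlmostMul C ψ.onLists)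
    (h1 : 0 < partSum ψ.onLists 1) (q : ℝ) {n : ℕ} (hn : n ≠ 0) :
    ∑ u ∈ wordsOf (Fin r₁) (longLen r₁ r₂ n), ∑ v ∈ wordsOf (Fin r₂) n, squareMass ψ q n u v
      ≤ (C ^ |q|) ^ |sExp r₁ r₂| := by
  have hL := le_longLen hr₁ hr n
  have hF := hC.fibPowPow (sExp r₁ r₂) q
  have hF1 := partSum_fibPowPow_one_pos hC h1 (sExp r₁ r₂) q
  set P := growthRate (fibPowPow ψ.onLists (sExp r₁ r₂) q) with hP
  have e : ∀ u ∈ wordsOf (Fin r₁) (longLen r₁ r₂ n),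
      ∑ v ∈ wordsOf (Fin r₂) n, squareMass ψ q n u v ≤
        fibPowPow ψ.onLists (sExp r₁ r₂) q u * Real.exp (-(longLen r₁ r₂ n * P)) := by
    intro u hu
    have hlen : (u.take n).length = n := by
      rw [List.length_take, mem_wordsOf.1 hu, min_eq_left hL]
    simp only [squareMass]
    rw [← Finset.sum_mul, ← Finset.sum_mul]
    have e1 : ∑ v ∈ wordsOf (Fin r₂) n, zpw (ψ.onLists ((u.take n).zip v)) q =
        fibPow ψ.onLists q (u.take n) := by
      rw [fibPow, fiberPart, hlen]
    rw [e1]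
    have e2 : fibPow ψ.onLists q (u.take n) * zpw (fibPow ψ.onLists q (u.take n)) (-1) ≤ 1 := by
      rcases ((hC.fibPow q).nonneg (u.take n)).eq_or_lt with h0 | h0
      · rw [← h0, zero_mul]
        exact zero_le_one
      · rw [zpw_of_pos h0, Real.rpow_neg_one, mul_inv_cancel₀ h0.ne']
    exact mul_le_of_le_one_left (mul_nonneg (hF.nonneg u) (Real.exp_pos _).le) e2
  refine (Finset.sum_le_sum e).trans ?_
  rw [← Finset.sum_mul]
  have h3 := hF.partSum_le_exp hF1 (n := longLen r₁ r₂ n) (by omega)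
  calc _ ≤ (C ^ |q|) ^ |sExp r₁ r₂| * Real.exp (longLen r₁ r₂ n * P) *
        Real.exp (-(longLen r₁ r₂ n * P)) := mul_le_mul_of_nonneg_right h3 (Real.exp_pos _).le
    _ = _ := by
      rw [mul_assoc, ← Real.exp_add, add_neg_cancel, Real.exp_zero, mul_one]

/-- Three terms make up the logarithm of the mass: q log ψ, known from the level set; -lP = n log r₂
T(q) up to |P|; and s log I_q(x|l) - log I_q(x|n), which is bounded below only along infinitely many
n. -/
theorem frequently_le_squareMass (hr₁ : 2 ≤ r₁) (hr : r₁ ≤ r₂) (hC : AlmostMul C ψ.onLists)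
    {α : ℝ} {z : SymbSpace r₁ × SymbSpace r₂} (hz : z ∈ levelSet ψ α) (q : ℝ) {ε : ℝ}
    (hε : 0 < ε) :
    ∃ᶠ n : ℕ in atTop, Real.exp (-(n * Real.log r₂ * (α * q - Tfun ψ q + ε))) ≤
      squareMass ψ q n (z.1.word (longLen r₁ r₂ n)) (z.2.word n) := by
  obtain ⟨hpos, hlim⟩ := hz
  have hs := sExp_pos hr₁ hr
  have hs1 := sExp_le_one hr₁ hr
  have hl1 : 0 < Real.log r₁ := Real.log_pos (by exact_mod_cast hr₁)
  have hl2 : 0 < Real.log r₂ := Real.log_pos (by exact_mod_cast hr₁.trans hr)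
  set Ψ := ψ.onLists with hΨ
  set s := sExp r₁ r₂ with hsdef
  set P := growthRate (fibPowPow Ψ s q) with hP
  have hT : Tfun ψ q = -P / Real.log r₁ := congrFun (Tfun_eq ψ) q
  have hval : ∀ n, 0 < Ψ ((z.1.word n).zip (z.2.word n)) := by
    intro n
    rw [hΨ, ← cylValue_eq]
    exact hpos n
  have hIpos : ∀ n, 0 < fibPow Ψ q (z.1.word n) := by
    intro n
    have := fibPow_map_fst_pos hC (hval n) q
    rwa [List.map_fst_zip (by simp)] at this
  obtain ⟨b, hb, hbd⟩ := (hC.fibPow q).exists_abs_log_le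
  set δ := Real.log r₂ * ε / 4 with hδ
  have hδ0 : 0 < δ := by positivity
  have fr := frequently_le_mul_ceil_sub (G := fun n => Real.log (fibPow Ψ q (z.1.word n)))
    hs hs1 hδ0 (fun n => by simpa using hbd _ (hIpos n))
  have ev1 : ∀ᶠ n : ℕ in atTop,
      |q * (Real.logb (r₂ : ℝ) (cylValue ψ z n) / (-(n : ℝ)) - α)| < ε / 4 := by
    have := ((hlim.sub_const α).const_mul q).abs
    rw [sub_self, mul_zero, abs_zero] at this
    exact this.eventually (gt_mem_nhds (by positivity))
  obtain ⟨n₁, hn₁⟩ := exists_nat_gt (|P| / δ)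
  refine (fr.and_eventually (ev1.and (eventually_ge_atTop (max n₁ 1)))).mono ?_
  rintro n ⟨h1, h2, h3⟩
  have h4 : (1 : ℝ) ≤ n := by exact_mod_cast (le_max_right _ _).trans h3
  have h5 : (n₁ : ℝ) ≤ n := by exact_mod_cast (le_max_left _ _).trans h3
  have hl : longLen r₁ r₂ n = ⌈(n : ℝ) / s⌉₊ := rfl
  rw [← hl] at h1
  set l := longLen r₁ r₂ n with hldef
  have hnl : n ≤ l := le_longLen hr₁ hr n
  have h6 : |P| < δ * n := by
    rw [div_lt_iff₀ hδ0] at hn₁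
    nlinarith
  have h7 : -(l * P) ≥ n * Real.log r₂ * Tfun ψ q - δ * n := by
    have e1 : (n : ℝ) / s ≤ l := by
      rw [hl]
      exact Nat.le_ceil _
    have e2 : (l : ℝ) ≤ n / s + 1 := by
      rw [hl]
      exact (Nat.ceil_lt_add_one (by positivity)).le
    have e3 : n * Real.log r₂ * Tfun ψ q = -(n / s * P) := by
      rw [hT, hsdef, sExp]
      field_simp
    have e4 : |(l - n / s) * P| ≤ |P| := by
      rw [abs_mul]
      refine mul_le_of_le_one_left (abs_nonneg P) ?_
      rw [abs_le]
      constructor <;> linarith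
    have e5 := (abs_le.1 e4).2
    rw [e3]
    nlinarith
  have h8 : q * Real.log (Ψ ((z.1.word n).zip (z.2.word n))) ≥
      -(n * Real.log r₂ * (α * q)) - δ * n := by
    have e1 := (abs_lt.1 h2).2
    rw [cylValue_eq, ← hΨ, Real.logb] at e1
    have e2 : 0 < n * Real.log r₂ := by positivity
    have e3 := mul_lt_mul_of_pos_left e1 e2
    have e4 : n * Real.log r₂ *
        (q * (Real.log (Ψ ((z.1.word n).zip (z.2.word n))) / Real.log r₂ / (-(n : ℝ)) - α)) =
        -(q * Real.log (Ψ ((z.1.word n).zip (z.2.word n)))) - n * Real.log r₂ * (α * q) := by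
      field_simp
    rw [e4] at e3
    have e5 : n * Real.log r₂ * (ε / 4) = δ * n := by rw [hδ]; ring
    linarith
  have hm : Real.log (squareMass ψ q n (z.1.word l) (z.2.word n)) =
      q * Real.log (Ψ ((z.1.word n).zip (z.2.word n))) +
      (s * Real.log (fibPow Ψ q (z.1.word l)) - Real.log (fibPow Ψ q (z.1.word n))) - l * P ∧
      0 < squareMass ψ q n (z.1.word l) (z.2.word n) := by
    have p1 := zpw_pos (hval n) q
    have p2 := zpw_pos (hIpos n) (-1)
    have p3 := zpw_pos (hIpos l) s
    rw [squareMass, SymbSpace.take_word _ hnl]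
    rw [fibPowPow]
    refine ⟨?_, by positivity⟩
    rw [Real.log_mul (by positivity) (by positivity), Real.log_mul (by positivity) (by positivity),
      Real.log_mul (by positivity) (by positivity), log_zpw (hval n).le, log_zpw (hIpos n).le,
      log_zpw (hIpos l).le, Real.log_exp]
    ring
  rw [← Real.le_log_iff_exp_le hm.2, hm.1]
  have h9 : n * Real.log r₂ * ε = 4 * δ * n := by rw [hδ]; ring
  nlinarith

/-- A point of the level set would have squares of arbitrarily large mass around it, against the
uniform bound on the total mass. -/
theorem levelSet_eq_empty (hr₁ : 2 ≤ r₁) (hr : r₁ ≤ r₂) (hψ : AlmostMultiplicative ψ) {α q : ℝ}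
    (hq : α * q - Tfun ψ q < 0) : levelSet ψ α = ∅ := by
  obtain ⟨C, hC, h1⟩ := hψ.exists_almostMul
  have hl2 : 0 < Real.log r₂ := Real.log_pos (by exact_mod_cast hr₁.trans hr)
  rw [Set.eq_empty_iff_forall_notMem]
  intro z hz
  set γ := α * q - Tfun ψ q with hγ
  have fr := frequently_le_squareMass hr₁ hr hC hz q (ε := -γ / 2) (by linarith)
  rw [← hγ] at fr
  set K := (C ^ |q|) ^ |sExp r₁ r₂| with hK
  obtain ⟨n₁, hn₁⟩ := exists_nat_gt (K / (Real.log r₂ * (-γ / 2)))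
  obtain ⟨n, h2, h3⟩ := (fr.and_eventually (eventually_ge_atTop (max n₁ 1))).exists
  have h4 : n ≠ 0 := by
    have := (le_max_right _ _).trans h3
    omega
  have h5 : (n₁ : ℝ) ≤ n := by exact_mod_cast (le_max_left _ _).trans h3
  have h6 : 0 < Real.log r₂ * (-γ / 2) := mul_pos hl2 (by linarith)
  have h7 : squareMass ψ q n (z.1.word (longLen r₁ r₂ n)) (z.2.word n) ≤ K := by
    refine le_trans ?_ (sum_squareMass_le hr₁ hr hC h1 q h4)
    refine le_trans ?_ (Finset.single_le_sum (f := fun u => ∑ v ∈ wordsOf (Fin r₂) n,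
      squareMass ψ q n u v) (fun u _ => Finset.sum_nonneg fun v _ => squareMass_nonneg hC q n u v)
      (z.1.word_mem _))
    exact Finset.single_le_sum (f := fun v => squareMass ψ q n _ v)
      (fun v _ => squareMass_nonneg hC q n _ v) (z.2.word_mem n)
  have h8 := Real.add_one_le_exp (-(n * Real.log r₂ * (γ + -γ / 2)))
  rw [div_lt_iff₀ h6] at hn₁
  have h9 : (n₁ : ℝ) * (Real.log r₂ * (-γ / 2)) ≤ n * (Real.log r₂ * (-γ / 2)) := by gcongr
  have h10 : -(n * Real.log r₂ * (γ + -γ / 2)) = n * (Real.log r₂ * (-γ / 2)) := by ring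
  linarith

/-- With d = γ + 2ε, the d-th power of the diameter of a heavy square of order n is at most its mass
times ρ^n. The heavy squares of all orders beyond n₀ cover the level set at the cost of a convergent
geometric series, uniformly in n₀. -/
theorem dimH_levelSet_le (hr₁ : 2 ≤ r₁) (hr : r₁ ≤ r₂) (hψ : AlmostMultiplicative ψ) {α q : ℝ}
    {d : ℝ≥0} (hd : 0 < d) (hq : α * q - Tfun ψ q < d) : dimH (levelSet ψ α) ≤ d := by
  obtain ⟨C, hC, h1⟩ := hψ.exists_almostMul
  have hr₂ : 2 ≤ r₂ := hr₁.trans hr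
  have hl2 : 0 < Real.log r₂ := Real.log_pos (by exact_mod_cast hr₂)
  have hr2 : (0 : ℝ) < r₂ := by positivity
  set γ := α * q - Tfun ψ q with hγ
  set ε : ℝ := (d - γ) / 2 with hε
  have hε0 : 0 < ε := by
    rw [hε]
    linarith
  set K := (C ^ |q|) ^ |sExp r₁ r₂| with hK
  set ρ := Real.exp (-(Real.log r₂ * ε)) with hρ
  have hρ1 : ρ < 1 := by
    rw [hρ, Real.exp_lt_one_iff]
    have : 0 < Real.log r₂ * ε := by positivity
    linarith
  have hρ0 : 0 < ρ := Real.exp_pos _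
  borelize (SymbSpace r₁ × SymbSpace r₂)
  refine dimH_le_of_hausdorffMeasure_ne_top ?_
  classical
  set heavy : ℕ → List (Fin r₁) → List (Fin r₂) → Prop := fun n u v =>
    u ∈ wordsOf (Fin r₁) (longLen r₁ r₂ n) ∧ v ∈ wordsOf (Fin r₂) n ∧
      Real.exp (-(n * Real.log r₂ * (γ + ε))) ≤ squareMass ψ q n u v with hheavy
  -- All words serve as indices; light squares are replaced by ∅, which contributes 0^d = 0 because
  -- d > 0.
  set t : ℕ → ℕ × List (Fin r₁) × List (Fin r₂) → Set (SymbSpace r₁ × SymbSpace r₂) :=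
    fun n₀ p => if n₀ < p.1 ∧ heavy p.1 p.2.1 p.2.2 then squareSet r₁ r₂ p.1 p.2.1 p.2.2 else ∅
    with ht
  have hr2' : (1 : ℝ) < r₂ := by exact_mod_cast hr₂
  have hrad : Tendsto (fun n₀ : ℕ => ENNReal.ofReal ((r₂ : ℝ) ^ n₀)⁻¹) atTop (𝓝 0) := by
    rw [← ENNReal.ofReal_zero]
    refine ENNReal.tendsto_ofReal ?_
    exact (tendsto_pow_atTop_atTop_of_one_lt hr2').inv_tendsto_atTop
  have hdiam : ∀ n₀ p, Metric.ediam (t n₀ p) ≤ ENNReal.ofReal ((r₂ : ℝ) ^ n₀)⁻¹ := by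
    intro n₀ p
    simp only [ht]
    split_ifs with h
    · refine (ediam_squareSet_le hr₁ hr _ _ _).trans (ENNReal.ofReal_le_ofReal ?_)
      have := h.1.le
      gcongr
      exact hr2'.le
    · simp
  have hcover : ∀ n₀, levelSet ψ α ⊆ ⋃ p, t n₀ p := by
    intro n₀ z hz
    obtain ⟨n, h2, h3⟩ := ((frequently_le_squareMass hr₁ hr hC hz q hε0).and_eventually
      (eventually_gt_atTop n₀)).exists
    rw [Set.mem_iUnion]
    refine ⟨(n, z.1.word (longLen r₁ r₂ n), z.2.word n), ?_⟩
    have : n₀ < n ∧ heavy n (z.1.word (longLen r₁ r₂ n)) (z.2.word n) :=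
      ⟨h3, z.1.word_mem _, z.2.word_mem _, h2⟩
    simp only [ht, if_pos this]
    exact ⟨rfl, rfl⟩
  have hterm : ∀ n₀ n u v, Metric.ediam (t n₀ (n, u, v)) ^ (d : ℝ) ≤
      if n ≠ 0 ∧ u ∈ wordsOf (Fin r₁) (longLen r₁ r₂ n) ∧ v ∈ wordsOf (Fin r₂) n then
        ENNReal.ofReal (squareMass ψ q n u v * ρ ^ n) else 0 := by
    intro n₀ n u v
    simp only [ht]
    split_ifs with h2 h3 h3
    · refine (ENNReal.rpow_le_rpow (ediam_squareSet_le hr₁ hr n u v) d.coe_nonneg).trans ?_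
      rw [ENNReal.ofReal_rpow_of_nonneg (by positivity) d.coe_nonneg]
      refine ENNReal.ofReal_le_ofReal ?_
      have e1 : (((r₂ : ℝ) ^ n)⁻¹) ^ (d : ℝ) =
          Real.exp (-(n * Real.log r₂ * (γ + ε))) * ρ ^ n := by
        rw [hρ, ← Real.exp_nat_mul, ← Real.exp_add, Real.rpow_def_of_pos (by positivity),
          Real.log_inv, Real.log_pow]
        congr 1
        rw [hε]
        ring
      rw [e1]
      exact mul_le_mul_of_nonneg_right h2.2.2.2 (by positivity)
    · exact absurd ⟨by have := h2.1; omega, h2.2.1, h2.2.2.1⟩ h3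
    · simp [ENNReal.zero_rpow_of_pos (NNReal.coe_pos.2 hd)]
    · simp [ENNReal.zero_rpow_of_pos (NNReal.coe_pos.2 hd)]
  have hsum : ∀ n₀, ∑' p, Metric.ediam (t n₀ p) ^ (d : ℝ) ≤ ENNReal.ofReal (∑' n, K * ρ ^ n) := by
    intro n₀
    have hsm : Summable fun n : ℕ => K * ρ ^ n :=
      (summable_geometric_of_lt_one hρ0.le hρ1).mul_left K
    have hK0 : 0 ≤ K := ((hC.fibPowPow (sExp r₁ r₂) q).pos_const).le
    rw [ENNReal.ofReal_tsum_of_nonneg (fun n => by positivity) hsm, ENNReal.tsum_prod']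
    refine ENNReal.tsum_le_tsum fun n => ?_
    refine (ENNReal.tsum_le_tsum fun uv : List (Fin r₁) × List (Fin r₂) =>
      hterm n₀ n uv.1 uv.2).trans ?_
    rcases Nat.eq_zero_or_pos n with hn | hn
    · simp [hn]
    · rw [tsum_eq_sum (s := wordsOf (Fin r₁) (longLen r₁ r₂ n) ×ˢ wordsOf (Fin r₂) n)]
      · rw [Finset.sum_product]
        have e2 : ∀ u ∈ wordsOf (Fin r₁) (longLen r₁ r₂ n), ∀ v ∈ wordsOf (Fin r₂) n,
            (if n ≠ 0 ∧ u ∈ wordsOf (Fin r₁) (longLen r₁ r₂ n) ∧ v ∈ wordsOf (Fin r₂) n then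
              ENNReal.ofReal (squareMass ψ q n u v * ρ ^ n) else 0) =
            ENNReal.ofReal (squareMass ψ q n u v * ρ ^ n) := by
          intro u hu v hv
          rw [if_pos ⟨hn.ne', hu, hv⟩]
        rw [Finset.sum_congr rfl fun u hu => Finset.sum_congr rfl fun v hv => e2 u hu v hv]
        have hnn : ∀ u v, 0 ≤ squareMass ψ q n u v * ρ ^ n := fun u v =>
          mul_nonneg (squareMass_nonneg hC q n u v) (by positivity)
        rw [Finset.sum_congr rfl fun u _ =>
          (ENNReal.ofReal_sum_of_nonneg fun v _ => hnn u v).symm,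
          ← ENNReal.ofReal_sum_of_nonneg fun u _ => Finset.sum_nonneg fun v _ => hnn u v]
        refine ENNReal.ofReal_le_ofReal ?_
        simp only [← Finset.sum_mul]
        exact mul_le_mul_of_nonneg_right (sum_squareMass_le hr₁ hr hC h1 q hn.ne')
          (by positivity)
      · rintro ⟨u, v⟩ huv
        rw [if_neg]
        rintro ⟨-, h2, h3⟩
        exact huv (Finset.mem_product.2 ⟨h2, h3⟩)
  have hfin := Measure.hausdorffMeasure_le_liminf_tsum (d : ℝ) (levelSet ψ α) _ hrad t
    (Eventually.of_forall hdiam) (Eventually.of_forall hcover)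
  have hle := hfin.trans ((liminf_le_liminf (Eventually.of_forall hsum)).trans_eq
    (liminf_const _))
  exact ne_top_of_le_ne_top ENNReal.ofReal_ne_top hle

end Squares

/-! ### Finite-length Gibbs laws with prescribed exponent and large entropy -/

theorem hasDerivAt_zpw {x : ℝ} (hx : 0 ≤ x) (q : ℝ) :
    HasDerivAt (fun q => zpw x q) (zpw x q * Real.log x) q := by
  rcases hx.eq_or_lt with rfl | h
  · simpa [zpw_zero_left] using hasDerivAt_const q (0 : ℝ)
  · simp only [zpw_of_pos h]
    exact (Real.hasStrictDerivAt_const_rpow h q).hasDerivAt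

theorem sum_mul_comp_map_fst {A B : Type} [Fintype A] [Fintype B] (F : List (A × B) → ℝ)
    (g : List A → ℝ) (n : ℕ) : ∑ w ∈ wordsOf (A × B) n, F w * g (w.map Prod.fst) =
      ∑ u ∈ wordsOf A n, fiberPart F u * g u := by
  rw [sum_wordsOf_prod]
  refine Finset.sum_congr rfl fun u hu => ?_
  rw [fiberPart, Finset.sum_mul, mem_wordsOf.1 hu]
  refine Finset.sum_congr rfl fun v hv => ?_
  rw [List.map_fst_zip ((mem_wordsOf.1 hu).trans (mem_wordsOf.1 hv).symm).le]

section GibbsDeriv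

variable {A B : Type} [Fintype B] {Ψ : List (A × B) → ℝ} {C : ℝ}

/-- The chain rule applies where I_q(u) > 0. If I_q(u) = 0 for one q, every Ψ in the fiber vanishes,
so the function is identically 0 in q. -/
theorem hasDerivAt_fibPowPow (h : AlmostMul C Ψ) (s q : ℝ) (u : List A) :
    HasDerivAt (fun q => fibPowPow Ψ s q u)
      (s * (fiberPart (fun w => gibbsWeight Ψ s q w * Real.log (Ψ w)) u)) q := by
  have hI : HasDerivAt (fun q => fibPow Ψ q u)
      (∑ v ∈ wordsOf B u.length, zpw (Ψ (u.zip v)) q * Real.log (Ψ (u.zip v))) q :=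
    HasDerivAt.fun_sum fun v _ => hasDerivAt_zpw (h.nonneg _) q
  have hG : fiberPart (fun w => gibbsWeight Ψ s q w * Real.log (Ψ w)) u =
      (∑ v ∈ wordsOf B u.length, zpw (Ψ (u.zip v)) q * Real.log (Ψ (u.zip v))) *
        zpw (fibPow Ψ q u) (s - 1) := by
    rw [fiberPart, Finset.sum_mul]
    refine Finset.sum_congr rfl fun v hv => ?_
    rw [gibbsWeight, List.map_fst_zip (mem_wordsOf.1 hv).ge]
    ring
  rw [hG]
  rcases ((h.fibPow q).nonneg u).eq_or_lt with h0 | h0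
  · have hzero : ∀ v ∈ wordsOf B u.length, Ψ (u.zip v) = 0 := by
      have h1 := h0.symm
      rw [fibPow, fiberPart, Finset.sum_eq_zero_iff_of_nonneg
        fun v _ => zpw_nonneg (h.nonneg _) q] at h1
      exact fun v hv => (zpw_eq_zero (h.nonneg _) q).1 (h1 v hv)
    have hall : ∀ q, fibPowPow Ψ s q u = 0 := by
      intro q
      have : fibPow Ψ q u = 0 := Finset.sum_eq_zero fun v hv => by
        simp only [hzero v hv, zpw_zero_left]
      rw [fibPowPow, this, zpw_zero_left]
    simp only [hall, ← h0, zpw_zero_left, mul_zero]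
    exact hasDerivAt_const q 0
  · have h1 := hI.rpow_const (p := s) (Or.inl h0.ne')
    have hev : ∀ᶠ q' in 𝓝 q, fibPowPow Ψ s q' u = fibPow Ψ q' u ^ s := by
      filter_upwards [hI.continuousAt.eventually (lt_mem_nhds h0)] with q' hq'
      rw [fibPowPow, zpw_of_pos hq']
    refine (h1.congr_of_eventuallyEq hev).congr_deriv ?_
    rw [zpw_of_pos h0]
    ring

variable [Fintype A]

theorem hasDerivAt_partSum_fibPowPow (h : AlmostMul C Ψ) (s q : ℝ) (n : ℕ) :
    HasDerivAt (fun q => partSum (fibPowPow Ψ s q) n)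
      (s * ∑ w ∈ wordsOf (A × B) n, gibbsWeight Ψ s q w * Real.log (Ψ w)) q := by
  have := partSum_prod (fun w => gibbsWeight Ψ s q w * Real.log (Ψ w)) n
  rw [partSum, partSum] at this
  rw [this, Finset.mul_sum]
  exact HasDerivAt.fun_sum fun u _ => hasDerivAt_fibPowPow h s q u

/-- The combination of entropies of the normalized Gibbs weight that governs the dimension. -/
theorem entropy_gibbsWeight (h : AlmostMul C Ψ) (h1 : 0 < partSum Ψ 1) {s : ℝ} (hs : s ≠ 0)
    (q : ℝ) (n : ℕ) {p : List (A × B) → ℝ}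
    (hp : p = fun w => gibbsWeight Ψ s q w / partSum (fibPowPow Ψ s q) n) :
    -(∑ w ∈ wordsOf (A × B) n, p w * Real.log (p w)) -
        (1 / s - 1) * ∑ u ∈ wordsOf A n, fiberPart p u * Real.log (fiberPart p u) =
      -q * (∑ w ∈ wordsOf (A × B) n, p w * Real.log (Ψ w)) +
        Real.log (partSum (fibPowPow Ψ s q) n) / s := by
  have ha := partSum_fibPowPow_pos h h1 s q n
  set a := partSum (fibPowPow Ψ s q) n with hadef
  have hfp : ∀ u, fiberPart p u = fibPowPow Ψ s q u / a := by
    intro u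
    rw [← fiberPart_gibbsWeight h, fiberPart, fiberPart, hp, Finset.sum_div]
  have hsum : ∑ u ∈ wordsOf A n, fiberPart p u = 1 := by
    simp only [hfp]
    rw [← Finset.sum_div]
    exact div_self ha.ne'
  have hsum' : ∑ w ∈ wordsOf (A × B) n, p w = 1 := by
    rw [← hsum]
    exact partSum_prod p n
  -- On its support log p = q log Ψ + (s - 1) log I_q - log a, and the marginal has logarithm s log
  -- I_q - log a. The factor 1/s - 1 is the one for which the terms in log I_q cancel.
  have e1 : ∑ w ∈ wordsOf (A × B) n, p w * Real.log (p w) =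
      q * (∑ w ∈ wordsOf (A × B) n, p w * Real.log (Ψ w)) +
      (s - 1) * (∑ u ∈ wordsOf A n, fiberPart p u * Real.log (fibPow Ψ q u)) - Real.log a := by
    rw [← sum_mul_comp_map_fst p (fun u => Real.log (fibPow Ψ q u))]
    have el : Real.log a = ∑ w ∈ wordsOf (A × B) n, p w * Real.log a := by
      rw [← Finset.sum_mul, hsum', one_mul]
    rw [el, Finset.mul_sum, Finset.mul_sum, ← Finset.sum_add_distrib,
      ← Finset.sum_sub_distrib]
    refine Finset.sum_congr rfl fun w _ => ?_
    rcases (h.nonneg w).eq_or_lt with h0 | h0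
    · have : p w = 0 := by
        rw [hp]
        simp [gibbsWeight, ← h0, zpw_zero_left]
      simp [this]
    · have h2 := fibPow_map_fst_pos h h0 q
      have h3 : Real.log (p w) = q * Real.log (Ψ w) +
          (s - 1) * Real.log (fibPow Ψ q (w.map Prod.fst)) - Real.log a := by
        rw [hp]
        simp only
        rw [Real.log_div (gibbsWeight_pos h h0 s q).ne' ha.ne', gibbsWeight,
          Real.log_mul (zpw_pos h0 q).ne' (zpw_pos h2 _).ne', log_zpw h0.le, log_zpw h2.le]
      rw [h3]
      ring
  have e2 : ∑ u ∈ wordsOf A n, fiberPart p u * Real.log (fiberPart p u) =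
      s * (∑ u ∈ wordsOf A n, fiberPart p u * Real.log (fibPow Ψ q u)) - Real.log a := by
    have el : Real.log a = ∑ u ∈ wordsOf A n, fiberPart p u * Real.log a := by
      rw [← Finset.sum_mul, hsum, one_mul]
    rw [el, Finset.mul_sum, ← Finset.sum_sub_distrib]
    refine Finset.sum_congr rfl fun u _ => ?_
    have h0 := (h.fibPow q).nonneg u
    rcases h0.eq_or_lt with h2 | h2
    · have : fiberPart p u = 0 := by rw [hfp, fibPowPow, ← h2, zpw_zero_left, zero_div]
      simp [this]
    · have h3 : Real.log (fiberPart p u) = s * Real.log (fibPow Ψ q u) - Real.log a := by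
        rw [hfp, fibPowPow, Real.log_div (zpw_pos h2 s).ne' ha.ne', log_zpw h0]
      rw [h3]
      ring
  rw [e1, e2]
  field_simp
  ring

end GibbsDeriv

/-- A law `p` on the words of length `n`, charging only words with `Ψ > 0`, along which `Ψ` decays
with exponent close to `α` and whose entropies are large enough for the dimension `τ`. -/
structure GoodLaw {r₁ r₂ : ℕ} (Ψ : List (Fin r₁ × Fin r₂) → ℝ) (α τ ε : ℝ) (n : ℕ)
    (p : List (Fin r₁ × Fin r₂) → ℝ) : Prop where
  nonneg : ∀ w, 0 ≤ p w
  sum_eq : ∑ w ∈ wordsOf (Fin r₁ × Fin r₂) n, p w = 1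
  supp : ∀ w, 0 < p w → 0 < Ψ w
  exponent : |∑ w ∈ wordsOf (Fin r₁ × Fin r₂) n, p w * Real.log (Ψ w) + n * (α * Real.log r₂)|
    ≤ ε * n
  entropy : n * (τ * Real.log r₂ - ε) ≤ -(∑ w ∈ wordsOf (Fin r₁ × Fin r₂) n, p w * Real.log (p w)) -
    (1 / sExp r₁ r₂ - 1) * ∑ u ∈ wordsOf (Fin r₁) n, fiberPart p u * Real.log (fiberPart p u)

/-- The infimum of αq - T(q) may not be attained, so f, the version of αq - T(q) at length n, is
minimised after adding the penalty e√(1 + q²). The derivative of f is read off from the mean of log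
Ψ under the normalised Gibbs weight, and f(q) itself from its entropies. -/
theorem exists_goodLaw {r₁ r₂ : ℕ} (hr₁ : 2 ≤ r₁) (hr : r₁ ≤ r₂) {ψ : CylFun (Fin r₁ × Fin r₂)}
    (hψ : AlmostMultiplicative ψ) {α τ : ℝ} (hτ : ∀ q, τ ≤ α * q - Tfun ψ q) {ε : ℝ} (hε : 0 < ε)
    (n₀ : ℕ) : ∃ n, n₀ ≤ n ∧ ∃ p, GoodLaw ψ.onLists α τ ε n p := by
  obtain ⟨C, hC, h1⟩ := hψ.exists_almostMul
  have hs := sExp_pos hr₁ hr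
  have hl1 : 0 < Real.log r₁ := Real.log_pos (by exact_mod_cast hr₁)
  have hl2 : 0 < Real.log r₂ := Real.log_pos (by exact_mod_cast hr₁.trans hr)
  have hsl : sExp r₁ r₂ * Real.log r₂ = Real.log r₁ := by
    rw [sExp]
    field_simp
  set s := sExp r₁ r₂ with hsdef
  set Ψ := ψ.onLists with hΨ
  have hlC : 0 ≤ Real.log C := Real.log_nonneg hC.one_le
  set e : ℝ := ε / Real.log r₂ with he
  have he0 : 0 < e := by positivity
  have hel : e * Real.log r₂ = ε := by
    rw [he]
    field_simp
  -- The error s|q| log C of the growth estimate is linear in q; for n beyond n₁ it becomes at most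
  -- (e/2)|q| in f, half of what the penalty provides.
  obtain ⟨n₁, hn₁⟩ := exists_nat_gt (2 * (s * Real.log C) / (Real.log r₁ * e))
  set n := max (max n₀ n₁) 1 with hn
  have hn0 : n₀ ≤ n := (le_max_left _ _).trans (le_max_left _ _)
  have hn1 : (n₁ : ℝ) ≤ n := by exact_mod_cast (le_max_right n₀ n₁).trans (le_max_left _ 1)
  have hnne : n ≠ 0 := by
    have : 1 ≤ n := le_max_right _ _
    omega
  have hnpos : (0 : ℝ) < n := by positivity
  have ha := fun q => partSum_fibPowPow_pos hC h1 s q n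
  set a := fun q => partSum (fibPowPow Ψ s q) n with hadef
  set f : ℝ → ℝ := fun q => α * q + Real.log (a q) / (n * Real.log r₁) with hf
  have hlow : ∀ q, τ - e / 2 * |q| ≤ f q := by
    intro q
    have b1 := (abs_le.1 ((hC.fibPowPow s q).abs_log_partSum_sub_le
      (partSum_fibPowPow_one_pos hC h1 s q) hnne)).1
    have b2 := hτ q
    have hT : Tfun ψ q = -growthRate (fibPowPow Ψ s q) / Real.log r₁ := congrFun (Tfun_eq ψ) q
    have b3 : Real.log ((C ^ |q|) ^ |s|) = s * (|q| * Real.log C) := by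
      rw [Real.log_rpow (Real.rpow_pos_of_pos hC.pos_const _), Real.log_rpow hC.pos_const,
        abs_of_pos hs]
    rw [b3] at b1
    have b4 : s * Real.log C ≤ n * Real.log r₁ * (e / 2) := by
      rw [div_lt_iff₀ (by positivity)] at hn₁
      have : (n₁ : ℝ) * (Real.log r₁ * e) ≤ n * (Real.log r₁ * e) := by gcongr
      linarith
    have b5 : s * (|q| * Real.log C) ≤ n * Real.log r₁ * (e / 2 * |q|) := by
      have := mul_le_mul_of_nonneg_right b4 (abs_nonneg q)
      linarith
    have b6 : growthRate (fibPowPow Ψ s q) / Real.log r₁ - e / 2 * |q| ≤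
        Real.log (a q) / (n * Real.log r₁) := by
      rw [le_div_iff₀ (by positivity)]
      have : (growthRate (fibPowPow Ψ s q) / Real.log r₁ - e / 2 * |q|) * (n * Real.log r₁) =
          n * growthRate (fibPowPow Ψ s q) - n * Real.log r₁ * (e / 2 * |q|) := by
        field_simp
      rw [this]
      linarith
    rw [hT, neg_div] at b2
    simp only [hf]
    linarith
  set Λ : ℝ → ℝ := fun q => ∑ w ∈ wordsOf (Fin r₁ × Fin r₂) n,
    gibbsWeight Ψ s q w * Real.log (Ψ w) with hΛ
  have hfd : ∀ q, HasDerivAt f (α + s * Λ q / a q / (n * Real.log r₁)) q := by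
    intro q
    have d1 := ((hasDerivAt_partSum_fibPowPow hC s q n).log (ha q).ne').div_const
      (n * Real.log r₁)
    have d2 : HasDerivAt (fun q => α * q) α q := by
      simpa using (hasDerivAt_id q).const_mul α
    exact d2.add d1
  have hgd : ∀ q : ℝ, HasDerivAt (fun q => e * √(1 + q ^ 2)) (e * (q / √(1 + q ^ 2))) q := by
    intro q
    have d1 : HasDerivAt (fun q : ℝ => 1 + q ^ 2) (2 * q) q := by
      simpa using (hasDerivAt_pow 2 q).const_add 1
    have d2 := (d1.sqrt (by positivity)).const_mul e
    refine d2.congr_deriv ?_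
    rw [mul_div_mul_left _ _ two_ne_zero]
  have hsq : ∀ q : ℝ, |q| ≤ √(1 + q ^ 2) := fun q => Real.abs_le_sqrt (by linarith)
  have hcont : Continuous fun q => f q + e * √(1 + q ^ 2) :=
    continuous_iff_continuousAt.2 fun q => ((hfd q).add (hgd q)).continuousAt
  have hcoer : Tendsto (fun q => f q + e * √(1 + q ^ 2)) (cocompact ℝ) atTop := by
    have t1 : Tendsto (fun q : ℝ => τ + e / 2 * ‖q‖) (cocompact ℝ) atTop :=
      tendsto_atTop_add_const_left _ _
        ((tendsto_norm_cocompact_atTop (E := ℝ)).const_mul_atTop (by positivity))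
    refine tendsto_atTop_mono (fun q => ?_) t1
    have := hlow q
    have h3 := mul_le_mul_of_nonneg_left (hsq q) he0.le
    rw [Real.norm_eq_abs]
    linarith
  obtain ⟨q, hq⟩ := hcont.exists_forall_le hcoer
  have hmin : IsLocalMin (fun q => f q + e * √(1 + q ^ 2)) q := Eventually.of_forall hq
  have hcrit := hmin.hasDerivAt_eq_zero ((hfd q).add (hgd q))
  have haq : 0 < a q := ha q
  refine ⟨n, hn0, fun w => gibbsWeight Ψ s q w / a q, ?_⟩
  set p : List (Fin r₁ × Fin r₂) → ℝ := fun w => gibbsWeight Ψ s q w / a q with hp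
  have hmean : ∑ w ∈ wordsOf (Fin r₁ × Fin r₂) n, p w * Real.log (Ψ w) = Λ q / a q := by
    rw [hΛ, Finset.sum_div]
    exact Finset.sum_congr rfl fun w _ => by
      rw [hp]
      ring
  set m := Λ q / a q with hm
  set σ := q / √(1 + q ^ 2) with hσ
  have hS : 0 < √(1 + q ^ 2) := by positivity
  -- The critical point equation, simplified by s log r₂ = log r₁; eσ is the derivative of the
  -- penalty.
  have hcrit' : m = -(n * Real.log r₂ * (α + e * σ)) := by
    have e1 : s * Λ q / a q / (n * Real.log r₁) = m / (n * Real.log r₂) := by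
      rw [hm, ← hsl]
      field_simp
    rw [e1] at hcrit
    have e2 : m / (n * Real.log r₂) = -(α + e * σ) := by linarith
    rw [div_eq_iff (by positivity)] at e2
    rw [e2]
    ring
  have hσ1 : |σ| ≤ 1 := by
    rw [hσ, abs_div, abs_of_pos hS, div_le_one hS]
    exact hsq q
  refine ⟨fun w => div_nonneg ((hC.gibbsWeight s q).nonneg w) haq.le, ?_, fun w hw => ?_, ?_, ?_⟩
  · rw [← Finset.sum_div]
    have := partSum_gibbsWeight hC s q n
    rw [partSum] at this
    rw [this]
    exact div_self haq.ne'
  · refine pos_of_gibbsWeight_pos hC (s := s) (q := q) ?_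
    have := mul_pos hw haq
    rwa [div_mul_cancel₀ _ haq.ne'] at this
  · rw [hmean, hcrit']
    have : -(n * Real.log r₂ * (α + e * σ)) + n * (α * Real.log r₂) = -(ε * n) * σ := by
      rw [← hel]
      ring
    rw [this, abs_mul, abs_neg, abs_of_pos (by positivity : 0 < ε * n)]
    exact mul_le_of_le_one_right (by positivity) hσ1
  · rw [entropy_gibbsWeight hC h1 hs.ne' q n hp, hmean, hcrit']
    have e1 : Real.log (partSum (fibPowPow Ψ s q) n) / s =
        n * Real.log r₂ * (f q - α * q) := by
      simp only [hf, hadef]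
      rw [← hsl]
      field_simp
      ring
    rw [e1]
    -- The entropy equals n log r₂ (f(q) + eqσ), and eqσ ≥ e|q| - e absorbs the possible loss
    -- (e/2)|q| of f(q).
    have e2 : q * σ ≥ |q| - 1 := by
      have e3 : q * σ = q ^ 2 / √(1 + q ^ 2) := by
        rw [hσ]
        ring
      rw [e3, ge_iff_le, le_div_iff₀ hS]
      have e4 : √(1 + q ^ 2) ^ 2 = 1 + q ^ 2 := Real.sq_sqrt (by positivity)
      have e5 := hsq q
      have e6 : 1 ≤ √(1 + q ^ 2) := Real.one_le_sqrt.2 (by nlinarith [sq_nonneg q])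
      have e7 : √(1 + q ^ 2) ≤ |q| + 1 := by
        rw [Real.sqrt_le_left (by positivity)]
        nlinarith [sq_abs q, abs_nonneg q]
      nlinarith [abs_nonneg q]
    have e8 := hlow q
    have e9 : τ - e ≤ f q + e * (q * σ) := by
      have := mul_le_mul_of_nonneg_left e2 he0.le
      nlinarith [abs_nonneg q]
    have e10 : 0 < n * Real.log r₂ := by positivity
    have e11 := mul_le_mul_of_nonneg_left e9 e10.le
    calc (n : ℝ) * (τ * Real.log r₂ - ε) = n * Real.log r₂ * (τ - e) := by
          rw [← hel]
          ring
      _ ≤ _ := e11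
      _ = _ := by ring

/-! ### A law of large numbers for independent variables with growing bounds -/

theorem summable_exp_neg_mul_sqrt {c : ℝ} (hc : 0 < c) :
    Summable fun n : ℕ => Real.exp (-(c * √n)) := by
  have h2 : Summable fun n : ℕ => 24 / c ^ 4 * (1 / (n : ℝ) ^ 2) :=
    (Real.summable_one_div_nat_pow.2 one_lt_two).mul_left _
  refine summable_of_isBigO_nat h2 (Asymptotics.IsBigO.of_bound 1 ?_)
  filter_upwards [eventually_ne_atTop 0] with n hn
  have hn' : (0 : ℝ) < n := by positivity
  have h3 : 0 < c * √n := by positivity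
  have h4 := Real.pow_div_factorial_le_exp _ h3.le 4
  have h5 : (c * √n) ^ 4 = c ^ 4 * n ^ 2 := by
    rw [mul_pow, show √(n : ℝ) ^ 4 = (√n ^ 2) ^ 2 by ring, Real.sq_sqrt hn'.le]
  have h6 : ((Nat.factorial 4 : ℕ) : ℝ) = 24 := by norm_num [Nat.factorial]
  rw [h5, h6] at h4
  rw [Real.norm_of_nonneg (Real.exp_pos _).le, Real.norm_of_nonneg (by positivity), one_mul,
    Real.exp_neg]
  calc _ ≤ (c ^ 4 * (n : ℝ) ^ 2 / 24)⁻¹ := inv_anti₀ (by positivity) h4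
    _ = _ := by field_simp

open ProbabilityTheory in
-- Hoeffding's inequality: bounds of order M n^(1/4) give the sum of n terms the variance proxy M²
-- n^(3/2), so a deviation δn has probability at most e^(-c√n). This is summable, and Borel–Cantelli
-- applies.
theorem ae_eventually_sum_lt {Ω : Type*} [MeasurableSpace Ω] {μ : Measure Ω}
    [IsProbabilityMeasure μ] {X : ℕ → Ω → ℝ} (hm : ∀ i, Measurable (X i)) (hX : iIndepFun X μ)
    {M : ℝ} (hM : 0 < M) (hb : ∀ i : ℕ, ∀ᵐ ω ∂μ, |X i ω| ≤ M * √√(i + 1)) {δ : ℝ} (hδ : 0 < δ) :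
    ∀ᵐ ω ∂μ, ∀ᶠ n : ℕ in atTop, ∑ i ∈ Finset.range n, (X i ω - ∫ x, X i x ∂μ) < δ * n := by
  have hY : iIndepFun (fun i ω => X i ω - ∫ x, X i x ∂μ) μ :=
    hX.comp (fun i x => x - ∫ x, X i x ∂μ) (fun i => measurable_id.sub_const _)
  set c : ℝ := δ ^ 2 / (2 * M ^ 2) with hc
  have hc0 : 0 < c := by positivity
  have key : ∀ n : ℕ, μ.real {ω | δ * n ≤ ∑ i ∈ Finset.range n, (X i ω - ∫ x, X i x ∂μ)} ≤
      Real.exp (-(c * √n)) := by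
    intro n
    rcases Nat.eq_zero_or_pos n with rfl | hn
    · simp
    have hn' : (0 : ℝ) < n := by exact_mod_cast hn
    set B : ℝ := M * √√n with hB
    have hB0 : 0 < B := by positivity
    have hsub : ∀ i < n, HasSubgaussianMGF (fun ω => X i ω - ∫ x, X i x ∂μ)
        ((‖B - -B‖₊ / 2) ^ 2) μ := by
      intro i hi
      refine hasSubgaussianMGF_of_mem_Icc (hm i).aemeasurable ?_
      filter_upwards [hb i] with ω hω
      refine abs_le.1 (hω.trans ?_)
      have : (i : ℝ) + 1 ≤ n := by exact_mod_cast hi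
      rw [hB]
      gcongr
    have h1 := HasSubgaussianMGF.measure_sum_range_ge_le_of_iIndepFun hY hsub
      (ε := δ * n) (by positivity)
    refine h1.trans_eq ?_
    congr 1
    have e1 : (((‖B - -B‖₊ / 2) ^ 2 : ℝ≥0) : ℝ) = M ^ 2 * √n := by
      push_cast
      rw [Real.norm_of_nonneg (by linarith), show (B - -B) / 2 = B by ring, hB, mul_pow,
        Real.sq_sqrt (Real.sqrt_nonneg _)]
    rw [e1, hc]
    have e2 : √(n : ℝ) * √n = n := Real.mul_self_sqrt hn'.le
    have e3 : 0 < √(n : ℝ) := by positivity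
    rw [div_eq_iff (by positivity)]
    field_simp
    nlinarith
  have hsum : ∑' n : ℕ, μ {ω | δ * n ≤ ∑ i ∈ Finset.range n, (X i ω - ∫ x, X i x ∂μ)} ≠ ∞ := by
    refine ne_top_of_le_ne_top (summable_exp_neg_mul_sqrt hc0).tsum_ofReal_ne_top
      (ENNReal.tsum_le_tsum fun n => ?_)
    rw [← ofReal_measureReal]
    exact ENNReal.ofReal_le_ofReal (key n)
  filter_upwards [ae_eventually_notMem hsum] with ω hω
  filter_upwards [hω] with n hn
  simpa using hn

open ProbabilityTheory in
/-- A strong law of large numbers for independent variables with slowly growing bounds. -/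
theorem ae_isLittleO_sum {Ω : Type*} [MeasurableSpace Ω] {μ : Measure Ω}
    [IsProbabilityMeasure μ] {X : ℕ → Ω → ℝ} (hm : ∀ i, Measurable (X i)) (hX : iIndepFun X μ)
    {M : ℝ} (hM : 0 < M) (hb : ∀ i : ℕ, ∀ᵐ ω ∂μ, |X i ω| ≤ M * √√(i + 1)) :
    ∀ᵐ ω ∂μ, (fun n : ℕ => ∑ i ∈ Finset.range n, (X i ω - ∫ x, X i x ∂μ)) =o[atTop]
      fun n : ℕ => (n : ℝ) := by
  have hneg : iIndepFun (fun i ω => -X i ω) μ := hX.comp (fun _ x => -x) fun _ => measurable_neg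
  have h1 : ∀ᵐ ω ∂μ, ∀ k : ℕ, ∀ᶠ n : ℕ in atTop,
      ∑ i ∈ Finset.range n, (X i ω - ∫ x, X i x ∂μ) < 1 / ((k : ℝ) + 1) * n :=
    ae_all_iff.2 fun k => ae_eventually_sum_lt hm hX hM hb (by positivity)
  have h2 : ∀ᵐ ω ∂μ, ∀ k : ℕ, ∀ᶠ n : ℕ in atTop,
      ∑ i ∈ Finset.range n, (-X i ω - ∫ x, -X i x ∂μ) < 1 / ((k : ℝ) + 1) * n :=
    ae_all_iff.2 fun k => ae_eventually_sum_lt (fun i => (hm i).neg) hneg hM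
      (fun i => by simpa using hb i) (by positivity)
  filter_upwards [h1, h2] with ω hω1 hω2
  rw [Asymptotics.isLittleO_iff]
  intro c hc
  obtain ⟨k, hk⟩ := exists_nat_one_div_lt hc
  filter_upwards [hω1 k, hω2 k] with n hn1 hn2
  have e : ∑ i ∈ Finset.range n, (-X i ω - ∫ x, -X i x ∂μ) =
      -∑ i ∈ Finset.range n, (X i ω - ∫ x, X i x ∂μ) := by
    rw [← Finset.sum_neg_distrib]
    refine Finset.sum_congr rfl fun i _ => ?_
    rw [integral_neg]
    ring
  rw [e] at hn2
  have hle : 1 / ((k : ℝ) + 1) * n ≤ c * n := by gcongr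
  rw [Real.norm_eq_abs, Real.norm_of_nonneg (Nat.cast_nonneg n), abs_le]
  constructor <;> linarith

/-! ### Slow schedules, entropy and sequences of block laws -/

/-- Any sequence can be run through so slowly that it grows at most like `i ^ (1/4)`. -/
theorem exists_slow_schedule (β : ℕ → ℝ) : ∃ (k : ℕ → ℕ) (M : ℝ), 0 < M ∧
    Tendsto k atTop atTop ∧ ∀ i : ℕ, β (k i) ≤ M * √√(i + 1) := by
  classical
  -- Since √√(i + 1) ≥ 1, this makes the index 0 admissible at every time i.
  set M := max (β 0) 1 with hM
  have hM0 : 0 < M := lt_of_lt_of_le one_pos (le_max_right _ _)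
  set Q : ℕ → ℕ → Prop := fun i k => ∀ j ≤ k, β j ≤ M * √√(i + 1) with hQ
  have hQ0 : ∀ i, Q i 0 := by
    intro i j hj
    rw [Nat.le_zero.1 hj]
    have : (1 : ℝ) ≤ √√((i : ℝ) + 1) := by
      rw [Real.one_le_sqrt, Real.one_le_sqrt]
      linarith [Nat.cast_nonneg (α := ℝ) i]
    exact (le_max_left _ _).trans (le_mul_of_one_le_right hM0.le this)
  refine ⟨fun i => Nat.findGreatest (Q i) i, M, hM0, ?_, fun i => ?_⟩
  · rw [tendsto_atTop]
    intro K
    have ht : Tendsto (fun i : ℕ => M * √√((i : ℝ) + 1)) atTop atTop :=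
      (Real.tendsto_sqrt_atTop.comp (Real.tendsto_sqrt_atTop.comp
        (tendsto_atTop_add_const_right _ _ tendsto_natCast_atTop_atTop))).const_mul_atTop hM0
    filter_upwards [ht.eventually_ge_atTop (∑ j ∈ Finset.range (K + 1), |β j|),
      eventually_ge_atTop K] with i hi hiK
    refine Nat.le_findGreatest hiK fun j hj => ?_
    have := Finset.single_le_sum (f := fun j => |β j|) (fun j _ => abs_nonneg _)
      (Finset.mem_range.2 (Nat.lt_succ_of_le hj))
    exact (le_abs_self _).trans (this.trans hi)
  · exact Nat.findGreatest_spec (Nat.zero_le i) (hQ0 i) _ le_rfl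

theorem card_wordsOf (A : Type) [Fintype A] (n : ℕ) :
    (wordsOf A n).card = Fintype.card A ^ n := by
  simp [wordsOf]

/-- Entropy is at most the logarithm of the number of points. -/
theorem neg_sum_mul_log_le {ι : Type*} (S : Finset ι) {f : ι → ℝ} (hf : ∀ i ∈ S, 0 ≤ f i)
    (h1 : ∑ i ∈ S, f i = 1) : -∑ i ∈ S, f i * Real.log (f i) ≤ Real.log S.card := by
  have hne : S.Nonempty := by
    rw [Finset.nonempty_iff_ne_empty]
    rintro rfl
    simp at h1
  have hc : (0 : ℝ) < S.card := by exact_mod_cast hne.card_pos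
  have key : ∀ i ∈ S, -(f i * Real.log (f i)) ≤ f i * Real.log S.card + (1 / S.card - f i) := by
    intro i hi
    rcases (hf i hi).eq_or_lt with h0 | h0
    · rw [← h0]
      simp
    · have h2 := Real.log_le_sub_one_of_pos (x := 1 / (f i * S.card)) (by positivity)
      rw [one_div, Real.log_inv, Real.log_mul h0.ne' hc.ne'] at h2
      have h3 := mul_le_mul_of_nonneg_left h2 h0.le
      have h4 : f i * ((f i * S.card)⁻¹ - 1) = 1 / S.card - f i := by
        field_simp
      rw [h4] at h3
      linarith
  rw [← Finset.sum_neg_distrib]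
  refine (Finset.sum_le_sum key).trans_eq ?_
  rw [Finset.sum_add_distrib, ← Finset.sum_mul, Finset.sum_sub_distrib, h1, Finset.sum_const,
    nsmul_eq_mul]
  field_simp
  ring

theorem neg_sum_mul_log_nonneg {ι : Type*} (S : Finset ι) {f : ι → ℝ} (hf : ∀ i ∈ S, 0 ≤ f i)
    (h1 : ∑ i ∈ S, f i = 1) : 0 ≤ -∑ i ∈ S, f i * Real.log (f i) := by
  rw [← Finset.sum_neg_distrib]
  refine Finset.sum_nonneg fun i hi => ?_
  have h2 := Finset.single_le_sum hf hi
  rw [h1] at h2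
  have h3 := Real.log_nonpos (hf i hi) h2
  have h4 := hf i hi
  nlinarith

/-- A sequence of laws of random words whose lengths increase slowly, along which the exponent of
`Ψ` tends to `α` and the entropies per letter have the limits `h` (at least) and `h'`. -/
structure BlockLaws {r₁ r₂ : ℕ} (Ψ : List (Fin r₁ × Fin r₂) → ℝ) (α h h' M : ℝ) (len : ℕ → ℕ)
    (p : ℕ → List (Fin r₁ × Fin r₂) → ℝ) : Prop where
  nonneg : ∀ i w, 0 ≤ p i w
  sum_eq : ∀ i, ∑ w ∈ wordsOf (Fin r₁ × Fin r₂) (len i), p i w = 1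
  supp : ∀ i w, 0 < p i w → 0 < Ψ w
  const_pos : 0 < M
  len_pos : ∀ i, 1 ≤ len i
  len_tendsto : Tendsto len atTop atTop
  len_le : ∀ i : ℕ, (len i : ℝ) ≤ M * √√(i + 1)
  bound : ∀ i : ℕ, ∀ w ∈ wordsOf (Fin r₁ × Fin r₂) (len i), |Real.log (Ψ w)| ≤ M * √√(i + 1) ∧
    |Real.log (p i w)| ≤ M * √√(i + 1) ∧
    |Real.log (fiberPart (p i) (w.map Prod.fst))| ≤ M * √√(i + 1)
  exponent : (fun i => ∑ w ∈ wordsOf (Fin r₁ × Fin r₂) (len i), p i w * Real.log (Ψ w)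
    + len i * (α * Real.log r₂)) =o[atTop] fun i => (len i : ℝ)
  entropy₁ : ∃ ρ : ℕ → ℝ, ρ =o[atTop] (fun i => (len i : ℝ)) ∧
    ∀ i, ∑ w ∈ wordsOf (Fin r₁ × Fin r₂) (len i), p i w * Real.log (p i w) ≤ -(h * len i) + ρ i
  entropy₂ : (fun i => ∑ u ∈ wordsOf (Fin r₁) (len i), fiberPart (p i) u *
    Real.log (fiberPart (p i) u) + h' * len i) =o[atTop] fun i => (len i : ℝ)

theorem isLittleO_mul_of_tendsto_zero {f g : ℕ → ℝ} (hf : Tendsto f atTop (𝓝 0)) :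
    (fun i => f i * g i) =o[atTop] g := by
  simpa using ((Asymptotics.isLittleO_one_iff ℝ).2 hf).mul_isBigO (Asymptotics.isBigO_refl g atTop)

/-- Laws with error 1/(k + 1) are run through slowly. Their two entropies need not converge, but the
marginal entropy per letter stays in [0, log r₁] and converges to h' along a subsequence; h is then
defined by the dimension formula, and only a lower bound on the full entropy is needed. -/
theorem exists_blockLaws {r₁ r₂ : ℕ} (hr₁ : 2 ≤ r₁) (hr : r₁ ≤ r₂)
    {ψ : CylFun (Fin r₁ × Fin r₂)} (hψ : AlmostMultiplicative ψ) {α τ : ℝ}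
    (hτ : ∀ q, τ ≤ α * q - Tfun ψ q) : ∃ h h' M len p,
      BlockLaws ψ.onLists α h h' M len p ∧ 0 ≤ h' ∧
      h + (1 / sExp r₁ r₂ - 1) * h' = τ * Real.log r₂ := by
  have hs := sExp_pos hr₁ hr
  set s := sExp r₁ r₂ with hsdef
  have H : ∀ k : ℕ, ∃ n, k + 1 ≤ n ∧ ∃ p, GoodLaw ψ.onLists α τ (1 / ((k : ℝ) + 1)) n p :=
    fun k => exists_goodLaw hr₁ hr hψ hτ (by positivity) (k + 1)
  choose N hN P hP using H
  have hNpos : ∀ k, (0 : ℝ) < N k := fun k => by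
    have := hN k
    exact_mod_cast (by omega : 0 < N k)
  set E₂ : ℕ → ℝ := fun k => ∑ u ∈ wordsOf (Fin r₁) (N k), fiberPart (P k) u *
    Real.log (fiberPart (P k) u) with hE₂
  set η : ℕ → ℝ := fun k => -E₂ k / N k with hη
  have hfibnn : ∀ k u, 0 ≤ fiberPart (P k) u := fun k u =>
    Finset.sum_nonneg fun v _ => (hP k).nonneg _
  have hfibsum : ∀ k, ∑ u ∈ wordsOf (Fin r₁) (N k), fiberPart (P k) u = 1 := fun k => by
    have := partSum_prod (P k) (N k)
    rw [partSum, partSum] at this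
    rw [← this, (hP k).sum_eq]
  have hη0 : ∀ k, 0 ≤ η k := fun k =>
    div_nonneg (neg_sum_mul_log_nonneg _ (fun u _ => hfibnn k u) (hfibsum k)) (hNpos k).le
  have hη1 : ∀ k, η k ≤ Real.log r₁ := fun k => by
    rw [hη, div_le_iff₀ (hNpos k)]
    have := neg_sum_mul_log_le _ (fun u _ => hfibnn k u) (hfibsum k)
    rw [card_wordsOf, Fintype.card_fin] at this
    push_cast at this
    rw [Real.log_pow] at this
    rw [mul_comm]
    exact this
  obtain ⟨h', hh', θ, hθ, hlim⟩ := isCompact_Icc.tendsto_subseq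
    (fun k => (⟨hη0 k, hη1 k⟩ : η k ∈ Set.Icc 0 (Real.log r₁)))
  -- A common bound for the length and all logarithms attached to the k-th law, so that one schedule
  -- controls them together.
  set β : ℕ → ℝ := fun k => N k + ∑ w ∈ wordsOf (Fin r₁ × Fin r₂) (N k),
    (|Real.log (ψ.onLists w)| + |Real.log (P k w)| +
      |Real.log (fiberPart (P k) (w.map Prod.fst))|) with hβ
  obtain ⟨κ, M, hM, hκ, hκβ⟩ := exists_slow_schedule (β ∘ θ)
  have hφ : Tendsto (fun i => θ (κ i)) atTop atTop := hθ.tendsto_atTop.comp hκ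
  set φ : ℕ → ℕ := fun i => θ (κ i) with hφdef
  have hβ1 : ∀ k, (N k : ℝ) ≤ β k := fun k =>
    le_add_of_nonneg_right (Finset.sum_nonneg fun w _ => by positivity)
  have hβ2 : ∀ k, ∀ w ∈ wordsOf (Fin r₁ × Fin r₂) (N k), |Real.log (ψ.onLists w)| +
      |Real.log (P k w)| + |Real.log (fiberPart (P k) (w.map Prod.fst))| ≤ β k := by
    intro k w hw
    refine le_trans (Finset.single_le_sum (f := fun w => |Real.log (ψ.onLists w)| +
      |Real.log (P k w)| + |Real.log (fiberPart (P k) (w.map Prod.fst))|)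
      (fun w _ => by positivity) hw) ?_
    exact le_add_of_nonneg_left (hNpos k).le
  have hε : Tendsto (fun i => 1 / ((φ i : ℝ) + 1)) atTop (𝓝 0) :=
    tendsto_one_div_add_atTop_nhds_zero_nat.comp hφ
  have hlim' : Tendsto (fun i => η (φ i) - h') atTop (𝓝 0) := by
    have := (hlim.comp hκ).sub_const h'
    rwa [sub_self] at this
  have hE : ∀ k, E₂ k = -(η k * N k) := fun k => by
    have := hNpos k
    simp only [hη]
    field_simp
  refine ⟨τ * Real.log r₂ - (1 / s - 1) * h', h', M, fun i => N (φ i), fun i => P (φ i), ?_,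
    hh'.1, by ring⟩
  refine ⟨fun i => (hP _).nonneg, fun i => (hP _).sum_eq, fun i => (hP _).supp, hM,
    fun i => by have := hN (φ i); omega, ?_, fun i => (hβ1 _).trans (hκβ i), ?_, ?_, ?_, ?_⟩
  · exact tendsto_atTop_mono (fun i => (Nat.le_succ _).trans (hN (φ i))) hφ
  · intro i w hw
    have h2 := (hβ2 _ w hw).trans (hκβ i)
    have a1 := abs_nonneg (Real.log (ψ.onLists w))
    have a2 := abs_nonneg (Real.log (P (φ i) w))
    have a3 := abs_nonneg (Real.log (fiberPart (P (φ i)) (w.map Prod.fst)))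
    refine ⟨?_, ?_, ?_⟩ <;> linarith
  · refine Asymptotics.IsBigO.trans_isLittleO (Asymptotics.IsBigO.of_bound 1
      (Eventually.of_forall fun i => ?_)) (isLittleO_mul_of_tendsto_zero hε)
    rw [one_mul]
    exact ((hP (φ i)).exponent).trans (le_abs_self _)
  · refine ⟨fun i => (1 / ((φ i : ℝ) + 1) + (1 / s - 1) * (η (φ i) - h')) * N (φ i),
      isLittleO_mul_of_tendsto_zero ?_, fun i => ?_⟩
    · simpa using hε.add (hlim'.const_mul (1 / s - 1))
    · have h2 := (hP (φ i)).entropy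
      have h3 := hE (φ i)
      simp only [hE₂] at h3
      rw [h3] at h2
      linarith
  · refine (isLittleO_mul_of_tendsto_zero (f := fun i => -(η (φ i) - h'))
      (by simpa using hlim'.neg)).congr (fun i => ?_) fun i => rfl
    have h3 := hE (φ i)
    simp only [hE₂] at h3
    rw [h3]
    ring

/-! ### Infinite words made of blocks -/

section Concat

variable {A : Type}

/-- The concatenation of the first `m` blocks. -/
def catBlocks (ω : ℕ → List A) : ℕ → List A
  | 0 => []
  | m + 1 => catBlocks ω m ++ ω m

/-- The infinite word obtained by concatenating all blocks. -/
def letterSeq (a₀ : A) (ω : ℕ → List A) (n : ℕ) : A := (catBlocks ω (n + 1)).getD n a₀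

/-- The total length of the first `m` blocks. -/
def totalLen (len : ℕ → ℕ) (m : ℕ) : ℕ := ∑ i ∈ Finset.range m, len i

theorem totalLen_succ (len : ℕ → ℕ) (m : ℕ) : totalLen len (m + 1) = totalLen len m + len m :=
  Finset.sum_range_succ _ _

theorem le_totalLen {len : ℕ → ℕ} (h : ∀ i, 1 ≤ len i) (m : ℕ) : m ≤ totalLen len m := by
  induction m with
  | zero => exact Nat.zero_le _
  | succ m ih =>
    have := h m
    rw [totalLen_succ]
    omega

theorem length_catBlocks {ω : ℕ → List A} {len : ℕ → ℕ} (hω : ∀ i, (ω i).length = len i) (m : ℕ) :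
    (catBlocks ω m).length = totalLen len m := by
  induction m with
  | zero => rfl
  | succ m ih => rw [catBlocks, List.length_append, ih, hω, totalLen_succ]

theorem catBlocks_prefix (ω : ℕ → List A) {m m' : ℕ} (h : m ≤ m') :
    catBlocks ω m <+: catBlocks ω m' := by
  induction m', h using Nat.le_induction with
  | base => exact List.prefix_rfl
  | succ k _ ih => exact ih.trans (List.prefix_append _ _)

/-- The blocks are nonempty, so n + 1 of them have more than n letters: the default a₀ is never
read, and every long enough concatenation shows the same letter. -/
theorem letterSeq_eq (a₀ : A) {ω : ℕ → List A} {len : ℕ → ℕ} (hω : ∀ i, (ω i).length = len i)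
    (hl : ∀ i, 1 ≤ len i) {n m : ℕ} (h : n < (catBlocks ω m).length) :
    letterSeq a₀ ω n = (catBlocks ω m)[n] := by
  have h2 : n < (catBlocks ω (n + 1)).length := by
    rw [length_catBlocks hω]
    exact le_totalLen hl (n + 1)
  rw [letterSeq, List.getD_eq_getElem _ _ h2]
  rcases le_total m (n + 1) with h3 | h3
  · exact ((catBlocks_prefix ω h3).getElem h).symm
  · exact (catBlocks_prefix ω h3).getElem h2

theorem ofFn_letterSeq (a₀ : A) {ω : ℕ → List A} {len : ℕ → ℕ} (hω : ∀ i, (ω i).length = len i)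
    (hl : ∀ i, 1 ≤ len i) {n m : ℕ} (h : n ≤ totalLen len m) :
    List.ofFn (fun i : Fin n => letterSeq a₀ ω i) = (catBlocks ω m).take n := by
  have hlen := length_catBlocks hω m
  refine List.ext_getElem (by simp [hlen, h]) fun i h1 h2 => ?_
  rw [List.getElem_ofFn, List.getElem_take]
  exact letterSeq_eq a₀ hω hl _

/-- The lengths are prescribed, so a concatenation can be cut back into blocks. The map f is the
identity for blocks known completely and `Prod.fst` for those known through their first coordinates.
-/
theorem eq_of_catBlocks_eq {B : Type} (f : A → B) {ω ω' : ℕ → List A} {len : ℕ → ℕ}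
    (hω : ∀ i, (ω i).length = len i) (hω' : ∀ i, (ω' i).length = len i) {m : ℕ}
    (h : (catBlocks ω m).map f = (catBlocks ω' m).map f) {i : ℕ} (hi : i < m) :
    (ω i).map f = (ω' i).map f := by
  induction m with
  | zero => omega
  | succ m ih =>
    rw [catBlocks, catBlocks, List.map_append, List.map_append] at h
    have h2 := List.append_inj h (by
      rw [List.length_map, List.length_map, length_catBlocks hω, length_catBlocks hω'])
    rcases Nat.lt_succ_iff_lt_or_eq.1 hi with h3 | rfl
    · exact ih h2.1 h3
    · exact h2.2

theorem AlmostMul.catBlocks_pos {C : ℝ} {F : List A → ℝ} (h : AlmostMul C F) {ω : ℕ → List A}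
    (hω : ∀ i, 0 < F (ω i)) (m : ℕ) : 0 < F (catBlocks ω m) := by
  induction m with
  | zero =>
    have : 0 < F ([] ++ ω 0) := hω 0
    exact (h.pos_append.1 this).1
  | succ m ih => exact h.pos_append.2 ⟨ih, hω m⟩

theorem AlmostMul.abs_log_catBlocks {C : ℝ} {F : List A → ℝ} (h : AlmostMul C F)
    {ω : ℕ → List A} (hω : ∀ i, 0 < F (ω i)) (m : ℕ) :
    |Real.log (F (catBlocks ω m)) - ∑ i ∈ Finset.range m, Real.log (F (ω i))| ≤
      m * Real.log C + |Real.log (F [])| := by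
  induction m with
  | zero => simp [catBlocks]
  | succ m ih =>
    have h1 := h.abs_log_append (h.pos_append.2 ⟨h.catBlocks_pos hω m, hω m⟩)
    rw [Finset.sum_range_succ, catBlocks]
    push_cast
    rw [abs_le] at *
    constructor <;> linarith

/-- The number of blocks contained in the first `n` letters. -/
def blockIdx (len : ℕ → ℕ) (n : ℕ) : ℕ := Nat.findGreatest (fun m => totalLen len m ≤ n) n

variable {len : ℕ → ℕ}

theorem totalLen_blockIdx_le (len : ℕ → ℕ) (n : ℕ) : totalLen len (blockIdx len n) ≤ n :=
  Nat.findGreatest_spec (P := fun m => totalLen len m ≤ n) (Nat.zero_le n)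
    (by simp [totalLen])

theorem le_blockIdx (hl : ∀ i, 1 ≤ len i) {n m : ℕ} (h : totalLen len m ≤ n) :
    m ≤ blockIdx len n :=
  Nat.le_findGreatest ((le_totalLen hl m).trans h) h

theorem lt_totalLen_blockIdx_succ (hl : ∀ i, 1 ≤ len i) (n : ℕ) :
    n < totalLen len (blockIdx len n + 1) := by
  by_contra! h
  have := le_blockIdx hl h
  omega

theorem blockIdx_mono (hl : ∀ i, 1 ≤ len i) : Monotone (blockIdx len) := fun _ _ h =>
  le_blockIdx hl ((totalLen_blockIdx_le len _).trans h)

theorem tendsto_blockIdx (hl : ∀ i, 1 ≤ len i) : Tendsto (blockIdx len) atTop atTop := by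
  rw [tendsto_atTop]
  intro m
  filter_upwards [eventually_ge_atTop (totalLen len m)] with n hn
  exact le_blockIdx hl hn

end Concat

/-! ### Negligible quantities along the blocks -/

theorem isLittleO_sqrt_sqrt : (fun m : ℕ => √√((m : ℝ) + 1)) =o[atTop] fun m : ℕ => (m : ℝ) := by
  rw [Asymptotics.isLittleO_iff]
  intro c hc
  have ht : Tendsto (fun i : ℕ => √√((i : ℝ) + 1)) atTop atTop :=
    Real.tendsto_sqrt_atTop.comp (Real.tendsto_sqrt_atTop.comp
      (tendsto_atTop_add_const_right _ _ tendsto_natCast_atTop_atTop))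
  filter_upwards [ht.eventually_ge_atTop (1 / c + 1)] with m hm
  set t := √√((m : ℝ) + 1) with htdef
  have h4 : (m : ℝ) = t ^ 4 - 1 := by
    rw [htdef, show √√((m : ℝ) + 1) ^ 4 = (√√((m : ℝ) + 1) ^ 2) ^ 2 by ring,
      Real.sq_sqrt (Real.sqrt_nonneg _), Real.sq_sqrt (by positivity)]
    ring
  have hc' : 0 < 1 / c := by positivity
  have ht1 : 1 ≤ t := by linarith
  have hct : 1 + c ≤ c * t := by
    have := mul_le_mul_of_nonneg_left hm hc.le
    rw [mul_add, mul_one_div_cancel hc.ne', mul_one] at this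
    exact this
  rw [Real.norm_of_nonneg (by linarith), Real.norm_of_nonneg (Nat.cast_nonneg m), h4]
  have h5 : t ^ 2 ≤ t ^ 4 := pow_le_pow_right₀ ht1 (by norm_num)
  have h6 : t * (1 + c) ≤ t * (c * t) := mul_le_mul_of_nonneg_left hct (by linarith)
  nlinarith

namespace BlockLaws

variable {r₁ r₂ : ℕ} {Ψ : List (Fin r₁ × Fin r₂) → ℝ} {α h h' M : ℝ} {len : ℕ → ℕ}
  {p : ℕ → List (Fin r₁ × Fin r₂) → ℝ}

theorem natCast_isBigO_totalLen (H : BlockLaws Ψ α h h' M len p) :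
    (fun m : ℕ => (m : ℝ)) =O[atTop] fun m => (totalLen len m : ℝ) :=
  Asymptotics.IsBigO.of_bound 1 (Eventually.of_forall fun m => by
    rw [Real.norm_of_nonneg (Nat.cast_nonneg _), Real.norm_of_nonneg (Nat.cast_nonneg _), one_mul]
    exact_mod_cast le_totalLen H.len_pos m)

theorem sum_isLittleO (H : BlockLaws Ψ α h h' M len p) {f : ℕ → ℝ}
    (hf : f =o[atTop] fun i => (len i : ℝ)) :
    (fun m => ∑ i ∈ Finset.range m, f i) =o[atTop] fun m => (totalLen len m : ℝ) := by
  have ht : Tendsto (fun m => ∑ i ∈ Finset.range m, (len i : ℝ)) atTop atTop := by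
    refine tendsto_atTop_mono (fun m => ?_) tendsto_natCast_atTop_atTop
    have := le_totalLen H.len_pos m
    rw [totalLen] at this
    exact_mod_cast this
  have := hf.sum_range (fun i => Nat.cast_nonneg _) ht
  simpa [totalLen] using this

/-- Because the lengths tend to infinity, a bounded error per junction is negligible compared with
the number of letters. -/
theorem natCast_isLittleO_totalLen (H : BlockLaws Ψ α h h' M len p) :
    (fun m : ℕ => (m : ℝ)) =o[atTop] fun m => (totalLen len m : ℝ) := by
  have h1 : (fun _ : ℕ => (1 : ℝ)) =o[atTop] fun i => (len i : ℝ) := by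
    rw [Asymptotics.isLittleO_one_left_iff]
    simp only [Real.norm_natCast]
    exact tendsto_natCast_atTop_atTop.comp H.len_tendsto
  simpa using H.sum_isLittleO h1

/-- The length of block m is O(m^(1/4)) while m blocks have at least m letters, so an incomplete
block is negligible. -/
theorem len_isLittleO_totalLen (H : BlockLaws Ψ α h h' M len p) :
    (fun m : ℕ => (len m : ℝ)) =o[atTop] fun m => (totalLen len m : ℝ) := by
  have h1 : (fun m : ℕ => (len m : ℝ)) =O[atTop] fun m : ℕ => √√((m : ℝ) + 1) :=
    Asymptotics.IsBigO.of_bound M (Eventually.of_forall fun m => by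
      rw [Real.norm_of_nonneg (Nat.cast_nonneg _), Real.norm_of_nonneg (Real.sqrt_nonneg _)]
      exact H.len_le m)
  exact (h1.trans_isLittleO isLittleO_sqrt_sqrt).trans_isBigO H.natCast_isBigO_totalLen

theorem comp_blockIdx (H : BlockLaws Ψ α h h' M len p) {f : ℕ → ℝ}
    (hf : f =o[atTop] fun m => (totalLen len m : ℝ)) :
    (fun n => f (blockIdx len n)) =o[atTop] fun n : ℕ => (n : ℝ) := by
  refine (hf.comp_tendsto (tendsto_blockIdx H.len_pos)).trans_isBigO
    (Asymptotics.IsBigO.of_bound 1 (Eventually.of_forall fun n => ?_))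
  simp only [Function.comp_apply]
  rw [Real.norm_of_nonneg (Nat.cast_nonneg _), Real.norm_of_nonneg (Nat.cast_nonneg _), one_mul]
  exact_mod_cast totalLen_blockIdx_le len n

theorem sub_totalLen_isLittleO (H : BlockLaws Ψ α h h' M len p) :
    (fun n : ℕ => (n : ℝ) - totalLen len (blockIdx len n)) =o[atTop] fun n : ℕ => (n : ℝ) := by
  refine Asymptotics.IsBigO.trans_isLittleO (Asymptotics.IsBigO.of_bound 1
    (Eventually.of_forall fun n => ?_)) (H.comp_blockIdx H.len_isLittleO_totalLen)
  have h1 : (totalLen len (blockIdx len n) : ℝ) ≤ n := by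
    exact_mod_cast totalLen_blockIdx_le len n
  have h2 : (n : ℝ) ≤ totalLen len (blockIdx len n) + len (blockIdx len n) := by
    have := lt_totalLen_blockIdx_succ H.len_pos n
    rw [totalLen_succ] at this
    exact_mod_cast this.le
  rw [Real.norm_of_nonneg (by linarith), Real.norm_of_nonneg (Nat.cast_nonneg _)]
  linarith

end BlockLaws

/-! ### Exponents and mass bounds at points made of blocks -/

section BlockPoint

variable {r₁ r₂ : ℕ}

/-- The point of the product space obtained by concatenating all blocks. -/
def blockPoint (a₀ : Fin r₁ × Fin r₂) (ω : ℕ → List (Fin r₁ × Fin r₂)) :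
    SymbSpace r₁ × SymbSpace r₂ :=
  (fun n => (letterSeq a₀ ω n).1, fun n => (letterSeq a₀ ω n).2)

theorem word_fst_blockPoint (a₀ : Fin r₁ × Fin r₂) {ω : ℕ → List (Fin r₁ × Fin r₂)} {len : ℕ → ℕ}
    (hω : ∀ i, (ω i).length = len i) (hl : ∀ i, 1 ≤ len i) {n m : ℕ} (h : n ≤ totalLen len m) :
    (blockPoint a₀ ω).1.word n = ((catBlocks ω m).take n).map Prod.fst := by
  rw [← ofFn_letterSeq a₀ hω hl h, List.map_ofFn]
  rfl

theorem word_snd_blockPoint (a₀ : Fin r₁ × Fin r₂) {ω : ℕ → List (Fin r₁ × Fin r₂)} {len : ℕ → ℕ}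
    (hω : ∀ i, (ω i).length = len i) (hl : ∀ i, 1 ≤ len i) {n m : ℕ} (h : n ≤ totalLen len m) :
    (blockPoint a₀ ω).2.word n = ((catBlocks ω m).take n).map Prod.snd := by
  rw [← ofFn_letterSeq a₀ hω hl h, List.map_ofFn]
  rfl

theorem zip_word_blockPoint (a₀ : Fin r₁ × Fin r₂) {ω : ℕ → List (Fin r₁ × Fin r₂)} {len : ℕ → ℕ}
    (hω : ∀ i, (ω i).length = len i) (hl : ∀ i, 1 ≤ len i) {n m : ℕ} (h : n ≤ totalLen len m) :
    ((blockPoint a₀ ω).1.word n).zip ((blockPoint a₀ ω).2.word n) = (catBlocks ω m).take n := by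
  rw [word_fst_blockPoint a₀ hω hl h, word_snd_blockPoint a₀ hω hl h, ← List.unzip_fst,
    ← List.unzip_snd, List.zip_unzip]

variable {ψ : CylFun (Fin r₁ × Fin r₂)} {α h h' M : ℝ} {len : ℕ → ℕ}
  {p : ℕ → List (Fin r₁ × Fin r₂) → ℝ}

/-- A prefix of length n consists of m complete blocks and a piece of the next one. The junctions
cost at most m log C and the piece O(len m + 1), both o(n), so the exponent along complete blocks
decides. -/
theorem BlockLaws.blockPoint_mem_levelSet (H : BlockLaws ψ.onLists α h h' M len p) {C : ℝ}
    (hr₂ : 2 ≤ r₂) (hC : AlmostMul C ψ.onLists) (a₀ : Fin r₁ × Fin r₂)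
    {ω : ℕ → List (Fin r₁ × Fin r₂)} (hω : ∀ i, (ω i).length = len i)
    (hpos : ∀ i, 0 < ψ.onLists (ω i))
    (hexp : (fun m => ∑ i ∈ Finset.range m, Real.log (ψ.onLists (ω i)) +
      totalLen len m * (α * Real.log r₂)) =o[atTop] fun m => (totalLen len m : ℝ)) :
    blockPoint a₀ ω ∈ levelSet ψ α := by
  have hl2 : 0 < Real.log r₂ := Real.log_pos (by exact_mod_cast hr₂)
  have hl := H.len_pos
  have hlC : 0 ≤ Real.log C := Real.log_nonneg hC.one_le
  set x : ℕ → ℝ := fun n => Real.log (cylValue ψ (blockPoint a₀ ω) n) with hx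
  have hsplit : ∀ n, ∃ v : List (Fin r₁ × Fin r₂), v.length ≤ len (blockIdx len n) ∧
      cylValue ψ (blockPoint a₀ ω) n = ψ.onLists (catBlocks ω (blockIdx len n) ++ v) ∧
      0 < ψ.onLists (catBlocks ω (blockIdx len n) ++ v) := by
    intro n
    set m := blockIdx len n
    have h1 : n ≤ totalLen len (m + 1) := (lt_totalLen_blockIdx_succ hl n).le
    have h2 : totalLen len m ≤ n := totalLen_blockIdx_le len n
    have h3 : (catBlocks ω (m + 1)).take n =
        catBlocks ω m ++ (ω m).take (n - totalLen len m) := by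
      rw [catBlocks, List.take_append, length_catBlocks hω, List.take_of_length_le]
      rwa [length_catBlocks hω]
    refine ⟨(ω m).take (n - totalLen len m), ?_, ?_, ?_⟩
    · rw [List.length_take, hω]
      exact min_le_right _ _
    · rw [cylValue_eq, zip_word_blockPoint a₀ hω hl h1, h3]
    · rw [← h3]
      have h4 := hC.catBlocks_pos hpos (m + 1)
      rw [← List.take_append_drop n (catBlocks ω (m + 1))] at h4
      exact (hC.pos_append.1 h4).1
  refine ⟨fun n => ?_, ?_⟩
  · obtain ⟨v, -, h2, h3⟩ := hsplit n
    rw [h2]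
    exact h3
  obtain ⟨b, hb, hbd⟩ := hC.exists_abs_log_le
  have e1 : (fun n : ℕ => x n - ∑ i ∈ Finset.range (blockIdx len n), Real.log (ψ.onLists (ω i)))
      =o[atTop] fun n : ℕ => (n : ℝ) := by
    have g1 := (H.comp_blockIdx H.natCast_isLittleO_totalLen).const_mul_left (Real.log C)
    have g2 := (H.comp_blockIdx H.len_isLittleO_totalLen).const_mul_left b
    have g3 : (fun _ : ℕ => |Real.log (ψ.onLists [])| + Real.log C + b) =o[atTop]
        fun n : ℕ => (n : ℝ) :=
      Asymptotics.isLittleO_const_left.2 (Or.inr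
        (tendsto_norm_atTop_atTop.comp tendsto_natCast_atTop_atTop))
    refine Asymptotics.IsBigO.trans_isLittleO (Asymptotics.IsBigO.of_bound 1
      (Eventually.of_forall fun n => ?_)) ((g1.add g2).add g3)
    obtain ⟨v, h1, h2, h3⟩ := hsplit n
    have c1 := hC.abs_log_append h3
    have c2 := hC.abs_log_catBlocks hpos (blockIdx len n)
    have c3 := hbd v (hC.pos_append.1 h3).2
    have c4 : b * ((v.length : ℝ) + 1) ≤ b * (len (blockIdx len n) + 1) := by gcongr
    simp only [hx, h2]
    rw [one_mul, Real.norm_eq_abs]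
    refine le_trans ?_ (le_abs_self _)
    rw [abs_le] at *
    constructor <;> linarith
  have e2 : (fun n : ℕ => x n + n * (α * Real.log r₂)) =o[atTop] fun n : ℕ => (n : ℝ) := by
    have g1 := H.comp_blockIdx hexp
    have g2 := H.sub_totalLen_isLittleO.const_mul_left (α * Real.log r₂)
    refine ((e1.add g1).add g2).congr (fun n => ?_) fun n => rfl
    ring
  have e3 := (e2.tendsto_div_nhds_zero.const_mul (-(1 / Real.log r₂))).add_const α
  rw [mul_zero, zero_add] at e3
  refine e3.congr' ?_
  filter_upwards [eventually_ne_atTop 0] with n hn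
  have hn' : (n : ℝ) ≠ 0 := by exact_mod_cast hn
  rw [Real.logb]
  simp only [hx]
  field_simp
  ring

/-- The logarithm of the mass bound for the approximate square of order `n` at a point given by
blocks. -/
noncomputable def logMassBound (p : ℕ → List (Fin r₁ × Fin r₂) → ℝ) (len : ℕ → ℕ)
    (ω : ℕ → List (Fin r₁ × Fin r₂)) (n : ℕ) : ℝ :=
  ∑ i ∈ Finset.range (blockIdx len n), Real.log (p i (ω i)) +
    ∑ i ∈ Finset.Ico (blockIdx len n) (blockIdx len (longLen r₁ r₂ n)),
      Real.log (fiberPart (p i) ((ω i).map Prod.fst))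

/-- Up to o(n), the blocks in the first n letters contribute at most -hn, and the marginals of those
between n and l contribute -h'(l - n). As h' ≥ 0, l can be replaced by n/s, which gives the rate h +
(1/s - 1) h'. -/
theorem BlockLaws.eventually_logMassBound_le (H : BlockLaws ψ.onLists α h h' M len p)
    (hr₁ : 2 ≤ r₁) (hr : r₁ ≤ r₂) (hh' : 0 ≤ h') {ω : ℕ → List (Fin r₁ × Fin r₂)}
    {ρ : ℕ → ℝ} (hρ : ρ =o[atTop] fun m => (totalLen len m : ℝ))
    (h1 : ∀ m, ∑ i ∈ Finset.range m, Real.log (p i (ω i)) ≤ -(h * totalLen len m) + ρ m)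
    (h2 : (fun m => ∑ i ∈ Finset.range m, Real.log (fiberPart (p i) ((ω i).map Prod.fst)) +
      h' * totalLen len m) =o[atTop] fun m => (totalLen len m : ℝ)) {t : ℝ}
    (ht : t < h + (1 / sExp r₁ r₂ - 1) * h') :
    ∀ᶠ n : ℕ in atTop, logMassBound p len ω n ≤ -(t * n) := by
  have hs := sExp_pos hr₁ hr
  set s := sExp r₁ r₂ with hsdef
  have hl := H.len_pos
  set c : ℕ → ℝ := fun m => ∑ i ∈ Finset.range m, Real.log (fiberPart (p i) ((ω i).map Prod.fst))
    with hc
  set l : ℕ → ℕ := longLen r₁ r₂ with hldef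
  have hlt : Tendsto l atTop atTop := tendsto_atTop_mono (fun n => le_longLen hr₁ hr n) tendsto_id
  have hlO : (fun n => (l n : ℝ)) =O[atTop] fun n : ℕ => (n : ℝ) := by
    refine Asymptotics.IsBigO.of_bound (1 / s + 1) ?_
    filter_upwards [eventually_ge_atTop 1] with n hn
    have hn' : (1 : ℝ) ≤ n := by exact_mod_cast hn
    rw [Real.norm_of_nonneg (Nat.cast_nonneg _), Real.norm_of_nonneg (Nat.cast_nonneg _)]
    have : (l n : ℝ) < n / s + 1 := Nat.ceil_lt_add_one (by positivity)
    calc (l n : ℝ) ≤ n / s + 1 := this.le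
      _ ≤ n / s + n := by linarith
      _ = _ := by ring
  have o1 := H.comp_blockIdx hρ
  have o2 := H.comp_blockIdx h2
  have o3 : (fun n => c (blockIdx len (l n)) + h' * totalLen len (blockIdx len (l n)))
      =o[atTop] fun n : ℕ => (n : ℝ) := (o2.comp_tendsto hlt).trans_isBigO hlO
  have o4 := H.sub_totalLen_isLittleO
  have o5 : (fun n => (l n : ℝ) - totalLen len (blockIdx len (l n)))
      =o[atTop] fun n : ℕ => (n : ℝ) := (o4.comp_tendsto hlt).trans_isBigO hlO
  have o := ((((o1.sub o2).add o3).add (o4.const_mul_left (h - h'))).add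
    (o5.const_mul_left h'))
  have hgap : 0 < h + (1 / s - 1) * h' - t := by linarith
  filter_upwards [(Asymptotics.isLittleO_iff.1 o) hgap] with n hn
  rw [Real.norm_eq_abs, Real.norm_of_nonneg (Nat.cast_nonneg n)] at hn
  have hn2 := (le_abs_self _).trans hn
  have hmM : blockIdx len n ≤ blockIdx len (l n) := blockIdx_mono hl (le_longLen hr₁ hr n)
  have e1 : logMassBound p len ω n = ∑ i ∈ Finset.range (blockIdx len n), Real.log (p i (ω i)) +
      (c (blockIdx len (l n)) - c (blockIdx len n)) := by
    rw [logMassBound, Finset.sum_Ico_eq_sub _ hmM]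
  have e2 := h1 (blockIdx len n)
  have e3 : (n : ℝ) / s ≤ l n := Nat.le_ceil _
  have e4 := mul_le_mul_of_nonneg_left e3 hh'
  rw [e1]
  have e5 : (h + (1 / s - 1) * h' - t) * n = h * n + h' * (n / s) - h' * n - t * n := by ring
  rw [e5] at hn2
  linarith

end BlockPoint

/-! ### The product measure, the mass distribution principle and the lower bound -/

instance List.instMeasurableSpaceTop (A : Type) : MeasurableSpace (List A) := ⊤

instance List.instDiscreteMeasurableSpace (A : Type) : DiscreteMeasurableSpace (List A) :=
  ⟨fun _ => trivial⟩

section BlockLaw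

variable {A : Type} [Fintype A]

/-- The measure on words of length `n` with weights `p`. -/
noncomputable def blockLaw (n : ℕ) (p : List A → ℝ) : Measure (List A) :=
  ∑ w ∈ wordsOf A n, ENNReal.ofReal (p w) • Measure.dirac w

variable {n : ℕ} {p : List A → ℝ}

theorem blockLaw_apply (hp : ∀ w, 0 ≤ p w) (S : Set (List A)) :
    blockLaw n p S = ENNReal.ofReal (∑ w ∈ wordsOf A n, p w * S.indicator 1 w) := by
  rw [blockLaw, Measure.finsetSum_apply, ENNReal.ofReal_sum_of_nonneg]
  · refine Finset.sum_congr rfl fun w _ => ?_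
    rw [Measure.smul_apply, Measure.dirac_apply' _ (MeasurableSet.of_discrete), smul_eq_mul]
    by_cases hw : w ∈ S <;> simp [hw]
  · intro w _
    exact mul_nonneg (hp w) (Set.indicator_nonneg (fun _ _ => zero_le_one) _)

theorem isProbabilityMeasure_blockLaw (hp : ∀ w, 0 ≤ p w) (h1 : ∑ w ∈ wordsOf A n, p w = 1) :
    IsProbabilityMeasure (blockLaw n p) :=
  ⟨by simp [blockLaw_apply hp, h1]⟩

theorem ae_blockLaw (hp : ∀ w, 0 ≤ p w) : ∀ᵐ w ∂(blockLaw n p), w ∈ wordsOf A n ∧ 0 < p w := by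
  rw [ae_iff, blockLaw_apply hp, ENNReal.ofReal_eq_zero]
  refine (Finset.sum_eq_zero fun w hw => ?_).le
  rcases (hp w).eq_or_lt with h0 | h0
  · rw [← h0, zero_mul]
  · rw [Set.indicator_of_notMem (by simp [hw, h0]), mul_zero]

theorem integral_blockLaw (hp : ∀ w, 0 ≤ p w) (f : List A → ℝ) :
    ∫ w, f w ∂(blockLaw n p) = ∑ w ∈ wordsOf A n, p w * f w := by
  rw [blockLaw, integral_finsetSum_measure]
  · refine Finset.sum_congr rfl fun w _ => ?_
    rw [integral_smul_measure, integral_dirac, ENNReal.toReal_ofReal (hp w), smul_eq_mul]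
  · intro w _
    exact (integrable_dirac (by simp)).smul_measure ENNReal.ofReal_ne_top

end BlockLaw

/-- An elementary mass distribution principle: the Hausdorff dimension of a set is at least `d` if
the set carries an outer measure that decays faster than `R ^ (-d n)` on sets of diameter at most
`R ^ (-n)`. -/
theorem le_dimH_of_outerMeasure {X : Type*} [EMetricSpace X] {E : Set X} (ν : OuterMeasure X)
    (hE : ν E ≠ 0) {R : ℝ} (hR : 1 < R) {d : ℝ≥0} (hd : 0 < d) {d' : ℝ} (hdd : d < d') {k : ℕ}
    (hν : ∀ n, k ≤ n → ∀ S : Set X, Metric.ediam S ≤ ENNReal.ofReal (R ^ n)⁻¹ →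
      ν S ≤ ENNReal.ofReal (Real.exp (-(d' * Real.log R * n)))) : d ≤ dimH E := by
  have hR0 : 0 < R := zero_lt_one.trans hR
  have hlR : 0 < Real.log R := Real.log_pos hR
  have hd' : 0 < d' := lt_trans (NNReal.coe_pos.2 hd) hdd
  -- From this order on d(n + 1) ≤ d'n, so the gap between d and d' pays for rounding the diameter
  -- to a power of R.
  obtain ⟨k', hk'⟩ := exists_nat_gt ((d : ℝ) / (d' - d))
  rw [div_lt_iff₀ (by linarith)] at hk'
  set K := max k k' with hK
  borelize X
  refine le_dimH_of_hausdorffMeasure_ne_zero ?_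
  have hle : ν ≤ OuterMeasure.mkMetric fun r => r ^ (d : ℝ) := by
    refine OuterMeasure.le_mkMetric _ ν (ENNReal.ofReal (R ^ K)⁻¹) (by positivity) fun S hS => ?_
    rcases eq_or_ne (Metric.ediam S) 0 with h0 | h0
    · have hall : ∀ n, k ≤ n → ν S ≤ ENNReal.ofReal (Real.exp (-(d' * Real.log R * n))) :=
        fun n hn => hν n hn S (by rw [h0]; exact zero_le)
      have hlim : Tendsto (fun n : ℕ => ENNReal.ofReal (Real.exp (-(d' * Real.log R * n)))) atTop
          (𝓝 0) := by
        rw [← ENNReal.ofReal_zero]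
        refine ENNReal.tendsto_ofReal (Real.tendsto_exp_neg_atTop_nhds_zero.comp ?_)
        exact tendsto_natCast_atTop_atTop.const_mul_atTop (by positivity)
      exact (ge_of_tendsto hlim (eventually_atTop.2 ⟨k, hall⟩)).trans zero_le
    · have htop : Metric.ediam S ≠ ∞ := ne_top_of_le_ne_top ENNReal.ofReal_ne_top hS
      set x := (Metric.ediam S).toReal with hx
      have hSx : Metric.ediam S = ENNReal.ofReal x := (ENNReal.ofReal_toReal htop).symm
      have hx0 : 0 < x := ENNReal.toReal_pos h0 htop
      have hxK : x ≤ (R ^ K)⁻¹ := by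
        rw [hSx] at hS
        exact (ENNReal.ofReal_le_ofReal_iff (by positivity)).1 hS
      have hx1 : x ≤ 1 := hxK.trans (inv_le_one_of_one_le₀ (one_le_pow₀ hR.le))
      obtain ⟨n, hn1, hn2⟩ := exists_nat_pow_near_of_lt_one hx0 hx1 (inv_pos.2 hR0)
        (inv_lt_one_of_one_lt₀ hR)
      rw [inv_pow] at hn1 hn2
      have hKn : K ≤ n := by
        have h3 := hn1.trans_le hxK
        rw [inv_lt_inv₀ (by positivity) (by positivity)] at h3
        have := (pow_lt_pow_iff_right₀ hR).1 h3
        omega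
      have h4 := hν n ((le_max_left _ _).trans hKn) S (by
        rw [hSx]
        exact ENNReal.ofReal_le_ofReal hn2)
      refine h4.trans ?_
      rw [hSx, ENNReal.ofReal_rpow_of_nonneg hx0.le d.coe_nonneg]
      refine ENNReal.ofReal_le_ofReal ?_
      have h5 : (k' : ℝ) ≤ n := by exact_mod_cast (le_max_right _ _).trans hKn
      calc Real.exp (-(d' * Real.log R * n)) ≤ Real.exp (-(d * Real.log R * (n + 1))) := by
            rw [Real.exp_le_exp]
            have h6 : (d : ℝ) * (n + 1) ≤ d' * n := by nlinarith
            nlinarith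
        _ = ((R ^ (n + 1))⁻¹) ^ (d : ℝ) := by
            rw [Real.rpow_def_of_pos (by positivity), Real.log_inv, Real.log_pow]
            push_cast
            congr 1
            ring
        _ ≤ x ^ (d : ℝ) := Real.rpow_le_rpow (by positivity) hn1.le d.coe_nonneg
  intro hzero
  have := hle E
  rw [← Measure.mkMetric_toOuterMeasure] at this
  exact hE (le_antisymm (this.trans hzero.le) zero_le)

namespace BlockLaws

variable {r₁ r₂ : ℕ} {ψ : CylFun (Fin r₁ × Fin r₂)} {α h h' M : ℝ} {len : ℕ → ℕ}
  {p : ℕ → List (Fin r₁ × Fin r₂) → ℝ}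

/-- The law of a sequence of independent blocks. -/
noncomputable def blockMeasure (len : ℕ → ℕ) (p : ℕ → List (Fin r₁ × Fin r₂) → ℝ) :
    Measure (ℕ → List (Fin r₁ × Fin r₂)) :=
  Measure.infinitePi fun i => blockLaw (len i) (p i)

theorem isProbabilityMeasure (H : BlockLaws ψ.onLists α h h' M len p) (i : ℕ) :
    IsProbabilityMeasure (blockLaw (len i) (p i)) :=
  isProbabilityMeasure_blockLaw (H.nonneg i) (H.sum_eq i)

theorem ae_mem (H : BlockLaws ψ.onLists α h h' M len p) :
    ∀ᵐ ω ∂(blockMeasure len p), ∀ i, ω i ∈ wordsOf (Fin r₁ × Fin r₂) (len i) ∧ 0 < p i (ω i) := by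
  have := H.isProbabilityMeasure
  refine ae_all_iff.2 fun i => ?_
  exact (measurePreserving_eval_infinitePi (fun i => blockLaw (len i) (p i))
    i).quasiMeasurePreserving.ae (ae_blockLaw (H.nonneg i))

open ProbabilityTheory in
/-- The law of large numbers for functions of the blocks. -/
theorem ae_isLittleO (H : BlockLaws ψ.onLists α h h' M len p) (f : ℕ → List (Fin r₁ × Fin r₂) → ℝ)
    (hf : ∀ i : ℕ, ∀ w ∈ wordsOf (Fin r₁ × Fin r₂) (len i), |f i w| ≤ M * √√(i + 1)) :
    ∀ᵐ ω ∂(blockMeasure len p), (fun m => ∑ i ∈ Finset.range m,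
      (f i (ω i) - ∑ w ∈ wordsOf (Fin r₁ × Fin r₂) (len i), p i w * f i w)) =o[atTop]
      fun m => (totalLen len m : ℝ) := by
  have := H.isProbabilityMeasure
  have hmeas : ∀ i, Measurable (f i) := fun i => Measurable.of_discrete
  have hind : iIndepFun (fun i (ω : ℕ → List (Fin r₁ × Fin r₂)) => f i (ω i))
      (blockMeasure len p) := iIndepFun_infinitePi (X := f) hmeas
  have hint : ∀ i, ∫ ω, f i (ω i) ∂(blockMeasure len p) =
      ∑ w ∈ wordsOf (Fin r₁ × Fin r₂) (len i), p i w * f i w := by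
    intro i
    rw [← integral_blockLaw (H.nonneg i), ← Measure.infinitePi_map_eval
      (fun i => blockLaw (len i) (p i)) i,
      integral_map (measurable_pi_apply i).aemeasurable (hmeas i).aestronglyMeasurable]
    rfl
  have : IsProbabilityMeasure (blockMeasure len p) := by
    unfold blockMeasure
    infer_instance
  have key := ae_isLittleO_sum (μ := blockMeasure len p)
    (X := fun i (ω : ℕ → List (Fin r₁ × Fin r₂)) => f i (ω i))
    (fun i => (hmeas i).comp (measurable_pi_apply i)) hind H.const_pos (fun i => by
      filter_upwards [H.ae_mem] with ω hω
      exact hf i _ (hω i).1)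
  filter_upwards [key] with ω hω
  simp only [hint] at hω
  exact hω.trans_isBigO H.natCast_isBigO_totalLen

/-- The points whose prefixes behave typically. -/
theorem ae_typical (H : BlockLaws ψ.onLists α h h' M len p) :
    ∀ᵐ ω ∂(blockMeasure len p),
      (fun m => ∑ i ∈ Finset.range m, Real.log (ψ.onLists (ω i)) +
        totalLen len m * (α * Real.log r₂)) =o[atTop] (fun m => (totalLen len m : ℝ)) ∧
      (∃ ρ : ℕ → ℝ, ρ =o[atTop] (fun m => (totalLen len m : ℝ)) ∧
        ∀ m, ∑ i ∈ Finset.range m, Real.log (p i (ω i)) ≤ -(h * totalLen len m) + ρ m) ∧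
      (fun m => ∑ i ∈ Finset.range m, Real.log (fiberPart (p i) ((ω i).map Prod.fst)) +
        h' * totalLen len m) =o[atTop] fun m => (totalLen len m : ℝ) := by
  obtain ⟨ρ, hρ, hρ'⟩ := H.entropy₁
  filter_upwards [H.ae_isLittleO (fun _ w => Real.log (ψ.onLists w)) (fun i w hw => (H.bound i w hw).1),
    H.ae_isLittleO (fun i w => Real.log (p i w)) (fun i w hw => (H.bound i w hw).2.1),
    H.ae_isLittleO (fun i w => Real.log (fiberPart (p i) (w.map Prod.fst)))
      (fun i w hw => (H.bound i w hw).2.2)] with ω h1 h2 h3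
  have hcast : ∀ m, (totalLen len m : ℝ) = ∑ i ∈ Finset.range m, (len i : ℝ) := fun m => by
    simp [totalLen]
  refine ⟨?_, ⟨_, h2.add (H.sum_isLittleO hρ), fun m => ?_⟩, ?_⟩
  · refine (h1.add (H.sum_isLittleO H.exponent)).congr (fun m => ?_) fun m => rfl
    rw [hcast, Finset.sum_mul, ← Finset.sum_add_distrib, ← Finset.sum_add_distrib]
    exact Finset.sum_congr rfl fun i _ => by ring
  · rw [hcast, Finset.mul_sum, ← Finset.sum_neg_distrib, ← Finset.sum_add_distrib,
      ← Finset.sum_add_distrib]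
    refine Finset.sum_le_sum fun i _ => ?_
    linarith [hρ' i]
  · refine (h3.add (H.sum_isLittleO H.entropy₂)).congr (fun m => ?_) fun m => rfl
    rw [hcast, Finset.mul_sum, ← Finset.sum_add_distrib, ← Finset.sum_add_distrib]
    refine Finset.sum_congr rfl fun i _ => ?_
    rw [sum_mul_comp_map_fst (p i) (fun u => Real.log (fiberPart (p i) u))]
    ring

/-- The mass of the approximate square of order `n` around a point given by blocks. -/
theorem measure_square_le (H : BlockLaws ψ.onLists α h h' M len p) (hr₁ : 2 ≤ r₁) (hr : r₁ ≤ r₂)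
    (a₀ : Fin r₁ × Fin r₂) {ω₀ : ℕ → List (Fin r₁ × Fin r₂)}
    (hω₀ : ∀ i, ω₀ i ∈ wordsOf (Fin r₁ × Fin r₂) (len i) ∧ 0 < p i (ω₀ i)) (n : ℕ) :
    blockMeasure len p {ω | (∀ i, ω i ∈ wordsOf (Fin r₁ × Fin r₂) (len i) ∧ 0 < p i (ω i)) ∧
      dist (blockPoint a₀ ω) (blockPoint a₀ ω₀) ≤ ((r₂ : ℝ) ^ n)⁻¹} ≤
      ENNReal.ofReal (Real.exp (logMassBound p len ω₀ n)) := by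
  classical
  have := H.isProbabilityMeasure
  have hl := H.len_pos
  set l := longLen r₁ r₂ n with hldef
  have hnl : n ≤ l := le_longLen hr₁ hr n
  set m := blockIdx len n with hm
  set m' := blockIdx len l with hm'
  have hmm' : m ≤ m' := blockIdx_mono hl hnl
  -- The square determines the blocks that end within the first n letters, and the first coordinates
  -- of those that end within the first l letters. What it says about partly covered blocks is
  -- dropped, which only enlarges the set.
  set t : ℕ → Set (List (Fin r₁ × Fin r₂)) := fun i =>
    if i < m then {ω₀ i} else {w | w.map Prod.fst = (ω₀ i).map Prod.fst} with ht
  have hsub : {ω : ℕ → List (Fin r₁ × Fin r₂) |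
      (∀ i, ω i ∈ wordsOf (Fin r₁ × Fin r₂) (len i) ∧ 0 < p i (ω i)) ∧
      dist (blockPoint a₀ ω) (blockPoint a₀ ω₀) ≤ ((r₂ : ℝ) ^ n)⁻¹} ⊆
      Set.pi (Finset.range m' : Set ℕ) t := by
    rintro ω ⟨hω, hdist⟩ i hi
    have hi' : i < m' := by simpa using hi
    rw [dist_le_inv_pow_iff hr₁ hr] at hdist
    have len1 : ∀ i, (ω i).length = len i := fun i => mem_wordsOf.1 (hω i).1
    have len0 : ∀ i, (ω₀ i).length = len i := fun i => mem_wordsOf.1 (hω₀ i).1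
    have hb : ∀ k, k ≤ totalLen len (blockIdx len k + 1) := fun k =>
      (lt_totalLen_blockIdx_succ hl k).le
    have take_take : ∀ {ω : ℕ → List (Fin r₁ × Fin r₂)}, (∀ i, (ω i).length = len i) → ∀ k,
        ((catBlocks ω (blockIdx len k + 1)).take k).take (totalLen len (blockIdx len k)) =
        catBlocks ω (blockIdx len k) := by
      intro ω hω k
      rw [List.take_take, min_eq_left (totalLen_blockIdx_le len k), catBlocks,
        List.take_append_of_le_length (length_catBlocks hω _).ge,
        List.take_of_length_le (length_catBlocks hω _).le]
    simp only [ht]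
    split_ifs with him
    · have e1 : (blockPoint a₀ ω).1.word n = (blockPoint a₀ ω₀).1.word n := by
        rw [← SymbSpace.take_word _ hnl, ← SymbSpace.take_word _ hnl, hdist.1]
      have e2 := zip_word_blockPoint a₀ len1 hl (hb n)
      rw [e1, hdist.2, zip_word_blockPoint a₀ len0 hl (hb n)] at e2
      have e3 := congrArg (List.take (totalLen len (blockIdx len n))) e2
      rw [take_take len1, take_take len0] at e3
      have e4 := eq_of_catBlocks_eq id len1 len0 (m := m) (by rw [← hm] at e3; rw [e3]) him
      simpa using e4
    · have e1 := hdist.1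
      rw [word_fst_blockPoint a₀ len1 hl (hb _), word_fst_blockPoint a₀ len0 hl (hb _)] at e1
      have e3 := congrArg (List.take (totalLen len (blockIdx len l))) e1
      rw [← List.map_take, ← List.map_take, take_take len1, take_take len0] at e3
      exact eq_of_catBlocks_eq Prod.fst len1 len0 e3 hi'
  refine (measure_mono hsub).trans ?_
  rw [blockMeasure, Measure.infinitePi_pi _ fun i _ => MeasurableSet.of_discrete]
  have hfib : ∀ i, 0 < fiberPart (p i) ((ω₀ i).map Prod.fst) := by
    intro i
    refine Finset.sum_pos' (fun _ _ => H.nonneg i _) ⟨(ω₀ i).map Prod.snd, ?_, ?_⟩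
    · rw [mem_wordsOf]
      simp
    · rw [← List.unzip_fst, ← List.unzip_snd, List.zip_unzip]
      exact (hω₀ i).2
  have h1 : ∀ i, i < m → blockLaw (len i) (p i) (t i) = ENNReal.ofReal (p i (ω₀ i)) := by
    intro i hi
    simp only [ht, if_pos hi]
    rw [blockLaw_apply (H.nonneg i), Finset.sum_eq_single_of_mem _ (hω₀ i).1]
    · simp
    · intro w _ hw
      simp [hw]
  have h2 : ∀ i, ¬ i < m → blockLaw (len i) (p i) (t i) =
      ENNReal.ofReal (fiberPart (p i) ((ω₀ i).map Prod.fst)) := by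
    intro i hi
    simp only [ht, if_neg hi]
    rw [blockLaw_apply (H.nonneg i)]
    congr 1
    have e := sum_mul_comp_map_fst (p i)
      (fun u => ({(ω₀ i).map Prod.fst} : Set (List (Fin r₁))).indicator 1 u) (len i)
    have hmem : (ω₀ i).map Prod.fst ∈ wordsOf (Fin r₁) (len i) := by
      rw [mem_wordsOf, List.length_map]
      exact mem_wordsOf.1 (hω₀ i).1
    rw [Finset.sum_eq_single_of_mem _ hmem (fun u _ hu => by simp [hu])] at e
    simp only [Set.mem_singleton_iff, Set.indicator_of_mem, Pi.one_apply, mul_one] at e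
    rw [← e]
    refine Finset.sum_congr rfl fun w _ => ?_
    by_cases hw : w.map Prod.fst = (ω₀ i).map Prod.fst
    · rw [Set.indicator_of_mem (by exact hw), Set.indicator_of_mem (by exact hw)]
      rfl
    · rw [Set.indicator_of_notMem (by exact hw), Set.indicator_of_notMem (by exact hw)]
  rw [← Finset.prod_range_mul_prod_Ico _ hmm',
    Finset.prod_congr rfl fun i hi => h1 i (Finset.mem_range.1 hi),
    Finset.prod_congr rfl fun i hi => h2 i (not_lt.2 (Finset.mem_Ico.1 hi).1),
    ← ENNReal.ofReal_prod_of_nonneg fun i _ => H.nonneg i _,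
    ← ENNReal.ofReal_prod_of_nonneg fun i _ => (hfib i).le,
    ← ENNReal.ofReal_mul (Finset.prod_nonneg fun i _ => H.nonneg i _)]
  refine ENNReal.ofReal_le_ofReal (le_of_eq ?_)
  rw [logMassBound, Real.exp_add, Real.exp_sum, Real.exp_sum]
  congr 1
  · exact Finset.prod_congr rfl fun i _ => (Real.exp_log (hω₀ i).2).symm
  · exact Finset.prod_congr rfl fun i _ => (Real.exp_log (hfib i)).symm

/-- The lower bound for the dimension of a level set. -/
theorem le_dimH_levelSet (H : BlockLaws ψ.onLists α h h' M len p) (hr₁ : 2 ≤ r₁) (hr : r₁ ≤ r₂)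
    {C : ℝ} (hC : AlmostMul C ψ.onLists) (hh' : 0 ≤ h') {d : ℝ≥0} (hd : 0 < d)
    (hdh : d * Real.log r₂ < h + (1 / sExp r₁ r₂ - 1) * h') : d ≤ dimH (levelSet ψ α) := by
  have hr₂ : 2 ≤ r₂ := hr₁.trans hr
  have hR : (1 : ℝ) < r₂ := by exact_mod_cast hr₂
  have hl2 : 0 < Real.log r₂ := Real.log_pos hR
  have := H.isProbabilityMeasure
  have hprob : IsProbabilityMeasure (blockMeasure len p) := by
    unfold blockMeasure
    infer_instance
  obtain ⟨t, ht1, ht2⟩ := exists_between hdh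
  set d' := t / Real.log r₂ with hd'
  have hdd' : (d : ℝ) < d' := by
    rw [hd', lt_div_iff₀ hl2]
    exact ht1
  have ht : d' * Real.log r₂ = t := by
    rw [hd']
    field_simp
  set a₀ : Fin r₁ × Fin r₂ := (⟨0, by omega⟩, ⟨0, by omega⟩)
  -- Countably many such sets cover almost every ω, so one of them is not null, and on it the mass
  -- bound holds uniformly from order k on.
  set G : ℕ → Set (ℕ → List (Fin r₁ × Fin r₂)) := fun k => {ω |
    (∀ i, ω i ∈ wordsOf (Fin r₁ × Fin r₂) (len i) ∧ 0 < p i (ω i)) ∧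
    blockPoint a₀ ω ∈ levelSet ψ α ∧ ∀ n, k ≤ n → logMassBound p len ω n ≤ -(t * n)} with hG
  have hae : ∀ᵐ ω ∂(blockMeasure len p), ∃ k, ω ∈ G k := by
    filter_upwards [H.ae_mem, H.ae_typical] with ω h1 h2
    obtain ⟨h3, ⟨ρ, hρ, hρ'⟩, h4⟩ := h2
    obtain ⟨k, hk⟩ := eventually_atTop.1
      (H.eventually_logMassBound_le hr₁ hr hh' hρ hρ' h4 ht2)
    exact ⟨k, h1, H.blockPoint_mem_levelSet hr₂ hC a₀ (fun i => mem_wordsOf.1 (h1 i).1)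
      (fun i => H.supp i _ (h1 i).2) h3, hk⟩
  obtain ⟨k, hk⟩ : ∃ k, blockMeasure len p (G k) ≠ 0 := by
    by_contra! hzero
    have h1 : blockMeasure len p (⋃ k, G k) = 0 := measure_iUnion_null hzero
    have h2 : ∀ᵐ ω ∂(blockMeasure len p), ω ∉ ⋃ k, G k := measure_eq_zero_iff_ae_notMem.1 h1
    obtain ⟨ω, h3, h4⟩ := (hae.and h2).exists
    exact h4 (Set.mem_iUnion.2 h3)
  -- Working with an outer measure avoids any question of measurability for `G k` and `blockPoint`.
  set ν : OuterMeasure (SymbSpace r₁ × SymbSpace r₂) :=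
    OuterMeasure.map (blockPoint a₀) (OuterMeasure.restrict (G k)
      (blockMeasure len p).toOuterMeasure) with hν
  have hνapp : ∀ S, ν S = blockMeasure len p (blockPoint a₀ ⁻¹' S ∩ G k) := by
    intro S
    rw [hν, OuterMeasure.map_apply, OuterMeasure.restrict_apply]
    rfl
  refine le_dimH_of_outerMeasure ν ?_ hR hd hdd' (k := k) fun n hn S hS => ?_
  · rw [hνapp, Set.inter_eq_right.2 fun ω hω => hω.2.1]
    exact hk
  · rw [hνapp, ht]
    rcases (blockPoint a₀ ⁻¹' S ∩ G k).eq_empty_or_nonempty with h0 | ⟨ω₀, hω₀, hω₀G⟩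
    · rw [h0, measure_empty]
      exact zero_le
    -- The closed ball of radius `r₂ ^ (-n)` around the point given by ω₀ contains S, so the bound
    -- for the square around that point applies.
    · refine (measure_mono ?_).trans ((H.measure_square_le hr₁ hr a₀ hω₀G.1 n).trans
        (ENNReal.ofReal_le_ofReal (Real.exp_le_exp.2 (hω₀G.2.2 n hn))))
      intro ω hω
      refine ⟨hω.2.1, ?_⟩
      have h1 := (Metric.edist_le_ediam_of_mem (s := S) (x := blockPoint a₀ ω)
        (y := blockPoint a₀ ω₀) hω.1 hω₀).trans hS
      exact (edist_le_ofReal (by positivity)).1 h1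

end BlockLaws

/-! ### Conclusion -/

/-- The infimum is a real number τ > 0. A number d > τ exceeds αq - T(q) for some q, whose heavy
squares bound the dimension by d; for 0 < d < τ, block laws built with τ bound it from below. -/
theorem dimH_levelSet_eq {r₁ r₂ : ℕ} (hr₁ : 2 ≤ r₁) (hr : r₁ ≤ r₂)
    {ψ : CylFun (Fin r₁ × Fin r₂)} (hψ : AlmostMultiplicative ψ) {α : ℝ}
    (hpos : 0 < legendre (Tfun ψ) α) :
    ((dimH (levelSet ψ α) : ENNReal) : EReal) = legendre (Tfun ψ) α := by
  have hl2 : 0 < Real.log r₂ := Real.log_pos (by exact_mod_cast hr₁.trans hr)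
  obtain ⟨τ, hτ⟩ : ∃ τ : ℝ, legendre (Tfun ψ) α = τ := by
    have hle : legendre (Tfun ψ) α ≤ ((α * 0 - Tfun ψ 0 : ℝ) : EReal) := iInf_le _ 0
    exact ⟨_, (EReal.coe_toReal (ne_top_of_le_ne_top (EReal.coe_ne_top _) hle)
      (bot_lt_of_lt hpos).ne').symm⟩
  have hτq : ∀ q, τ ≤ α * q - Tfun ψ q := by
    intro q
    have : legendre (Tfun ψ) α ≤ ((α * q - Tfun ψ q : ℝ) : EReal) := iInf_le _ q
    rw [hτ] at this
    exact EReal.coe_le_coe_iff.1 this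
  have hτ0 : 0 < τ := by
    rw [hτ] at hpos
    exact EReal.coe_pos.1 hpos
  have key : dimH (levelSet ψ α) = ENNReal.ofReal τ := by
    refine le_antisymm (ENNReal.le_of_forall_nnreal_lt fun d hd => ?_)
      (ENNReal.le_of_forall_nnreal_lt fun d hd => ?_)
    · by_contra! hlt
      have h2 : τ < d := by
        rwa [← ENNReal.ofReal_coe_nnreal, ENNReal.ofReal_lt_ofReal_iff_of_nonneg hτ0.le] at hlt
      have h3 : legendre (Tfun ψ) α < ((d : ℝ) : EReal) := by
        rw [hτ]
        exact EReal.coe_lt_coe_iff.2 h2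
      obtain ⟨q, hq⟩ := iInf_lt_iff.1 h3
      have h4 := dimH_levelSet_le hr₁ hr hψ (NNReal.coe_pos.1 (hτ0.trans h2))
        (EReal.coe_lt_coe_iff.1 hq)
      exact absurd (hd.trans_le h4) (lt_irrefl _)
    · rcases eq_or_ne d 0 with rfl | hd0
      · exact zero_le
      · have h2 : (d : ℝ) < τ := by
          rwa [← ENNReal.ofReal_coe_nnreal,
            ENNReal.ofReal_lt_ofReal_iff_of_nonneg d.coe_nonneg] at hd
        obtain ⟨C, hC, -⟩ := hψ.exists_almostMul
        obtain ⟨h, h', M, len, p, H, hh', hsum⟩ := exists_blockLaws hr₁ hr hψ hτq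
        refine H.le_dimH_levelSet hr₁ hr hC hh' (pos_iff_ne_zero.2 hd0) ?_
        rw [hsum]
        exact mul_lt_mul_of_pos_right h2 hl2
  rw [key, hτ, EReal.coe_ennreal_ofReal, max_eq_left hτ0.le]

theorem theorem3p1 (r₁ r₂ : ℕ) (hr₁ : 2 ≤ r₁) (hr : r₁ ≤ r₂)
    (ψ : CylFun (Fin r₁ × Fin r₂)) (hψ : AlmostMultiplicative ψ) (hP : HasPressure ψ 0) :
    -- the pressures that define `𝒯_ψ` exist
    (∀ q : ℝ, HasPressure (cylPow (fiberSum ψ q) (sExp r₁ r₂))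
      (pressure (cylPow (fiberSum ψ q) (sExp r₁ r₂)))) ∧
    -- (i)
    (ConcaveOn ℝ Set.univ (Tfun ψ) ∧ Differentiable ℝ (Tfun ψ) ∧ Monotone (Tfun ψ)) ∧
    -- (ii)
    (∀ α : ℝ, 0 ≤ α →
      (0 < legendre (Tfun ψ) α →
        ((dimH (levelSet ψ α) : ENNReal) : EReal) = legendre (Tfun ψ) α) ∧
      (legendre (Tfun ψ) α < 0 → levelSet ψ α = ∅)) := by
  refine ⟨fun q => hasPressure_cylPow_fiberSum hψ q _,
    Tfun_concave_differentiable_monotone hr₁ hr hψ hP,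
    fun α _ => ⟨dimH_levelSet_eq hr₁ hr hψ, fun hneg => ?_⟩⟩
  obtain ⟨q, hq⟩ := iInf_lt_iff.1 hneg
  exact levelSet_eq_empty hr₁ hr hψ (EReal.coe_neg'.1 hq)
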